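/- Let $\Sigma\subseteq\{0,\dots,\sigma\}$ be an integer alphabet and let $T=T[1..n]$ ($n\ge 1$) be a text whose last symbol, the end-marker, is strictly smaller than all other symbols of $T$ and occurs only at the end. Write $T_p=T[p..n]$, let $\mathrm{pos}(S)=n+1-|S|$ be the starting position of a suffix $S$, and let $\mathrm{lcp}$ be the length of the longest common prefix. Let $\preceq$ be either the lexicographic order or the text order ($X\preceq Y$ iff $|X|\ge|Y|$), with strict part $\prec$, and put $$\mathrm{GLPF}_{\preceq}[p]=\max\bigl(\{\mathrm{lcp}(T_p,T_q): q\in[n],\ T_q\prec T_p\}\cup\{0\}\bigr).$$ Let $G=\mathrm{CDAWG}(T)$ be the edge-labelled DAG obtained from the suffix tree of $T$ by merging all isomorphic subtrees, and let $e$ be the number of its edges plus the number of its suffix links. For a node $v$ let $\mathrm{rep}_-(v)$ be the longest string spelled by a root-to-$v$ path and $\mathrm{rep}_+(v)$ the $\preceq$-smallest string spelled by a $v$-to-sink path. An edge $(v,X,w)$ is $(-)$-primary if the path spelling $\mathrm{rep}_-(w)$ goes through it, $(+)$-primary if the path spelling $\mathrm{rep}_+(v)$ goes through it, and otherwise $(-)$-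 respectively $(+)$-secondary. For $\delta\in\{-,+\}$, a suffix is $\delta$-canonical if its root-to-sink path either consists of $\delta$-primary edges only, or has the form $P\,f\,Q$ with $f$ a $\delta$-secondary edge, all edges of $P$ $(-)$-primary and all edges of $Q$ $(+)$-primary. The quasi-irreducible GLPF array is $$\{(\mathrm{pos}(S),\ \mathrm{GLPF}_{\preceq}[\mathrm{pos}(S)]) : S \text{ is } \delta\text{-canonical}\};$$ both choices of $\delta$ give the same array. A self-index of $G$ without a text stores, for some numbering of the nodes and edges, the number $n$, the root, the sink, the end nodes, the label length and the first label symbol of each edge, the suffix links, and for each node the list of its outgoing edges and the list of its incoming edges, the latter in non-increasing order of $|\mathrm{rep}_-(w)|+|X|$ over the incoming edges $(w,X,v)$. Algorithm QIrrGLPF, on a self-index of $G$, first computes $|\mathrm{rep}_-(v)|$ and $|\mathrm{rep}_+(v)|$ for all nodes $v$ and marks the $(+)$-primary edges, by two depth-first searches with memoization: upward from the sink and downward from the root. It then calls the following recursive procedure at $v=\mathrm{sink}$. If $v$ has no incoming edge, output $(n+1-|\mathrm{rep}_+(v)|,\,0)$; otherwise, for each incoming edge $(w,X,v)$ in the listed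 order, call the procedure at $w$ if the edge is $(+)$-primary, and else output $(n+1-|\mathrm{rep}_-(w)|-|X|-|\mathrm{rep}_+(v)|,\ |\mathrm{rep}_-(w)|)$. **Theorem.** (a) For every such text and every $p\in[n]$, $\mathrm{GLPF}_{\mathrm{lex}}[p]=\mathrm{PLCP}[p]$ and $\mathrm{GLPF}_{\mathrm{pos}}[p]=\mathrm{LPF}[p]$. Here $\mathrm{PLCP}[p]$ is $0$ if $T_p$ is the lexicographically first suffix and otherwise is $\mathrm{lcp}(T_p,T_q)$ for the lexicographic predecessor $T_q$ of $T_p$ among the suffixes, and $\mathrm{LPF}[p]=\max(\{\mathrm{lcp}(T_p,T_q):1\le q<p\}\cup\{0\})$. (b) There is an absolute constant $C$ such that, for both orders $\preceq$, every such text $T$ and every self-index of $\mathrm{CDAWG}(T)$, Algorithm QIrrGLPF (including its preprocessing) terminates on a word RAM with recursive procedures, and its output is exactly the quasi-irreducible $\mathrm{GLPF}_{\preceq}$ array, in strictly increasing order of positions. The array has at most $e$ entries. The run takes at most $C e$ steps and at most $C e$ words of space (input, working arrays, call stack and output together), and no word ever holds a number larger than $C(n+\sigma+e)$. By (a), for the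 lexicographic order and the text order the output consists of samples of the PLCP and the LPF array, respectively. -/

import Mathlib

namespace Cdawg

/-! ## Strings, texts, suffixes -/

/-- Strings over the integer alphabet; a symbol is a natural number. -/
abbrev Str := List ℕ

/-- A text: a string whose last symbol, the end-marker, is smaller than all symbols before it
(in particular it occurs only once). -/
def IsText (T : Str) : Prop := ∃ (w : Str) (d : ℕ), T = w ++ [d] ∧ ∀ a ∈ w, d < a

/-- The set of nonempty suffixes of `T`. -/
def Suf (T : Str) : Set Str := {S | S ≠ [] ∧ S <:+ T}

/-- `T_p = T[p..n]`, where positions are counted from `1`. -/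
def sufAt (T : Str) (p : ℕ) : Str := T.drop (p - 1)

/-- The starting position `n + 1 - |S|` of a suffix `S` of `T`. -/
def pos (T S : Str) : ℕ := T.length + 1 - S.length

/-- Length of the longest common prefix. -/
def lcp : Str → Str → ℕ
  | a :: x, b :: y => if a = b then lcp x y + 1 else 0
  | _, _ => 0

/-! ## String orders and the arrays GLPF, PLCP, LPF -/

/-- The two lower path orders: the lexicographic order and the text order. -/
inductive PathOrder where
  | lex
  | pos

/-- `X ≼ Y`: lexicographic order, or `|X| ≥ |Y|` for the text order. -/
def PathOrder.le : PathOrder → Str → Str → Prop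
  | .lex, X, Y => X ≤ Y
  | .pos, X, Y => Y.length ≤ X.length

/-- The strict part of `≼`. -/
def PathOrder.lt (o : PathOrder) (X Y : Str) : Prop := o.le X Y ∧ ¬ o.le Y X

instance (o : PathOrder) (X Y : Str) : Decidable (o.le X Y) := by
  cases o <;> unfold PathOrder.le <;> infer_instance

instance (o : PathOrder) (X Y : Str) : Decidable (o.lt X Y) := by
  unfold PathOrder.lt; infer_instance

/-- `GLPF[p] = max ({lcp(T_p, T_q) | T_q ≺ T_p, q ∈ [n]} ∪ {0})`. -/
def GLPF (o : PathOrder) (T : Str) (p : ℕ) : ℕ :=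
  ((Finset.Icc 1 T.length).filter fun q => o.lt (sufAt T q) (sufAt T p)).sup
    fun q => lcp (sufAt T p) (sufAt T q)

/-- The suffix array: the positions `1, …, n` sorted by the lexicographic order of the suffixes. -/
def SA (T : Str) : List ℕ :=
  (List.range' 1 T.length).mergeSort fun p q => decide (sufAt T p ≤ sufAt T q)

/-- `PLCP[p]`: `0` if `T_p` is the lexicographically first suffix, and otherwise the length of the
longest common prefix of `T_p` with its predecessor in the suffix array. -/
def PLCP (T : Str) (p : ℕ) : ℕ :=
  if (SA T).idxOf p = 0 then 0
  else lcp (sufAt T p) (sufAt T ((SA T).getD ((SA T).idxOf p - 1) 0))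

/-- `LPF[p]`: the longest previous factor, the maximum of `lcp(T_p, T_q)` over `1 ≤ q < p`
(and `0` if there is no such `q`). -/
def LPF (T : Str) (p : ℕ) : ℕ :=
  (Finset.Ico 1 p).sup fun q => lcp (sufAt T p) (sufAt T q)

/-! ## The suffix tree -/

/-- The nodes of the suffix tree, i.e. of the compacted trie of all suffixes of `T`, named by the
string that leads to them: the root, the leaves, and the branching factors. -/
def IsSTNode (T u : Str) : Prop :=
  u = [] ∨ u ∈ Suf T ∨ ∃ a b, a ≠ b ∧ u ++ [a] <:+: T ∧ u ++ [b] <:+: T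

/-- The type of suffix tree nodes. -/
abbrev STNode (T : Str) := {u : Str // IsSTNode T u}

/-- `(u, X, v)` is an edge of the suffix tree: `v = uX`, `X` is nonempty, and no node lies strictly
between `u` and `v`. -/
def STEdge (T : Str) (u : STNode T) (X : Str) (v : STNode T) : Prop :=
  X ≠ [] ∧ v.1 = u.1 ++ X ∧ ∀ w : STNode T, u.1 <+: w.1 → w.1 <+: v.1 → w = u ∨ w = v

/-- The nodes of the subtree below `u`. -/
abbrev Subtree (T : Str) (u : STNode T) := {w : STNode T // u.1 <+: w.1}

/-- The subtrees below `u` and `v` are isomorphic as rooted trees with labelled edges. -/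
def SubtreeIso (T : Str) (u v : STNode T) : Prop :=
  ∃ φ : Subtree T u ≃ Subtree T v,
    (∀ x, x.1 = u ↔ (φ x).1 = v) ∧
    ∀ x X y, STEdge T x.1 X y.1 ↔ STEdge T (φ x).1 X (φ y).1

/-- Isomorphism of subtrees is an equivalence relation. -/
def isoSetoid (T : Str) : Setoid (STNode T) where
  r := SubtreeIso T
  iseqv :=
    { refl := fun u => ⟨Equiv.refl _, fun _ => Iff.rfl, fun _ _ _ => Iff.rfl⟩
      symm := by
        rintro u v ⟨φ, h1, h2⟩
        refine ⟨φ.symm, fun x => ?_, fun x X y => ?_⟩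
        · have := h1 (φ.symm x)
          simpa using this.symm
        · have := h2 (φ.symm x) X (φ.symm y)
          simpa using this.symm
      trans := by
        rintro u v w ⟨φ, h1, h2⟩ ⟨ψ, k1, k2⟩
        exact ⟨φ.trans ψ, fun x => (h1 x).trans (k1 (φ x)),
          fun x X y => (h2 x X y).trans (k2 (φ x) X (φ y))⟩ }

/-! ## The CDAWG: the suffix tree with isomorphic subtrees merged -/

/-- The nodes of `CDAWG(T)`. -/
def Node (T : Str) := Quotient (isoSetoid T)

/-- The CDAWG node into which a suffix tree node is merged. -/
def cls {T : Str} (u : STNode T) : Node T := Quotient.mk (isoSetoid T) u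

/-- Triples `(v, X, w)`: source, label, destination. -/
abbrev Edge (T : Str) := Node T × Str × Node T

/-- The source of an edge. -/
abbrev Edge.src {T : Str} (f : Edge T) : Node T := f.1
/-- The label of an edge. -/
abbrev Edge.lab {T : Str} (f : Edge T) : Str := f.2.1
/-- The destination of an edge. -/
abbrev Edge.dst {T : Str} (f : Edge T) : Node T := f.2.2

/-- The edges of `CDAWG(T)`: the images of the edges of the suffix tree. -/
def edges (T : Str) : Set (Edge T) :=
  {f | ∃ u X v, STEdge T u X v ∧ f = (cls u, X, cls v)}

/-- The suffix links of `CDAWG(T)`: the images of the suffix links `aY ↦ Y` of the suffix tree,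
without the loops that arise when both ends are merged. -/
def sufLinks (T : Str) : Set (Node T × Node T) :=
  {l | l.1 ≠ l.2 ∧ ∃ (u v : STNode T) (a : ℕ), u.1 = a :: v.1 ∧ l = (cls u, cls v)}

/-- The root. -/
def root (T : Str) : Node T := cls ⟨[], Or.inl rfl⟩

/-- The sink, into which all the leaves (such as the suffix `T` itself) are merged. -/
def sink (T : Str) : Node T :=
  cls ⟨T, by
    by_cases h : T = []
    · exact Or.inl h
    · exact Or.inr (Or.inl ⟨h, List.suffix_rfl⟩)⟩

/-- The size `e = e_R + e_L`: the number of edges plus the number of suffix links. -/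
noncomputable def size (T : Str) : ℕ := (edges T).ncard + (sufLinks T).ncard

/-- `IsPath v π w`: the list of edges `π` is a path from `v` to `w`. -/
inductive IsPath {T : Str} : Node T → List (Edge T) → Node T → Prop
  | nil (v : Node T) : IsPath v [] v
  | cons {f : Edge T} {π : List (Edge T)} {w : Node T} :
      f ∈ edges T → IsPath f.dst π w → IsPath f.src (f :: π) w

/-- The string spelled by a path. -/
def str {T : Str} (π : List (Edge T)) : Str := (π.map Edge.lab).flatten

/-- The two sides: `up` is `(-)`, `down` is `(+)`. -/
inductive Side where
  | up
  | down

/-- `U_δ(v)`: the strings spelled by the root-to-`v` paths (upper side) or by the `v`-to-sink paths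
(lower side). -/
def U {T : Str} : Side → Node T → Set Str
  | .up, v => {X | ∃ π, IsPath (root T) π v ∧ str π = X}
  | .down, v => {X | ∃ π, IsPath v π (sink T) ∧ str π = X}

/-- The path order on each side, for the pair (text order, `o`). -/
def sideOrder (o : PathOrder) : Side → PathOrder
  | .up => .pos
  | .down => o

/-- The `δ`-representative of `v`: the smallest element of `U_δ(v)`. -/
noncomputable def rep (o : PathOrder) {T : Str} (δ : Side) (v : Node T) : Str :=
  Classical.epsilon fun X => X ∈ U δ v ∧ ∀ Y ∈ U δ v, (sideOrder o δ).le X Y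

/-- `f` is `δ`-primary: the path spelling the `δ`-representative of the destination (for `up`) or of
the source (for `down`) goes through `f`. -/
def IsPrimary (o : PathOrder) {T : Str} : Side → Edge T → Prop
  | .up, f => ∃ π, IsPath (root T) (π ++ [f]) f.dst ∧ str (π ++ [f]) = rep o .up f.dst
  | .down, f => ∃ π, IsPath f.src (f :: π) (sink T) ∧ str (f :: π) = rep o .down f.src

/-- The `δ`-canonical suffixes: those spelled by a root-to-sink path that either consists of
`δ`-primary edges only (trivial case) or has the form `P · f · Q` where `f` is `δ`-secondary,
`P` has `(-)`-primary edges only and `Q` has `(+)`-primary edges only. -/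
def CS (o : PathOrder) (T : Str) (δ : Side) : Set Str :=
  {S | ∃ π : List (Edge T), IsPath (root T) π (sink T) ∧ str π = S ∧
    ((∀ f ∈ π, IsPrimary o δ f) ∨
      ∃ P f Q, π = P ++ f :: Q ∧ ¬ IsPrimary o δ f ∧
        (∀ g ∈ P, IsPrimary o .up g) ∧ (∀ g ∈ Q, IsPrimary o .down g))}

/-- The quasi-irreducible GLPF array, as a set of index-value pairs indexed by the canonical
suffixes. -/
def qirGLPF (o : PathOrder) (T : Str) (δ : Side) : Set (ℕ × ℕ) :=
  {x | ∃ S ∈ CS o T δ, x = (pos T S, GLPF o T (pos T S))}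

/-! ## A word RAM with finitely many arrays and recursive procedures

`ι` is the type of array names and `κ` the type of procedure names. Interleaving the arrays gives
the usual random access memory. A call opens a stack frame whose words are the local variables. -/

/-- Expressions: constants, local variables, array entries, sum, truncated difference. -/
inductive Expr (ι : Type) where
  | num (k : ℕ)
  | var (x : ℕ)
  | arr (a : ι) (i : Expr ι)
  | add (s t : Expr ι)
  | sub (s t : Expr ι)

/-- Conditions. -/
inductive Cond (ι : Type) where
  | lt (s t : Expr ι)
  | eq (s t : Expr ι)
  | or (c d : Cond ι)

/-- Statements. `call k t` calls the procedure `k`, whose variable `0` receives the value of `t`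
and whose other variables start at `0`. `emit s t` writes a pair to the output. -/
inductive Stmt (ι κ : Type) where
  | skip
  | assign (x : ℕ) (t : Expr ι)
  | store (a : ι) (i t : Expr ι)
  | emit (s t : Expr ι)
  | seq (s t : Stmt ι κ)
  | ite (c : Cond ι) (s t : Stmt ι κ)
  | while (c : Cond ι) (s : Stmt ι κ)
  | call (k : κ) (t : Expr ι)

/-- Resources used by a computation: the number of steps; one more than the largest array index
accessed; the largest number of words on the call stack; the largest number held in a word. -/
structure Cost where
  time : ℕ
  addr : ℕ
  stack : ℕ
  word : ℕ

/-- Resources of two computations in a row. -/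
def Cost.seq (c d : Cost) : Cost :=
  ⟨c.time + d.time, max c.addr d.addr, max c.stack d.stack, max c.word d.word⟩

/-- Resources of one elementary step that yields or moves the word `w`. -/
def Cost.step (w : ℕ) : Cost := ⟨1, 0, 0, w⟩

/-- Resources of one access to the array entry with index `i` that holds the word `w`. -/
def Cost.access (i w : ℕ) : Cost := ⟨1, i + 1, 0, w⟩

/-- Machine state: local variables of the current frame, arrays, output written so far. -/
structure State (ι : Type) where
  loc : ℕ → ℕ
  mem : ι → ℕ → ℕ
  out : List (ℕ × ℕ)

namespace Expr

variable {ι : Type}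

/-- The value of an expression. -/
def eval (σ : State ι) : Expr ι → ℕ
  | num k => k
  | var x => σ.loc x
  | arr a i => σ.mem a (i.eval σ)
  | add s t => s.eval σ + t.eval σ
  | sub s t => s.eval σ - t.eval σ

/-- The resources needed to evaluate an expression. -/
def cost (σ : State ι) : Expr ι → Cost
  | num k => .step k
  | var x => .step (σ.loc x)
  | arr a i => (i.cost σ).seq (.access (i.eval σ) (σ.mem a (i.eval σ)))
  | add s t => ((s.cost σ).seq (t.cost σ)).seq (.step (s.eval σ + t.eval σ))
  | sub s t => ((s.cost σ).seq (t.cost σ)).seq (.step (s.eval σ - t.eval σ))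

/-- One more than the largest number of a local variable in an expression. -/
def width : Expr ι → ℕ
  | num _ => 0
  | var x => x + 1
  | arr _ i => i.width
  | add s t => max s.width t.width
  | sub s t => max s.width t.width

end Expr

namespace Cond

variable {ι : Type}

/-- The truth value of a condition. -/
def eval (σ : State ι) : Cond ι → Bool
  | lt s t => decide (s.eval σ < t.eval σ)
  | eq s t => decide (s.eval σ = t.eval σ)
  | or c d => c.eval σ || d.eval σ

/-- The resources needed to evaluate a condition. -/
def cost (σ : State ι) : Cond ι → Cost
  | lt s t => ((s.cost σ).seq (t.cost σ)).seq (.step 1)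
  | eq s t => ((s.cost σ).seq (t.cost σ)).seq (.step 1)
  | or c d => ((c.cost σ).seq (d.cost σ)).seq (.step 1)

/-- One more than the largest number of a local variable in a condition. -/
def width : Cond ι → ℕ
  | lt s t => max s.width t.width
  | eq s t => max s.width t.width
  | or c d => max c.width d.width

end Cond

/-- The number of words of a stack frame for a procedure with the given body: its local variables
(numbered from `0`, the argument, on) and a return address. -/
def Stmt.frame {ι κ : Type} (s : Stmt ι κ) : ℕ := max 1 (go s) + 1
where
  /-- One more than the largest number of a local variable in a statement. -/
  go : Stmt ι κ → ℕ
  | .skip => 0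
  | .assign x t => max (x + 1) t.width
  | .store _ i t => max i.width t.width
  | .emit s t => max s.width t.width
  | .seq s t => max (go s) (go t)
  | .ite c s t => max c.width (max (go s) (go t))
  | .while c s => max c.width (go s)
  | .call _ t => t.width

/-- `Exec P s σ τ c`: with procedure bodies `P`, the statement `s` started in the state `σ`
terminates in the state `τ` and uses the resources `c`. -/
inductive Exec {ι κ : Type} [DecidableEq ι] (P : κ → Stmt ι κ) :
    Stmt ι κ → State ι → State ι → Cost → Prop
  | skip (σ) : Exec P .skip σ σ (.step 0)
  | assign (σ x t) :
      Exec P (.assign x t) σ { σ with loc := Function.update σ.loc x (t.eval σ) }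
        ((t.cost σ).seq (.step (t.eval σ)))
  | store (σ a i t) :
      Exec P (.store a i t) σ
        { σ with mem := Function.update σ.mem a
                          (Function.update (σ.mem a) (i.eval σ) (t.eval σ)) }
        (((i.cost σ).seq (t.cost σ)).seq (.access (i.eval σ) (t.eval σ)))
  | emit (σ s t) :
      Exec P (.emit s t) σ { σ with out := σ.out ++ [(s.eval σ, t.eval σ)] }
        (((s.cost σ).seq (t.cost σ)).seq (.step 0))
  | seq {s t σ σ' σ'' c d} :
      Exec P s σ σ' c → Exec P t σ' σ'' d → Exec P (.seq s t) σ σ'' (c.seq d)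
  | ite_true {b s t σ σ' c} :
      b.eval σ = true → Exec P s σ σ' c → Exec P (.ite b s t) σ σ' ((b.cost σ).seq c)
  | ite_false {b s t σ σ' c} :
      b.eval σ = false → Exec P t σ σ' c → Exec P (.ite b s t) σ σ' ((b.cost σ).seq c)
  | while_false {b s σ} :
      b.eval σ = false → Exec P (.while b s) σ σ (b.cost σ)
  | while_true {b s σ σ' σ'' c d} :
      b.eval σ = true → Exec P s σ σ' c → Exec P (.while b s) σ' σ'' d →
      Exec P (.while b s) σ σ'' (((b.cost σ).seq c).seq d)
  | call {k t σ τ c} :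
      Exec P (P k) ⟨Function.update (fun _ => 0) 0 (t.eval σ), σ.mem, σ.out⟩ τ c →
      Exec P (.call k t) σ ⟨σ.loc, τ.mem, τ.out⟩
        ((t.cost σ).seq
          ⟨c.time + (P k).frame, c.addr, c.stack + (P k).frame, c.word⟩)

/-! ## The self-index of the ordered CDAWG, without a text -/

/-- The data of a self-index. Nodes are numbered `0, …, numV - 1` and edges `0, …, numE - 1`.
An edge is stored by its end nodes, the length of its label and the first symbol of its label.
The edges entering node `v` are `inAdj[inPtr[v]], …, inAdj[inPtr[v+1] - 1]`, and the edges leaving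
it are `outAdj[outPtr[v]], …, outAdj[outPtr[v+1] - 1]`. -/
structure SelfIndex where
  n : ℕ
  numV : ℕ
  numE : ℕ
  root : ℕ
  sink : ℕ
  src : ℕ → ℕ
  dst : ℕ → ℕ
  len : ℕ → ℕ
  sym : ℕ → ℕ
  inPtr : ℕ → ℕ
  inAdj : ℕ → ℕ
  outPtr : ℕ → ℕ
  outAdj : ℕ → ℕ
  suf : ℕ → ℕ

/-- The number of words of a self-index: five numbers, six arrays indexed by the edges, two pointer
arrays of length `numV + 1`, and one array of suffix links indexed by the nodes. -/
def SelfIndex.words (D : SelfIndex) : ℕ := 5 + 6 * D.numE + 2 * (D.numV + 1) + D.numV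

/-- The entries `adj[ptr[v]], …, adj[ptr[v+1] - 1]` of an adjacency list. -/
def adjList (ptr adj : ℕ → ℕ) (v : ℕ) : List ℕ :=
  (List.range' (ptr v) (ptr (v + 1) - ptr v)).map adj

/-- `f` precedes `g` in the text order of edges entering a node:
`|rep(src f)| + |lab f| ≥ |rep(src g)| + |lab g|` for the upper representatives (which do not
depend on the lower path order). -/
def EdgePosLe {T : Str} (f g : Edge T) : Prop :=
  (rep .pos .up g.src).length + g.lab.length ≤ (rep .pos .up f.src).length + f.lab.length

/-- `D` is a self-index of `CDAWG(T)`, for some numbering of its nodes and edges, with the incoming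
edges of each node listed in the text order. The outgoing edges may be listed in any order. -/
structure SelfIndex.Represents (D : SelfIndex) (T : Str)
    (node : Fin D.numV ≃ Node T) (edge : Fin D.numE ≃ edges T) : Prop where
  n_eq : D.n = T.length
  root_eq : D.root = node.symm (Cdawg.root T)
  sink_eq : D.sink = node.symm (Cdawg.sink T)
  src_eq : ∀ i : Fin D.numE, D.src i = node.symm (edge i).1.src
  dst_eq : ∀ i : Fin D.numE, D.dst i = node.symm (edge i).1.dst
  len_eq : ∀ i : Fin D.numE, D.len i = (edge i).1.lab.length
  sym_eq : ∀ i : Fin D.numE, (edge i).1.lab.head? = some (D.sym i)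
  suf_eq : ∀ v w, (v, w) ∈ sufLinks T → D.suf (node.symm v) = node.symm w
  inPtr_zero : D.inPtr 0 = 0
  inPtr_mono : ∀ v < D.numV, D.inPtr v ≤ D.inPtr (v + 1)
  inPtr_last : D.inPtr D.numV = D.numE
  outPtr_zero : D.outPtr 0 = 0
  outPtr_mono : ∀ v < D.numV, D.outPtr v ≤ D.outPtr (v + 1)
  outPtr_last : D.outPtr D.numV = D.numE
  in_nodup : ∀ v : Fin D.numV, (adjList D.inPtr D.inAdj v).Nodup
  out_nodup : ∀ v : Fin D.numV, (adjList D.outPtr D.outAdj v).Nodup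
  mem_in : ∀ (v : Fin D.numV) (i : ℕ), i ∈ adjList D.inPtr D.inAdj v ↔
    ∃ h : i < D.numE, (edge ⟨i, h⟩).1.dst = node v
  mem_out : ∀ (v : Fin D.numV) (i : ℕ), i ∈ adjList D.outPtr D.outAdj v ↔
    ∃ h : i < D.numE, (edge ⟨i, h⟩).1.src = node v
  in_sorted : ∀ v : Fin D.numV, (adjList D.inPtr D.inAdj v).Pairwise fun i j =>
    ∀ (hi : i < D.numE) (hj : j < D.numE), EdgePosLe (edge ⟨i, hi⟩).1 (edge ⟨j, hj⟩).1

/-- `D` is a self-index of `CDAWG(T)`, for some numbering of its nodes and edges. -/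
def SelfIndex.IsFor (D : SelfIndex) (T : Str) : Prop :=
  ∃ (node : Fin D.numV ≃ Node T) (edge : Fin D.numE ≃ edges T), D.Represents T node edge

/-! ## The algorithm -/

/-- The arrays: those of the input self-index, and the working arrays for the lengths of the upper
and lower representatives, the marks of visited nodes, and the marks of `(+)`-primary edges. -/
inductive Arr where
  | n | numV | numE | root | sink
  | src | dst | len | sym | inPtr | inAdj | outPtr | outAdj | suf
  | repUp | repDown | seenUp | seenDown | primary
  deriving DecidableEq

instance : Fintype Arr where
  elems := {.n, .numV, .numE, .root, .sink, .src, .dst, .len, .sym, .inPtr, .inAdj, .outPtr,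
    .outAdj, .suf, .repUp, .repDown, .seenUp, .seenDown, .primary}
  complete := by intro a; cases a <;> decide

/-- The procedures. -/
inductive Proc where
  | prepUpward
  | prepDownward
  | qIrrGLPF

/-- The initial state: the arrays hold the self-index, the working arrays hold zeros, and the
output is empty. -/
def SelfIndex.init (D : SelfIndex) : State Arr where
  loc := fun _ => 0
  mem
    | .n => Pi.single 0 D.n
    | .numV => Pi.single 0 D.numV
    | .numE => Pi.single 0 D.numE
    | .root => Pi.single 0 D.root
    | .sink => Pi.single 0 D.sink
    | .src => D.src
    | .dst => D.dst
    | .len => D.len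
    | .sym => D.sym
    | .inPtr => D.inPtr
    | .inAdj => D.inAdj
    | .outPtr => D.outPtr
    | .outAdj => D.outAdj
    | .suf => D.suf
    | .repUp | .repDown | .seenUp | .seenDown | .primary => 0
  out := []

namespace Alg

/-- Argument of each procedure: a node. -/
abbrev v : Expr Arr := .var 0
/-- Position in an adjacency list. -/
abbrev j : Expr Arr := .var 1
/-- Current edge. -/
abbrev f : Expr Arr := .var 2
/-- Other end of the current edge. -/
abbrev w : Expr Arr := .var 3
/-- Length of the best path found so far. -/
abbrev bestLen : Expr Arr := .var 4
/-- First edge of the best path found so far. -/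
abbrev best : Expr Arr := .var 5

/-- A block of statements. -/
def block {ι κ : Type} (l : List (Stmt ι κ)) : Stmt ι κ := l.foldr .seq .skip

/-- `for each edge f = adj[j] in the adjacency list of v: w ← other[f]; body`. -/
def forEach {κ : Type} (ptr adj other : Arr) (body : Stmt Arr κ) : Stmt Arr κ :=
  block [
    .assign 1 (.arr ptr v),
    .while (.lt j (.arr ptr (.add v (.num 1)))) (block [
      .assign 2 (.arr adj j),
      .assign 3 (.arr other f),
      body,
      .assign 1 (.add j (.num 1))])]

/-- The adjacency list of `v` is empty. -/
def isEmpty (ptr : Arr) : Cond Arr := .eq (.arr ptr v) (.arr ptr (.add v (.num 1)))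

/-- Computes the lengths of the upper representatives of `v` and of all nodes above it. -/
def prepUpward : Stmt Arr Proc :=
  .ite (.eq (.arr .seenUp v) (.num 1)) .skip
    (.ite (isEmpty .inPtr)
      (block [
        .store .repUp v (.num 0),
        .store .seenUp v (.num 1)])
      (block [
        .assign 4 (.num 0),
        forEach .inPtr .inAdj .src (block [
          .call .prepUpward w,
          .ite (.lt bestLen (.add (.arr .repUp w) (.arr .len f)))
            (.assign 4 (.add (.arr .repUp w) (.arr .len f)))
            .skip]),
        .store .repUp v bestLen,
        .store .seenUp v (.num 1)]))

/-- The test whether the best lower path through the current edge precedes the best path so far: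
by the first symbols for the lexicographic order, by the lengths for the text order. -/
def better : PathOrder → Cond Arr
  | .lex => .lt (.arr .sym f) (.arr .sym best)
  | .pos => .lt bestLen (.add (.arr .len f) (.arr .repDown w))

/-- Computes the lengths of the lower representatives of `v` and of all nodes below it, and marks
the `(+)`-primary edges leaving them. (While no path has been found, `bestLen` is `0`.) -/
def prepDownward (o : PathOrder) : Stmt Arr Proc :=
  .ite (.eq (.arr .seenDown v) (.num 1)) .skip
    (.ite (isEmpty .outPtr)
      (block [
        .store .repDown v (.num 0),
        .store .seenDown v (.num 1)])
      (block [
        .assign 4 (.num 0),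
        forEach .outPtr .outAdj .dst (block [
          .call .prepDownward w,
          .ite (.or (.eq bestLen (.num 0)) (better o))
            (block [
              .assign 4 (.add (.arr .len f) (.arr .repDown w)),
              .assign 5 f])
            .skip]),
        .store .primary best (.num 1),
        .store .repDown v bestLen,
        .store .seenDown v (.num 1)]))

/-- The recursive procedure that writes the quasi-irreducible GLPF array, by the backward
depth-first search along `(+)`-primary edges. At the root it writes the entry of the trivial
suffix, whose length is that of the lower representative of the root. -/
def qIrrGLPF : Stmt Arr Proc :=
  .ite (isEmpty .inPtr)
    (.emit (.sub (.add (.arr .n (.num 0)) (.num 1)) (.arr .repDown v)) (.num 0))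
    (forEach .inPtr .inAdj .src
      (.ite (.eq (.arr .primary f) (.num 1))
        (.call .qIrrGLPF w)
        (.emit
          (.sub (.sub (.sub (.add (.arr .n (.num 0)) (.num 1)) (.arr .repUp w)) (.arr .len f))
            (.arr .repDown v))
          (.arr .repUp w))))

/-- The procedure bodies. -/
def procs (o : PathOrder) : Proc → Stmt Arr Proc
  | .prepUpward => prepUpward
  | .prepDownward => prepDownward o
  | .qIrrGLPF => qIrrGLPF

/-- The whole algorithm: the preprocessing, then the backward search from the sink. -/
def main : Stmt Arr Proc :=
  block [
    .call .prepUpward (.arr .sink (.num 0)),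
    .call .prepDownward (.arr .root (.num 0)),
    .call .qIrrGLPF (.arr .sink (.num 0))]

end Alg

/-- The number of words of space of a run of the algorithm on the self-index `D`: the input, the
arrays up to the largest index accessed in any of them, the call stack, and the output. -/
def space (D : SelfIndex) (c : Cost) (out : List (ℕ × ℕ)) : ℕ :=
  D.words + Fintype.card Arr * c.addr + c.stack + 2 * out.length

end Cdawg

open Cdawg

namespace Cdawg

/-! ## Longest common prefixes and string orders -/

/-! Two nodes of the suffix tree are merged exactly when the same strings extend them to suffixes of
`T` (`cls_eq_iff_conts`). So the strings below a CDAWG node are the continuations of any of its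
members, and its members form a chain under the suffix relation, each determined by its length.
Representatives are therefore unique, and an edge is primary exactly when the representative of one
end is obtained from that of the other end by attaching the label (`isPrimary_up_iff`,
`isPrimary_down_iff`).

Hence a canonical suffix is either the smallest suffix or `viaEdge o f` for a `(+)`-secondary edge
`f` (`mem_CS_iff`). The first has GLPF value 0. The second has the value `|rep_-(src f)|`
(`GLPF_pos_viaEdge`): leaving the source by its primary edge instead gives a strictly smaller suffix
with that common prefix; a suffix agreeing for longer would branch off only at or below the
destination, where the lower representative is already smallest. That both sides give the same array
is a statement about lists (`split_swap`): both describe paths whose edges are `(-)`-primary before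
some position and `(+)`-primary after it.

Every node but the sink has exactly one `(+)`-primary outgoing edge, so these edges form a tree
directed to the sink. The backward search traverses this tree: it visits each node once and writes
one pair for each secondary edge and one at the root. The order of the output rests on
`length_lt_of_edgePosLe`: at a node, all members spelled through an earlier incoming edge are longer
than all members spelled through a later one. Otherwise the suffix chain would sandwich a member of
one edge between two members of the other. A suffix of a node is again a node, so unequal label
lengths would put a node strictly inside an edge; with equal labels the sandwich forces equal
sources, hence equal edges. Along primary edges the lower representatives only absorb labels, so
longer members mean smaller positions at every level of the recursion.

The program is treated in a logic that tracks time, indices and word sizes. The structure `NumGraph`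
collects the numerical facts about the graph, so that the program proofs involve no strings. Both
memoized searches are paid from a potential that gives every unvisited node a constant plus a
multiple of its degree; all recursions terminate because `|rep_-|` strictly increases along edges.
Opening a stack frame costs as much time as it has words, so the stack bound comes from the time
bound.

For the identification with PLCP, the common prefix with a fixed string grows as smaller strings
approach it in lexicographic order, so the predecessor attains the maximum. For LPF, a smaller
suffix in the text order is one that starts earlier. -/

theorem lcp_append (z x y : Str) : lcp (z ++ x) (z ++ y) = z.length + lcp x y := by
  induction z with
  | nil => simp
  | cons a z ih => simp [lcp, ih]; omega

/-- Cut both strings at the first mismatch. Stating the mismatch through `head?` also covers the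
case in which a remainder is empty. -/
theorem lcp_spec (x y : Str) : ∃ z x' y', x = z ++ x' ∧ y = z ++ y' ∧ lcp x y = z.length ∧
    ∀ a, x'.head? = some a → y'.head? = some a → False := by
  induction x generalizing y with
  | nil => exact ⟨[], [], y, by simp [lcp]⟩
  | cons a x ih =>
    cases y with
    | nil => exact ⟨[], a :: x, [], by simp [lcp]⟩
    | cons b y =>
      by_cases h : a = b
      · subst h
        obtain ⟨z, x', y', rfl, rfl, h3, h4⟩ := ih y
        exact ⟨a :: z, x', y', by simp, by simp, by simp [lcp, h3], h4⟩
      · refine ⟨[], a :: x, b :: y, by simp, by simp, by simp [lcp, h], ?_⟩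
        simp only [List.head?_cons, Option.some.injEq]
        rintro c rfl rfl
        exact h rfl

theorem str_cons_le_cons (a b : ℕ) (x y : Str) :
    (a :: x ≤ b :: y) ↔ a < b ∨ a = b ∧ x ≤ y := by
  rw [le_iff_lt_or_eq, le_iff_lt_or_eq, List.cons_lt_cons_iff]
  simp only [List.cons.injEq]
  tauto

theorem not_cons_le_nil (a : ℕ) (x : Str) : ¬ (a :: x ≤ ([] : Str)) :=
  not_le.2 List.Lex.nil

theorem append_le_append_left_iff (z x y : Str) : (z ++ x ≤ z ++ y) ↔ x ≤ y := by
  induction z with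
  | nil => simp
  | cons a z ih =>
    rw [List.cons_append, List.cons_append, str_cons_le_cons]
    simp [ih]

/-- A prefix shared by the outer strings `x` and `z` is shared by everything between them. -/
theorem lcp_le_lcp_of_le {x y z : Str} (h : x ≤ y) (h' : y ≤ z) : lcp z x ≤ lcp z y := by
  induction z generalizing x y with
  | nil => simp [lcp]
  | cons c z ih =>
    cases x with
    | nil => simp [lcp]
    | cons a x =>
      cases y with
      | nil => exact absurd h (not_cons_le_nil _ _)
      | cons b y =>
        rw [str_cons_le_cons] at h h'
        simp only [lcp]
        by_cases hca : c = a
        · subst hca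
          have hb : c = b := by omega
          subst hb
          simp only [lt_irrefl, false_or, true_and] at h h'
          simpa using ih h h'
        · simp [hca]

/-! ### The two path orders -/

namespace PathOrder

variable (o : PathOrder)

theorem le_refl (X : Str) : o.le X X := by
  cases o <;> simp [PathOrder.le]

theorem le_total (X Y : Str) : o.le X Y ∨ o.le Y X := by
  cases o
  · exact _root_.le_total X Y
  · exact _root_.le_total _ _

variable {o}

theorem lt_of_not_le {X Y : Str} (h : ¬ o.le X Y) : o.lt Y X :=
  ⟨(o.le_total X Y).resolve_left h, h⟩

theorem append_le_append_left (Z X Y : Str) : o.le (Z ++ X) (Z ++ Y) ↔ o.le X Y := by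
  cases o
  · exact append_le_append_left_iff Z X Y
  · simp [PathOrder.le]

/-- The text order is only a preorder on strings, but a suffix of a fixed text is determined by its
length. -/
theorem antisymm_of_suffix {T X Y : Str} (hX : X <:+ T) (hY : Y <:+ T) (h : o.le X Y)
    (h' : o.le Y X) : X = Y := by
  cases o
  · exact le_antisymm (α := Str) h h'
  · have hl : X.length = Y.length := le_antisymm (α := ℕ) h' h
    exact (List.suffix_of_suffix_length_le hX hY hl.le).eq_of_length hl

end PathOrder

/-! ## Suffixes and positions -/

theorem sufAt_suffix (T : Str) (p : ℕ) : sufAt T p <:+ T := List.drop_suffix _ _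

theorem length_sufAt {T : Str} {p : ℕ} (hp : p ∈ Finset.Icc 1 T.length) :
    (sufAt T p).length = T.length + 1 - p := by
  simp only [Finset.mem_Icc] at hp
  simp only [sufAt, List.length_drop]
  omega

theorem sufAt_mem_Suf {T : Str} {p : ℕ} (hp : p ∈ Finset.Icc 1 T.length) :
    sufAt T p ∈ Suf T := by
  refine ⟨?_, sufAt_suffix T p⟩
  rw [← List.length_pos_iff, length_sufAt hp]
  simp only [Finset.mem_Icc] at hp
  omega

theorem length_le_of_mem_Suf {T S : Str} (hS : S ∈ Suf T) : S.length ≤ T.length :=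
  hS.2.length_le

theorem eq_of_suffix_of_length_eq {T X Y : Str} (hX : X <:+ T) (hY : Y <:+ T)
    (h : X.length = Y.length) : X = Y :=
  (List.suffix_of_suffix_length_le hX hY h.le).eq_of_length h

theorem pos_mem_Icc {T S : Str} (hS : S ∈ Suf T) : pos T S ∈ Finset.Icc 1 T.length := by
  have h1 := length_le_of_mem_Suf hS
  have h2 := List.length_pos_iff.2 hS.1
  simp only [pos, Finset.mem_Icc]
  omega

theorem sufAt_pos {T S : Str} (hS : S ∈ Suf T) : sufAt T (pos T S) = S := by
  refine eq_of_suffix_of_length_eq (sufAt_suffix _ _) hS.2 ?_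
  have h1 := length_le_of_mem_Suf hS
  have h2 := List.length_pos_iff.2 hS.1
  rw [length_sufAt (pos_mem_Icc hS), pos]
  omega

theorem sufAt_injOn {T : Str} {p q : ℕ} (hp : p ∈ Finset.Icc 1 T.length)
    (hq : q ∈ Finset.Icc 1 T.length) (h : sufAt T p = sufAt T q) : p = q := by
  have := congrArg List.length h
  rw [length_sufAt hp, length_sufAt hq] at this
  simp only [Finset.mem_Icc] at hp hq
  omega

/-- Replaces the supremum over positions by a quantifier over suffixes, the form in which the tree
arguments apply. -/
theorem GLPF_pos_le_iff {o : PathOrder} {T S : Str} (hS : S ∈ Suf T) (k : ℕ) :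
    GLPF o T (pos T S) ≤ k ↔ ∀ S' ∈ Suf T, o.lt S' S → lcp S S' ≤ k := by
  simp only [GLPF, Finset.sup_le_iff, Finset.mem_filter, sufAt_pos hS, and_imp]
  constructor
  · intro h S' hS' hlt
    have := h (pos T S') (pos_mem_Icc hS')
    rw [sufAt_pos hS'] at this
    exact this hlt
  · intro h q hq hlt
    exact h _ (sufAt_mem_Suf hq) hlt

theorem lcp_le_GLPF_pos {o : PathOrder} {T S S' : Str} (hS : S ∈ Suf T) (hS' : S' ∈ Suf T)
    (hlt : o.lt S' S) : lcp S S' ≤ GLPF o T (pos T S) :=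
  (GLPF_pos_le_iff hS _).1 le_rfl S' hS' hlt

/-! ## GLPF for the text order and for the lexicographic order -/

theorem GLPF_pos_eq_LPF {T : Str} {p : ℕ} (hp : p ∈ Finset.Icc 1 T.length) :
    GLPF .pos T p = LPF T p := by
  unfold GLPF LPF
  congr 1
  ext q
  simp only [Finset.mem_filter, Finset.mem_Ico]
  have hp' := Finset.mem_Icc.1 hp
  constructor
  · rintro ⟨hq, h1, h2⟩
    simp only [PathOrder.le, length_sufAt hp, length_sufAt hq] at h1 h2
    rw [Finset.mem_Icc] at hq
    omega
  · rintro ⟨h1, h2⟩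
    have hq : q ∈ Finset.Icc 1 T.length := Finset.mem_Icc.2 (by omega)
    refine ⟨hq, ?_⟩
    simp only [PathOrder.lt, PathOrder.le, length_sufAt hp, length_sufAt hq]
    omega

theorem mem_SA {T : Str} {p : ℕ} : p ∈ SA T ↔ p ∈ Finset.Icc 1 T.length := by
  simp only [SA, List.mem_mergeSort, List.mem_range', Finset.mem_Icc]
  constructor
  · rintro ⟨i, h, rfl⟩
    omega
  · intro h
    exact ⟨p - 1, by omega, by omega⟩

theorem SA_nodup (T : Str) : (SA T).Nodup :=
  (List.mergeSort_perm _ _).nodup_iff.2 List.nodup_range'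

theorem SA_sorted (T : Str) : (SA T).Pairwise fun p q => sufAt T p ≤ sufAt T q := by
  have := List.pairwise_mergeSort (le := fun p q => decide (sufAt T p ≤ sufAt T q))
    (by
      intro a b c h1 h2
      simp only [decide_eq_true_eq] at *
      exact h1.trans h2)
    (by
      intro a b
      simpa using _root_.le_total (sufAt T a) (sufAt T b))
    (List.range' 1 T.length)
  simpa [SA] using this

/-- All smaller suffixes stand earlier in the suffix array, and by `lcp_le_lcp_of_le` the last of
them has the longest common prefix with the given one. -/
theorem GLPF_lex_eq_PLCP {T : Str} {p : ℕ} (hp : p ∈ Finset.Icc 1 T.length) :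
    GLPF .lex T p = PLCP T p := by
  have hpl : p ∈ SA T := mem_SA.2 hp
  have hs := List.pairwise_iff_getElem.1 (SA_sorted T)
  have hi : (SA T).idxOf p < (SA T).length := List.idxOf_lt_length_iff.2 hpl
  have hgp : (SA T)[(SA T).idxOf p] = p := List.getElem_idxOf hi
  have hbefore : ∀ q ∈ Finset.Icc 1 T.length, PathOrder.lex.lt (sufAt T q) (sufAt T p) →
      ∃ k, ∃ hk : k < (SA T).length, k < (SA T).idxOf p ∧ (SA T)[k] = q := by
    intro q hq hlt
    have hk : (SA T).idxOf q < (SA T).length := List.idxOf_lt_length_iff.2 (mem_SA.2 hq)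
    have hgq : (SA T)[(SA T).idxOf q] = q := List.getElem_idxOf hk
    refine ⟨(SA T).idxOf q, hk, ?_, hgq⟩
    by_contra hcon
    rcases (not_lt.1 hcon).lt_or_eq with h | h
    · have := hs _ _ hi hk h
      rw [hgp, hgq] at this
      exact hlt.2 this
    · have : p = q := by rw [← hgp, ← hgq]; simp only [h]
      subst this
      exact hlt.2 (PathOrder.le_refl _ _)
  unfold PLCP
  split_ifs with h0
  · unfold GLPF
    rw [Finset.filter_eq_empty_iff.2]
    · rfl
    · intro q hq hlt
      obtain ⟨k, -, hk, -⟩ := hbefore q hq hlt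
      omega
  · have hi' : (SA T).idxOf p - 1 < (SA T).length := by omega
    rw [List.getD_eq_getElem _ _ hi']
    set r := (SA T)[(SA T).idxOf p - 1] with hr
    have hrI : r ∈ Finset.Icc 1 T.length := mem_SA.1 (List.getElem_mem hi')
    have hrp : sufAt T r ≤ sufAt T p := by
      have := hs _ _ hi' hi (by omega)
      rwa [hgp] at this
    apply le_antisymm
    · refine Finset.sup_le fun q hq => ?_
      rw [Finset.mem_filter] at hq
      obtain ⟨k, hk, hk1, hk2⟩ := hbefore q hq.1 hq.2
      refine lcp_le_lcp_of_le ?_ hrp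
      rcases (show k ≤ (SA T).idxOf p - 1 by omega).lt_or_eq with h | h
      · have := hs _ _ hk hi' h
        rwa [hk2] at this
      · rw [← hk2, hr]
        simp only [h]
        exact le_rfl
    · refine Finset.le_sup (f := fun q => lcp (sufAt T p) (sufAt T q))
        (Finset.mem_filter.2 ⟨hrI, hrp, fun hle => ?_⟩)
      have hne : r = p := sufAt_injOn hrI hp (le_antisymm (α := Str) hrp hle)
      have := (SA_nodup T).getElem_inj_iff (hi := hi') (hj := hi) |>.1 (by rw [hgp]; exact hne)
      omega

/-! ## The suffix tree -/

theorem IsText.ne_nil {T : Str} (hT : IsText T) : T ≠ [] := by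
  obtain ⟨w, d, rfl, -⟩ := hT
  simp

theorem IsText.self_mem_Suf {T : Str} (hT : IsText T) : T ∈ Suf T := ⟨hT.ne_nil, List.suffix_rfl⟩

/-- No suffix is a proper prefix of another suffix, because of the end-marker. -/
theorem IsText.eq_of_prefix {T S S' : Str} (hT : IsText T) (hS : S ∈ Suf T) (hS' : S' ∈ Suf T)
    (h : S <+: S') : S = S' := by
  obtain ⟨w, d, rfl, hd⟩ := hT
  have aux : ∀ {Y : Str}, Y ∈ Suf (w ++ [d]) → ∃ s, Y = s ++ [d] ∧ s <:+ w := by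
    rintro Y ⟨h1, h2⟩
    rcases List.suffix_concat_iff.1 h2 with h | ⟨t, rfl, ht⟩
    · exact absurd h h1
    · exact ⟨t, rfl, ht⟩
  obtain ⟨s, rfl, hs⟩ := aux hS
  obtain ⟨s', rfl, hs'⟩ := aux hS'
  rcases List.prefix_concat_iff.1 h with h | h
  · exact h
  · have : d ∈ w := hs'.subset (h.subset (by simp))
    exact absurd (hd d this) (lt_irrefl d)

/-- The strings that extend `u` to a suffix. -/
def conts (T u : Str) : Set Str := {X | u ++ X ∈ Suf T}

theorem mem_conts {T u X : Str} : X ∈ conts T u ↔ u ++ X ∈ Suf T := Iff.rfl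

theorem mem_conts_append {T u X Y : Str} : Y ∈ conts T (u ++ X) ↔ X ++ Y ∈ conts T u := by
  simp [mem_conts]

theorem conts_nil (T : Str) : conts T [] = Suf T := rfl

theorem suffix_of_mem_conts {T u X : Str} (h : X ∈ conts T u) : X <:+ T :=
  (List.suffix_append u X).trans h.2

theorem conts_of_mem_Suf {T S : Str} (hT : IsText T) (hS : S ∈ Suf T) : conts T S = {[]} := by
  ext X
  simp only [mem_conts, Set.mem_singleton_iff]
  constructor
  · intro h
    simpa using hT.eq_of_prefix hS h (List.prefix_append S X)
  · rintro rfl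
    simpa using hS

theorem infix_iff_conts {T u : Str} (hu : u ≠ []) : u <:+: T ↔ ∃ X, X ∈ conts T u := by
  constructor
  · rintro ⟨s, t, rfl⟩
    exact ⟨t, by simp [hu], s, by simp⟩
  · rintro ⟨X, -, s, rfl⟩
    exact ⟨s, X, by simp⟩

theorem concat_infix_iff {T u : Str} {a : ℕ} :
    u ++ [a] <:+: T ↔ ∃ Y, a :: Y ∈ conts T u := by
  rw [infix_iff_conts (by simp)]
  simp [mem_conts]

/-- Apart from the clause for the root, being a node depends on the set of continuations alone. -/
theorem isSTNode_iff {T u : Str} : IsSTNode T u ↔ u = [] ∨ [] ∈ conts T u ∨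
    ∃ a b Y Z, a ≠ b ∧ a :: Y ∈ conts T u ∧ b :: Z ∈ conts T u := by
  simp only [IsSTNode, concat_infix_iff, mem_conts, List.append_nil]
  constructor
  · rintro (h | h | ⟨a, b, h, ⟨Y, hY⟩, Z, hZ⟩)
    · exact Or.inl h
    · exact Or.inr (Or.inl h)
    · exact Or.inr (Or.inr ⟨a, b, Y, Z, h, hY, hZ⟩)
  · rintro (h | h | ⟨a, b, Y, Z, h, hY, hZ⟩)
    · exact Or.inl h
    · exact Or.inr (Or.inl h)
    · exact Or.inr (Or.inr ⟨a, b, h, ⟨Y, hY⟩, Z, hZ⟩)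

theorem conts_nonempty {T u : Str} (hT : IsText T) (hu : IsSTNode T u) : (conts T u).Nonempty := by
  rcases isSTNode_iff.1 hu with rfl | h | ⟨a, b, Y, Z, -, h, -⟩
  · exact ⟨T, hT.self_mem_Suf⟩
  · exact ⟨_, h⟩
  · exact ⟨_, h⟩

theorem IsSTNode.infix {T u : Str} (hT : IsText T) (hu : IsSTNode T u) : u <:+: T := by
  obtain ⟨X, -, s, h⟩ := conts_nonempty hT hu
  exact ⟨s, X, by simpa using h⟩

theorem isSTNode_of_mem_Suf {T S : Str} (hS : S ∈ Suf T) : IsSTNode T S := Or.inr (Or.inl hS)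

/-- A common prefix of two distinct suffixes after which they differ is a node. -/
theorem isSTNode_of_differ {T z x y : Str} (hT : IsText T) (hx : z ++ x ∈ Suf T)
    (hy : z ++ y ∈ Suf T) (hne : x ≠ y)
    (h : ∀ a, x.head? = some a → y.head? = some a → False) : IsSTNode T z := by
  cases x with
  | nil =>
    have := hT.eq_of_prefix hx hy (by simp)
    simp only [List.append_cancel_left_eq] at this
    exact absurd this hne
  | cons a x =>
    cases y with
    | nil =>
      have := hT.eq_of_prefix hy hx (by simp)
      simp at this
    | cons b y =>
      refine isSTNode_iff.2 (Or.inr (Or.inr ⟨a, b, x, y, ?_, hx, hy⟩))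
      rintro rfl
      exact h a rfl rfl

/-- The strings that lead from `u` to the nodes below it. -/
def below (T u : Str) : Set Str := {X | IsSTNode T (u ++ X)}

theorem mem_below {T u X : Str} : X ∈ below T u ↔ IsSTNode T (u ++ X) := Iff.rfl

theorem conts_subset_below {T u : Str} : conts T u ⊆ below T u :=
  fun _ h => isSTNode_of_mem_Suf h

/-- The leaves are the nodes with nothing below them, so the continuations can be read off from the
shape of the subtree. -/
theorem mem_conts_iff_below {T u X : Str} (hT : IsText T) :
    X ∈ conts T u ↔ X ∈ below T u ∧ ∀ Z, X ++ Z ∈ below T u → Z = [] := by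
  constructor
  · intro h
    refine ⟨conts_subset_below h, fun Z hZ => ?_⟩
    obtain ⟨Y, hY⟩ := conts_nonempty hT hZ
    have := hT.eq_of_prefix h hY ⟨Z ++ Y, by simp⟩
    have := congrArg List.length this
    simp only [List.length_append] at this
    exact List.length_eq_zero_iff.1 (by omega)
  · rintro ⟨h1, h2⟩
    obtain ⟨Y, hY⟩ := conts_nonempty hT h1
    have := h2 Y (conts_subset_below (mem_conts_append.1 hY))
    subst this
    simpa [mem_conts] using hY

/-- Equal continuations at `u` and `v` stay equal after appending any `X`, so the same extensions
are nodes. The clause for the root does no harm: only the empty string can be continued by the whole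
text. -/
theorem below_eq_of_conts_eq {T u v : Str} (hT : IsText T) (h : conts T u = conts T v)
    (hu : IsSTNode T u) : below T u = below T v := by
  have key : ∀ {u v : Str}, conts T u = conts T v → IsSTNode T u → below T u ⊆ below T v := by
    intro u v h hu X hX
    have hh : ∀ Y, Y ∈ conts T (u ++ X) ↔ Y ∈ conts T (v ++ X) := fun Y => by
      rw [mem_conts_append, mem_conts_append, h]
    rcases isSTNode_iff.1 hX with h0 | h1 | ⟨a, b, Y, Z, hne, hY, hZ⟩
    · simp only [List.append_eq_nil_iff] at h0
      obtain ⟨rfl, rfl⟩ := h0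
      have : T ∈ conts T v := h ▸ hT.self_mem_Suf
      have hl := length_le_of_mem_Suf this
      simp only [List.length_append] at hl
      have : v = [] := List.length_eq_zero_iff.1 (by omega)
      subst this
      exact Or.inl rfl
    · exact isSTNode_iff.2 (Or.inr (Or.inl ((hh _).1 h1)))
    · exact isSTNode_iff.2 (Or.inr (Or.inr ⟨a, b, Y, Z, hne, (hh _).1 hY, (hh _).1 hZ⟩))
  have hv : IsSTNode T v := by
    have : ([] : Str) ∈ below T v := key h hu (by simpa [mem_below] using hu)
    simpa [mem_below] using this
  exact Set.Subset.antisymm (key h hu) (key h.symm hv)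

/-! ### Edges of the suffix tree -/

theorem exists_edge {T : Str} {u v : STNode T} (h : u.1 <+: v.1) (hne : u ≠ v) :
    ∃ X w, STEdge T u X w ∧ w.1 <+: v.1 := by
  classical
  have hex : ∃ k, ∃ w : STNode T, u.1 <+: w.1 ∧ w.1 <+: v.1 ∧ w ≠ u ∧ w.1.length = k :=
    ⟨_, v, h, List.prefix_rfl, hne.symm, rfl⟩
  obtain ⟨w, h1, h2, h3, h4⟩ := Nat.find_spec hex
  obtain ⟨X, hX⟩ := h1
  refine ⟨X, w, ⟨?_, hX.symm, fun x hx1 hx2 => ?_⟩, h2⟩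
  · rintro rfl
    exact h3 (Subtype.ext (by simpa using hX.symm))
  · by_contra hcon
    push Not at hcon
    have hlt : x.1.length < w.1.length :=
      lt_of_le_of_ne hx2.length_le fun hl => hcon.2 (Subtype.ext (hx2.eq_of_length hl))
    exact Nat.find_min hex (h4 ▸ hlt) ⟨x, hx1, hx2.trans h2, hcon.1, rfl⟩

theorem exists_edge_into {T : Str} {u v : STNode T} (h : u.1 <+: v.1) (hne : u ≠ v) :
    ∃ w X, STEdge T w X v ∧ u.1 <+: w.1 := by
  classical
  have hex : ∃ k, ∃ w : STNode T, u.1 <+: w.1 ∧ w.1 <+: v.1 ∧ w ≠ v ∧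
      v.1.length - w.1.length = k := ⟨_, u, List.prefix_rfl, h, hne, rfl⟩
  obtain ⟨w, h1, h2, h3, h4⟩ := Nat.find_spec hex
  obtain ⟨X, hX⟩ := h2
  refine ⟨w, X, ⟨?_, hX.symm, fun x hx1 hx2 => ?_⟩, h1⟩
  · rintro rfl
    exact h3 (Subtype.ext (by simpa using hX))
  · by_contra hcon
    push Not at hcon
    have hlt : w.1.length < x.1.length :=
      lt_of_le_of_ne hx1.length_le fun hl => hcon.1 (Subtype.ext (hx1.eq_of_length hl)).symm
    have hle := hx2.length_le
    exact Nat.find_min hex (m := v.1.length - x.1.length) (by omega)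
      ⟨x, h1.trans hx1, hx2, hcon.2, rfl⟩

/-- Distinct edges leaving a node have distinct first symbols. -/
theorem STEdge.det {T : Str} (hT : IsText T) {u v v' : STNode T} {X X' : Str}
    (h : STEdge T u X v) (h' : STEdge T u X' v') (hh : X.head? = X'.head?) :
    X = X' ∧ v = v' := by
  suffices hs : v = v' by
    refine ⟨?_, hs⟩
    have := h.2.1.symm.trans ((congrArg Subtype.val hs).trans h'.2.1)
    simpa using this
  have aux : ∀ {v v' : STNode T} {X X' : Str}, STEdge T u X v → STEdge T u X' v' →
      v.1 <+: v'.1 → v = v' := by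
    intro v v' X X' h h' hp
    rcases h'.2.2 v (by rw [h.2.1]; simp) hp with e | e
    · have := h.2.1
      rw [e] at this
      simp only [List.self_eq_append_right] at this
      exact absurd this h.1
    · exact e
  obtain ⟨Y, hY⟩ := conts_nonempty hT v.2
  obtain ⟨Y', hY'⟩ := conts_nonempty hT v'.2
  obtain ⟨z, x, y, hx, hy, -, hxy⟩ := lcp_spec X X'
  cases hz : z with
  | nil =>
    subst hz
    simp only [List.nil_append] at hx hy
    subst hx hy
    cases X with
    | nil => exact absurd rfl h.1
    | cons a X => exact (hxy a rfl (by rw [← hh]; rfl)).elim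
  | cons c z' =>
    have hzne : z ≠ [] := by simp [hz]
    cases x with
    | nil =>
      exact aux h h' (by rw [h.2.1, h'.2.1, hx, hy]; simp)
    | cons a x =>
      cases y with
      | nil => exact (aux h' h (by rw [h.2.1, h'.2.1, hx, hy]; simp)).symm
      | cons b y =>
        have hab : a ≠ b := fun e => hxy a rfl (by rw [e]; rfl)
        -- The labels agree on the nonempty string `z` and then differ, so `u.1 ++ z` branches and
        -- would be a node strictly inside the first edge.
        have hn : IsSTNode T (u.1 ++ z) := by
          rw [mem_conts, h.2.1, hx] at hY
          rw [mem_conts, h'.2.1, hy] at hY'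
          exact isSTNode_iff.2 (Or.inr (Or.inr ⟨a, b, x ++ Y, y ++ Y', hab,
            by simpa [mem_conts] using hY, by simpa [mem_conts] using hY'⟩))
        rcases h.2.2 ⟨_, hn⟩ (by simp) (by rw [h.2.1, hx]; simp) with e | e
        · have := congrArg Subtype.val e
          exact absurd (by simpa using this) hzne
        · have := congrArg Subtype.val e
          simp only [h.2.1, hx, List.append_cancel_left_eq] at this
          simp at this

/-! ## Merging isomorphic subtrees -/

/-- The isomorphism preserves roots and labels, so by induction on the length of the node it sends
`u.1 ++ X` to `v.1 ++ X`. -/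
theorem below_subset_of_subtreeIso {T : Str} {u v : STNode T} (h : SubtreeIso T u v) :
    below T u.1 ⊆ below T v.1 := by
  obtain ⟨φ, h1, h2⟩ := h
  have key : ∀ k, ∀ x : Subtree T u, x.1.1.length = k →
      ∃ X, x.1.1 = u.1 ++ X ∧ (φ x).1.1 = v.1 ++ X := by
    intro k
    induction k using Nat.strong_induction_on with
    | _ k ih =>
      intro x hx
      by_cases hxu : x.1 = u
      · exact ⟨[], by simp [hxu], by simp [(h1 x).1 hxu]⟩
      · obtain ⟨w, X, hw, huw⟩ := exists_edge_into x.2 (Ne.symm hxu)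
        have hlen : w.1.length < k := by
          rw [← hx, hw.2.1, List.length_append]
          have := List.length_pos_iff.2 hw.1
          omega
        obtain ⟨Y, hY1, hY2⟩ := ih _ hlen ⟨w, huw⟩ rfl
        have hφ := (h2 ⟨w, huw⟩ X x).1 hw
        simp only at hY1
        refine ⟨Y ++ X, ?_, ?_⟩
        · rw [hw.2.1, hY1, List.append_assoc]
        · rw [hφ.2.1, hY2, List.append_assoc]
  intro X hX
  obtain ⟨Y, hY1, hY2⟩ := key _ ⟨⟨u.1 ++ X, hX⟩, List.prefix_append _ _⟩ rfl
  simp only [List.append_cancel_left_eq] at hY1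
  subst hY1
  rw [mem_below, ← hY2]
  exact (φ _).1.2

/-- The isomorphism replaces the prefix `u.1` by `v.1`. -/
theorem subtreeIso_of_below_eq {T : Str} {u v : STNode T} (h : below T u.1 = below T v.1) :
    SubtreeIso T u v := by
  have hdrop : ∀ {u : STNode T} (x : Subtree T u), u.1 ++ x.1.1.drop u.1.length = x.1.1 := by
    rintro u ⟨⟨x, hx⟩, t, ht⟩
    simp only at ht
    subst ht
    simp
  have hmem : ∀ {u v : STNode T}, below T u.1 = below T v.1 → ∀ x : Subtree T u,
      IsSTNode T (v.1 ++ x.1.1.drop u.1.length) := by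
    intro u v h x
    rw [← mem_below, ← h, mem_below, hdrop]
    exact x.1.2
  let φ : Subtree T u ≃ Subtree T v :=
    { toFun := fun x => ⟨⟨v.1 ++ x.1.1.drop u.1.length, hmem h x⟩, List.prefix_append _ _⟩
      invFun := fun x => ⟨⟨u.1 ++ x.1.1.drop v.1.length, hmem h.symm x⟩, List.prefix_append _ _⟩
      left_inv := fun x => Subtype.ext (Subtype.ext (by simp [hdrop]))
      right_inv := fun x => Subtype.ext (Subtype.ext (by simp [hdrop])) }
  have hφ : ∀ x X, x.1.1 = u.1 ++ X ↔ (φ x).1.1 = v.1 ++ X := by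
    intro x X
    constructor
    · intro hx
      simp [φ, hx]
    · intro hx
      simp only [φ, Equiv.coe_fn_mk, List.append_cancel_left_eq] at hx
      rw [← hx, hdrop]
  refine ⟨φ, fun x => ?_, fun x X y => ?_⟩
  · have := hφ x []
    simp only [List.append_nil] at this
    rw [Subtype.ext_iff, this, ← Subtype.ext_iff]
  · obtain ⟨A, hA⟩ : ∃ A, x.1.1 = u.1 ++ A := ⟨_, (hdrop x).symm⟩
    obtain ⟨B, hB⟩ : ∃ B, y.1.1 = u.1 ++ B := ⟨_, (hdrop y).symm⟩
    have hA' := (hφ x A).1 hA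
    have hB' := (hφ y B).1 hB
    have aux : ∀ {u v : STNode T} {x y x' y' : STNode T} {A B : Str}, below T u.1 = below T v.1 →
        x.1 = u.1 ++ A → y.1 = u.1 ++ B → x'.1 = v.1 ++ A → y'.1 = v.1 ++ B →
        STEdge T x X y → STEdge T x' X y' := by
      intro u v x y x' y' A B h hx hy hx' hy' ⟨e1, e2, e3⟩
      have hBA : B = A ++ X := by
        rw [hx, hy, List.append_assoc] at e2
        simpa using e2
      refine ⟨e1, by rw [hx', hy', hBA, List.append_assoc], ?_⟩
      rintro ⟨w, hw⟩ ⟨C, hC⟩ h2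
      simp only at hC h2
      subst hC
      have hAC : A ++ C ∈ below T u.1 := by
        rw [h, mem_below, ← List.append_assoc, ← hx']; exact hw
      have hCX : C <+: X := by
        rw [hx', hy', hBA, ← List.append_assoc] at h2
        simpa using h2
      rcases e3 ⟨_, hAC⟩ (by rw [hx]; exact ⟨C, by simp⟩)
        (by rw [hy, hBA, List.prefix_append_right_inj, List.prefix_append_right_inj]; exact hCX)
        with e | e
      · left
        have := congrArg Subtype.val e
        simp only [hx] at this
        have hC0 : C = [] := by simpa using this
        exact Subtype.ext (by simp [hC0])
      · right
        have := congrArg Subtype.val e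
        simp only [hy, hBA] at this
        have hC0 : C = X := by simpa using this
        exact Subtype.ext (by simp [hC0, hx', hy', hBA])
    exact ⟨aux h hA hB hA' hB', aux h.symm hA' hB' hA hB⟩

theorem cls_eq_iff_below {T : Str} {u v : STNode T} :
    cls u = cls v ↔ below T u.1 = below T v.1 := by
  constructor
  · intro h
    have h' : SubtreeIso T u v := Quotient.exact h
    exact Set.Subset.antisymm (below_subset_of_subtreeIso h')
      (below_subset_of_subtreeIso ((isoSetoid T).symm h'))
  · intro h
    exact Quotient.sound (subtreeIso_of_below_eq h)

/-- The working description of the CDAWG: from here on a node is handled through the common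
continuations of its members. -/
theorem cls_eq_iff_conts {T : Str} (hT : IsText T) {u v : STNode T} :
    cls u = cls v ↔ conts T u.1 = conts T v.1 := by
  rw [cls_eq_iff_below]
  constructor
  · intro h
    ext X
    rw [mem_conts_iff_below hT, mem_conts_iff_below hT, h]
  · intro h
    exact below_eq_of_conts_eq hT h u.2

theorem exists_cls {T : Str} (v : Node T) : ∃ u : STNode T, cls u = v := Quotient.exists_rep v

theorem cls_eq_sink_iff {T : Str} (hT : IsText T) {u : STNode T} :
    cls u = sink T ↔ u.1 ∈ Suf T := by
  rw [sink, cls_eq_iff_conts hT, conts_of_mem_Suf hT hT.self_mem_Suf]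
  constructor
  · intro h
    have : ([] : Str) ∈ conts T u.1 := by rw [h]; rfl
    simpa [mem_conts] using this
  · exact conts_of_mem_Suf hT

theorem cls_eq_root_iff {T : Str} (hT : IsText T) {u : STNode T} :
    cls u = root T ↔ u.1 = [] := by
  constructor
  · intro h
    rw [root, cls_eq_iff_conts hT] at h
    have : T ∈ conts T u.1 := by rw [h]; exact hT.self_mem_Suf
    have hl := length_le_of_mem_Suf this
    simp only [List.length_append] at hl
    exact List.length_eq_zero_iff.1 (by omega)
  · intro h
    unfold root
    congr 1
    exact Subtype.ext h

/-- Edges lift along the quotient map to every member of the source. -/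
theorem lift_edge {T : Str} {f : Edge T} (hf : f ∈ edges T) {u : STNode T}
    (hu : cls u = f.src) : ∃ v, STEdge T u f.lab v ∧ cls v = f.dst := by
  obtain ⟨u', X, v', ⟨h1, h2, h3⟩, rfl⟩ := hf
  have h := cls_eq_iff_below.1 hu
  have hX : IsSTNode T (u.1 ++ X) := by
    rw [← mem_below, h, mem_below, ← h2]
    exact v'.2
  refine ⟨⟨_, hX⟩, ⟨h1, rfl, ?_⟩, ?_⟩
  · rintro ⟨w, hw⟩ ⟨C, rfl⟩ hC2
    simp only [List.prefix_append_right_inj] at hC2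
    have hC : IsSTNode T (u'.1 ++ C) := by
      rw [← mem_below, ← h]; exact hw
    rcases h3 ⟨_, hC⟩ (by simp) (by rw [h2]; simpa using hC2) with e | e
    · left
      have := congrArg Subtype.val e
      have hC0 : C = [] := by simpa using this
      exact Subtype.ext (by simp [hC0])
    · right
      have := congrArg Subtype.val e
      simp only [h2, List.append_cancel_left_eq] at this
      exact Subtype.ext (by simp [this])
  · rw [cls_eq_iff_below]
    ext Y
    simp only [mem_below, h2, List.append_assoc]
    exact Set.ext_iff.1 h (X ++ Y)

theorem STEdge.mem_edges {T : Str} {u v : STNode T} {X : Str} (h : STEdge T u X v) :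
    (cls u, X, cls v) ∈ edges T := ⟨u, X, v, h, rfl⟩

theorem lab_ne_nil {T : Str} {f : Edge T} (hf : f ∈ edges T) : f.lab ≠ [] := by
  obtain ⟨u, X, v, h, rfl⟩ := hf
  exact h.1

/-- Distinct edges leaving a node of the CDAWG have distinct first symbols. -/
theorem edge_det {T : Str} (hT : IsText T) {f g : Edge T} (hf : f ∈ edges T) (hg : g ∈ edges T)
    (hs : f.src = g.src) (hh : f.lab.head? = g.lab.head?) : f = g := by
  obtain ⟨u, hu⟩ := exists_cls f.src
  obtain ⟨v, hv, hv'⟩ := lift_edge hf hu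
  obtain ⟨w, hw, hw'⟩ := lift_edge hg (hu.trans hs)
  obtain ⟨h1, h2⟩ := hv.det hT hw hh
  exact Prod.ext hs (Prod.ext h1 (hv'.symm.trans ((congrArg cls h2).trans hw')))

theorem edge_det_append {T : Str} (hT : IsText T) {f g : Edge T} (hf : f ∈ edges T)
    (hg : g ∈ edges T) (hs : f.src = g.src) {X Y : Str} (h : f.lab ++ X = g.lab ++ Y) : f = g := by
  refine edge_det hT hf hg hs ?_
  have := congrArg List.head? h
  rwa [List.head?_append_of_ne_nil _ (lab_ne_nil hf),
    List.head?_append_of_ne_nil _ (lab_ne_nil hg)] at this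

/-! ## Paths -/

theorem str_nil {T : Str} : str ([] : List (Edge T)) = [] := rfl

theorem str_cons {T : Str} (f : Edge T) (π : List (Edge T)) : str (f :: π) = f.lab ++ str π := rfl

theorem str_append {T : Str} (π ρ : List (Edge T)) : str (π ++ ρ) = str π ++ str ρ := by
  simp [str]

theorem IsPath.append {T : Str} {u v w : Node T} {π ρ : List (Edge T)} (h : IsPath u π v)
    (h' : IsPath v ρ w) : IsPath u (π ++ ρ) w := by
  induction h with
  | nil v => exact h'
  | cons hf _ ih => exact IsPath.cons hf (ih h')

theorem isPath_cons_iff {T : Str} {v w : Node T} {f : Edge T} {π : List (Edge T)} :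
    IsPath v (f :: π) w ↔ f ∈ edges T ∧ f.src = v ∧ IsPath f.dst π w := by
  constructor
  · intro h
    cases h with
    | cons hf h => exact ⟨hf, rfl, h⟩
  · rintro ⟨hf, rfl, h⟩
    exact .cons hf h

theorem isPath_nil_iff {T : Str} {v w : Node T} : IsPath v [] w ↔ v = w := by
  constructor
  · intro h
    cases h
    rfl
  · rintro rfl
    exact .nil v

theorem isPath_append_iff {T : Str} {u w : Node T} {π ρ : List (Edge T)} :
    IsPath u (π ++ ρ) w ↔ ∃ v, IsPath u π v ∧ IsPath v ρ w := by
  constructor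
  · intro h
    induction π generalizing u with
    | nil => exact ⟨u, .nil u, h⟩
    | cons f π ih =>
      obtain ⟨hf, rfl, hp⟩ := isPath_cons_iff.1 h
      obtain ⟨v, h1, h2⟩ := ih hp
      exact ⟨v, .cons hf h1, h2⟩
  · rintro ⟨v, h1, h2⟩
    exact h1.append h2

theorem lift_path {T : Str} {v w : Node T} {π : List (Edge T)} (h : IsPath v π w) {u : STNode T}
    (hu : cls u = v) : ∃ x : STNode T, cls x = w ∧ x.1 = u.1 ++ str π := by
  induction h generalizing u with
  | nil v => exact ⟨u, hu, by simp [str_nil]⟩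
  | cons hf _ ih =>
    obtain ⟨x, hx, hx'⟩ := lift_edge hf hu
    obtain ⟨y, hy, hy'⟩ := ih hx'
    exact ⟨y, hy, by rw [hy', hx.2.1, str_cons, List.append_assoc]⟩

theorem exists_path {T : Str} {u v : STNode T} (h : u.1 <+: v.1) :
    ∃ π, IsPath (cls u) π (cls v) ∧ u.1 ++ str π = v.1 := by
  induction hk : v.1.length - u.1.length using Nat.strong_induction_on generalizing u with
  | _ k ih =>
    by_cases hne : u = v
    · subst hne
      exact ⟨[], .nil _, by simp [str_nil]⟩
    · obtain ⟨X, w, hw, hwv⟩ := exists_edge h hne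
      have h1 := List.length_pos_iff.2 hw.1
      have h2 : w.1.length = u.1.length + X.length := by rw [hw.2.1, List.length_append]
      have h3 := hwv.length_le
      obtain ⟨π, hπ, hs⟩ := ih _ (by omega) hwv rfl
      refine ⟨(cls u, X, cls w) :: π, isPath_cons_iff.2 ⟨hw.mem_edges, rfl, hπ⟩, ?_⟩
      rw [str_cons, ← hs, hw.2.1, List.append_assoc]

/-- The members of a node, i.e. the strings spelled by the root-to-`v` paths. -/
theorem mem_U_up {T : Str} {v : Node T} {X : Str} :
    X ∈ U .up v ↔ ∃ u : STNode T, cls u = v ∧ u.1 = X := by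
  constructor
  · rintro ⟨π, hπ, rfl⟩
    obtain ⟨x, h1, h2⟩ := lift_path hπ (u := ⟨[], Or.inl rfl⟩) rfl
    exact ⟨x, h1, by simpa using h2⟩
  · rintro ⟨u, rfl, rfl⟩
    obtain ⟨π, h1, h2⟩ := exists_path (u := ⟨[], Or.inl rfl⟩) (v := u) (by simp)
    exact ⟨π, h1, by simpa using h2⟩

/-- Paths lift to the suffix tree from any member of their start, and the members of the sink are
exactly the suffixes. -/
theorem U_down_cls {T : Str} (hT : IsText T) (u : STNode T) : U .down (cls u) = conts T u.1 := by
  ext X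
  constructor
  · rintro ⟨π, hπ, rfl⟩
    obtain ⟨x, h1, h2⟩ := lift_path hπ rfl
    rw [mem_conts, ← h2]
    exact (cls_eq_sink_iff hT).1 h1
  · intro h
    obtain ⟨π, h1, h2⟩ := exists_path (u := u) (v := ⟨u.1 ++ X, isSTNode_of_mem_Suf h⟩)
      (List.prefix_append _ _)
    have hs : cls (⟨u.1 ++ X, isSTNode_of_mem_Suf h⟩ : STNode T) = sink T :=
      (cls_eq_sink_iff hT).2 h
    rw [hs] at h1
    exact ⟨π, h1, by simpa using h2⟩

theorem suffix_of_mem_U_down {T : Str} (hT : IsText T) {v : Node T} {X : Str}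
    (hX : X ∈ U .down v) : X <:+ T := by
  obtain ⟨u, rfl⟩ := exists_cls v
  rw [U_down_cls hT] at hX
  exact suffix_of_mem_conts hX

theorem append_mem_Suf {T : Str} (hT : IsText T) {v : Node T} {X Y : Str} (hX : X ∈ U .up v)
    (hY : Y ∈ U .down v) : X ++ Y ∈ Suf T := by
  obtain ⟨u, rfl, rfl⟩ := (mem_U_up).1 hX
  rwa [U_down_cls hT] at hY

theorem append_lab_mem_U_up {T : Str} {f : Edge T} (hf : f ∈ edges T) {X : Str}
    (hX : X ∈ U .up f.src) : X ++ f.lab ∈ U .up f.dst := by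
  obtain ⟨π, hπ, rfl⟩ := hX
  exact ⟨π ++ [f], hπ.append (.cons hf (.nil _)), by simp [str_append, str_cons, str_nil]⟩

theorem lab_append_mem_U_down {T : Str} {f : Edge T} (hf : f ∈ edges T) {X : Str}
    (hX : X ∈ U .down f.dst) : f.lab ++ X ∈ U .down f.src := by
  obtain ⟨π, hπ, rfl⟩ := hX
  exact ⟨f :: π, .cons hf hπ, by simp [str_cons]⟩

/-- Of two members of a node the shorter one is a suffix of the longer one. -/
theorem suffix_of_mem_U_up {T : Str} (hT : IsText T) {v : Node T} {X Y : Str} (hX : X ∈ U .up v)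
    (hY : Y ∈ U .up v) (h : X.length ≤ Y.length) : X <:+ Y := by
  obtain ⟨u, rfl, rfl⟩ := (mem_U_up).1 hX
  obtain ⟨Z, hZ⟩ := conts_nonempty hT u.2
  rw [← U_down_cls hT] at hZ
  have h1 := append_mem_Suf hT hX hZ
  have h2 := append_mem_Suf hT hY hZ
  -- Followed by the common continuation `Z`, both members become suffixes of `T`, which are nested;
  -- then `Z` is cancelled.
  have h3 := List.suffix_of_suffix_length_le h1.2 h2.2 (by simpa using h)
  exact ((List.suffix_append_inj_of_length_eq rfl).1 h3).1

theorem eq_of_mem_U_up {T : Str} (hT : IsText T) {v : Node T} {X Y : Str} (hX : X ∈ U .up v)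
    (hY : Y ∈ U .up v) (h : X.length = Y.length) : X = Y :=
  (suffix_of_mem_U_up hT hX hY h.le).eq_of_length h

theorem U_up_root {T : Str} (hT : IsText T) : U .up (root T) = {[]} := by
  ext X
  rw [mem_U_up]
  simp only [cls_eq_root_iff hT, Set.mem_singleton_iff]
  constructor
  · rintro ⟨u, h, rfl⟩
    exact h
  · rintro rfl
    exact ⟨⟨[], Or.inl rfl⟩, rfl, rfl⟩

theorem U_down_sink {T : Str} (hT : IsText T) : U .down (sink T) = {[]} := by
  rw [sink, U_down_cls hT, conts_of_mem_Suf hT hT.self_mem_Suf]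

theorem U_down_root {T : Str} (hT : IsText T) : U .down (root T) = Suf T := by
  rw [root, U_down_cls hT, conts_nil]

theorem exists_edge_dst {T : Str} {v : Node T} (hv : v ≠ root T) :
    ∃ f ∈ edges T, f.dst = v := by
  obtain ⟨u, rfl⟩ := exists_cls v
  have hu : (⟨[], Or.inl rfl⟩ : STNode T) ≠ u := by
    rintro rfl
    exact hv rfl
  obtain ⟨w, X, h, -⟩ := exists_edge_into (by simp) hu
  exact ⟨_, h.mem_edges, rfl⟩

theorem dst_ne_root {T : Str} (hT : IsText T) {f : Edge T} (hf : f ∈ edges T) :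
    f.dst ≠ root T := by
  obtain ⟨u, X, v, h, rfl⟩ := hf
  intro e
  have := (cls_eq_root_iff hT).1 e
  rw [h.2.1] at this
  simp [h.1] at this

theorem src_ne_sink {T : Str} (hT : IsText T) {f : Edge T} (hf : f ∈ edges T) :
    f.src ≠ sink T := by
  obtain ⟨u, X, v, h, rfl⟩ := hf
  intro e
  have h1 := (mem_conts_iff_below hT (u := u.1) (X := [])).1
    (by simpa [mem_conts] using (cls_eq_sink_iff hT).1 e)
  exact h.1 (h1.2 X (by simpa [mem_below, ← h.2.1] using v.2))

/-! ## Representatives and primary edges -/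

theorem infix_of_mem_U {T : Str} (hT : IsText T) {δ : Side} {v : Node T} {X : Str}
    (hX : X ∈ U δ v) : X <:+: T := by
  cases δ
  · obtain ⟨u, -, rfl⟩ := mem_U_up.1 hX
    exact u.2.infix hT
  · exact (suffix_of_mem_U_down hT hX).isInfix

theorem U_nonempty {T : Str} (hT : IsText T) (δ : Side) (v : Node T) : (U δ v).Nonempty := by
  obtain ⟨u, rfl⟩ := exists_cls v
  cases δ
  · exact ⟨u.1, mem_U_up.2 ⟨u, rfl, rfl⟩⟩
  · rw [U_down_cls hT]
    exact conts_nonempty hT u.2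

theorem U_finite {T : Str} (hT : IsText T) (δ : Side) (v : Node T) : (U δ v).Finite := by
  refine (T.sublists.toFinset.finite_toSet).subset fun X hX => ?_
  simpa using (infix_of_mem_U hT hX).sublist

theorem PathOrder.exists_min (o : PathOrder) {s : Set Str} (hs : s.Finite) (hne : s.Nonempty) :
    ∃ X ∈ s, ∀ Y ∈ s, o.le X Y := by
  cases o
  · exact Set.exists_min_image s id hs hne
  · exact Set.exists_max_image s List.length hs hne

/-- The choice in `rep` is meaningful because the strings in question are factors of `T`: there are
finitely many, and at least one. -/
theorem rep_spec {T : Str} (hT : IsText T) (o : PathOrder) (δ : Side) (v : Node T) :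
    rep o δ v ∈ U δ v ∧ ∀ Y ∈ U δ v, (sideOrder o δ).le (rep o δ v) Y :=
  Classical.epsilon_spec (p := fun X => X ∈ U δ v ∧ ∀ Y ∈ U δ v, (sideOrder o δ).le X Y)
    ((sideOrder o δ).exists_min (U_finite hT δ v) (U_nonempty hT δ v))

theorem rep_mem {T : Str} (hT : IsText T) (o : PathOrder) (δ : Side) (v : Node T) :
    rep o δ v ∈ U δ v := (rep_spec hT o δ v).1

theorem length_le_rep {T : Str} (hT : IsText T) (o : PathOrder) {v : Node T} {X : Str}
    (hX : X ∈ U .up v) : X.length ≤ (rep o .up v).length := (rep_spec hT o .up v).2 X hX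

theorem rep_le {T : Str} (hT : IsText T) (o : PathOrder) {v : Node T} {X : Str}
    (hX : X ∈ U .down v) : o.le (rep o .down v) X := (rep_spec hT o .down v).2 X hX

theorem rep_root {T : Str} (hT : IsText T) (o : PathOrder) : rep o .up (root T) = [] := by
  simpa [U_up_root hT] using rep_mem hT o .up (root T)

theorem rep_sink {T : Str} (hT : IsText T) (o : PathOrder) : rep o .down (sink T) = [] := by
  simpa [U_down_sink hT] using rep_mem hT o .down (sink T)

theorem rep_antisymm {T : Str} (hT : IsText T) {o : PathOrder} {v : Node T} {X : Str}
    (hX : X ∈ U .down v) (h : o.le X (rep o .down v)) : X = rep o .down v :=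
  PathOrder.antisymm_of_suffix (suffix_of_mem_U_down hT hX)
    (suffix_of_mem_U_down hT (rep_mem hT o .down v)) h (rep_le hT o hX)

/-- The part before the last edge of a longest path must itself be longest, and a member of a node
is determined by its length. This makes primality a condition on the two representatives only. -/
theorem isPrimary_up_iff {T : Str} (hT : IsText T) {o : PathOrder} {f : Edge T}
    (hf : f ∈ edges T) : IsPrimary o .up f ↔ rep o .up f.dst = rep o .up f.src ++ f.lab := by
  have hsrc := rep_mem hT o .up f.src
  constructor
  · rintro ⟨π, hπ, hs⟩
    obtain ⟨x, h1, h2⟩ := isPath_append_iff.1 hπ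
    obtain ⟨-, rfl, -⟩ := isPath_cons_iff.1 h2
    rw [← hs, str_append, str_cons, str_nil, List.append_nil]
    have hmem : str π ∈ U .up f.src := ⟨π, h1, rfl⟩
    have h3 := length_le_rep hT o hmem
    have h4 := length_le_rep hT o (append_lab_mem_U_up hf hsrc)
    rw [← hs, str_append, str_cons, str_nil, List.append_nil] at h4
    simp only [List.length_append, add_le_add_iff_right] at h4
    rw [eq_of_mem_U_up hT hmem hsrc (le_antisymm h3 h4)]
  · intro h
    obtain ⟨π, hπ, hs⟩ := hsrc
    exact ⟨π, hπ.append (.cons hf (.nil _)), by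
      rw [str_append, str_cons, str_nil, List.append_nil, hs, h]⟩

/-- A common prefix does not affect `≼`, so the rest of a smallest path is smallest from the
destination on. -/
theorem isPrimary_down_iff {T : Str} (hT : IsText T) {o : PathOrder} {f : Edge T}
    (hf : f ∈ edges T) :
    IsPrimary o .down f ↔ rep o .down f.src = f.lab ++ rep o .down f.dst := by
  have hdst := rep_mem hT o .down f.dst
  constructor
  · rintro ⟨π, hπ, hs⟩
    obtain ⟨-, -, h2⟩ := isPath_cons_iff.1 hπ
    have hmem : str π ∈ U .down f.dst := ⟨π, h2, rfl⟩
    have h4 := rep_le hT o (lab_append_mem_U_down hf hdst)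
    rw [← hs, str_cons, PathOrder.append_le_append_left] at h4
    rw [← hs, str_cons, rep_antisymm hT hmem h4]
  · intro h
    obtain ⟨π, hπ, hs⟩ := hdst
    exact ⟨π, .cons hf hπ, by rw [str_cons, hs, h]⟩

/-- Equality at the end of the path leaves no slack at any edge: a shorter intermediate member would
make the final one too short. -/
theorem IsPath.all_up_iff {T : Str} (hT : IsText T) {o : PathOrder} {v w : Node T}
    {π : List (Edge T)} (h : IsPath v π w) :
    (∀ f ∈ π, IsPrimary o .up f) ↔ rep o .up w = rep o .up v ++ str π := by
  induction h with
  | nil v => simp [str_nil]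
  | @cons f π w hf hp ih =>
    rw [List.forall_mem_cons, ih, isPrimary_up_iff hT hf, str_cons]
    constructor
    · rintro ⟨h1, h2⟩
      rw [h2, h1, List.append_assoc]
    · intro h
      have hd := rep_mem hT o .up f.dst
      have hs := append_lab_mem_U_up hf (rep_mem hT o .up f.src)
      have h1 := length_le_rep hT o hs
      have h2 : rep o .up f.dst ++ str π ∈ U .up w := by
        obtain ⟨ρ, hρ, hρ'⟩ := hd
        exact ⟨ρ ++ π, hρ.append hp, by rw [str_append, hρ']⟩
      have h2 := length_le_rep hT o h2
      rw [h] at h2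
      simp only [List.length_append] at h1 h2
      have := eq_of_mem_U_up hT hd hs (by simp only [List.length_append]; omega)
      exact ⟨this, by rw [h, this, List.append_assoc]⟩

theorem IsPath.all_down_iff {T : Str} (hT : IsText T) {o : PathOrder} {v w : Node T}
    {π : List (Edge T)} (h : IsPath v π w) :
    (∀ f ∈ π, IsPrimary o .down f) ↔ rep o .down v = str π ++ rep o .down w := by
  induction h with
  | nil v => simp [str_nil]
  | @cons f π w hf hp ih =>
    rw [List.forall_mem_cons, ih, isPrimary_down_iff hT hf, str_cons]
    constructor
    · rintro ⟨h1, h2⟩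
      rw [h1, h2, List.append_assoc]
    · intro h
      have h2 : str π ++ rep o .down w ∈ U .down f.dst := by
        obtain ⟨ρ, hρ, hρ'⟩ := rep_mem hT o .down w
        exact ⟨π ++ ρ, hp.append hρ, by rw [str_append, hρ']⟩
      have h1 := rep_le hT o (lab_append_mem_U_down hf (rep_mem hT o .down f.dst))
      rw [h, List.append_assoc, PathOrder.append_le_append_left] at h1
      have := rep_antisymm hT h2 h1
      exact ⟨by rw [h, ← this, List.append_assoc], this.symm⟩

/-- Every node but the sink has a primary outgoing edge. -/
theorem exists_isPrimary_down {T : Str} (hT : IsText T) (o : PathOrder) {v : Node T}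
    (hv : v ≠ sink T) : ∃ f ∈ edges T, f.src = v ∧ IsPrimary o .down f := by
  obtain ⟨π, hπ, hs⟩ := rep_mem hT o .down v
  have hall := (hπ.all_down_iff hT (o := o)).2 (by rw [rep_sink hT, hs, List.append_nil])
  cases π with
  | nil => exact absurd (isPath_nil_iff.1 hπ) hv
  | cons f π =>
    obtain ⟨hf, hfs, -⟩ := isPath_cons_iff.1 hπ
    exact ⟨f, hf, hfs, hall f (by simp)⟩

/-- The primary edge is the unique best edge leaving a node. -/
theorem better_of_isPrimary_down {T : Str} (hT : IsText T) {o : PathOrder} {f g : Edge T}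
    (hf : f ∈ edges T) (hg : g ∈ edges T) (hs : f.src = g.src) (hne : f ≠ g)
    (h : IsPrimary o .down f) :
    match o with
    | .lex => ∀ a b, f.lab.head? = some a → g.lab.head? = some b → a < b
    | .pos => g.lab.length + (rep o .down g.dst).length <
        f.lab.length + (rep o .down f.dst).length := by
  rw [isPrimary_down_iff hT hf] at h
  have h1 : o.le (f.lab ++ rep o .down f.dst) (g.lab ++ rep o .down g.dst) := by
    rw [← h, hs]
    exact rep_le hT o (lab_append_mem_U_down hg (rep_mem hT o .down g.dst))
  cases o with
  | lex =>
    intro a b ha hb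
    obtain ⟨x, hx⟩ := List.head?_eq_some_iff.1 ha
    obtain ⟨y, hy⟩ := List.head?_eq_some_iff.1 hb
    rw [hx, hy] at h1
    rcases (str_cons_le_cons _ _ _ _).1 h1 with h2 | ⟨rfl, -⟩
    · exact h2
    · exact absurd (edge_det hT hf hg hs (by rw [ha, hb])) hne
  | pos =>
    have h2 : (g.lab ++ rep .pos .down g.dst).length ≤ (f.lab ++ rep .pos .down f.dst).length := h1
    simp only [List.length_append] at h2
    -- Two suffixes of `T` of equal length coincide, so a tie would make the two edges start with
    -- the same symbol.
    refine lt_of_le_of_ne h2 fun e => hne ?_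
    refine edge_det_append hT hf hg hs (X := rep .pos .down f.dst) (Y := rep .pos .down g.dst) ?_
    have m1 := lab_append_mem_U_down hf (rep_mem hT .pos .down f.dst)
    have m2 := lab_append_mem_U_down hg (rep_mem hT .pos .down g.dst)
    exact eq_of_suffix_of_length_eq (suffix_of_mem_U_down hT m1) (suffix_of_mem_U_down hT m2)
      (by simp only [List.length_append, e])

theorem exists_isPrimary_up {T : Str} (hT : IsText T) (o : PathOrder) {v : Node T}
    (hv : v ≠ root T) : ∃ f ∈ edges T, f.dst = v ∧ IsPrimary o .up f := by
  obtain ⟨π, hπ, hs⟩ := rep_mem hT o .up v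
  rcases List.eq_nil_or_concat π with rfl | ⟨π, f, rfl⟩
  · exact absurd (isPath_nil_iff.1 hπ).symm hv
  · rw [List.concat_eq_append] at hπ hs
    obtain ⟨x, h1, h2⟩ := isPath_append_iff.1 hπ
    obtain ⟨hf, -, h3⟩ := isPath_cons_iff.1 h2
    have h4 := isPath_nil_iff.1 h3
    subst h4
    exact ⟨f, hf, rfl, π, hπ, hs⟩

/-! ## Canonical suffixes -/

/-- The suffix spelled by the primary path to an edge, the edge, and the primary path after it. -/
noncomputable def viaEdge (o : PathOrder) {T : Str} (f : Edge T) : Str :=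
  rep o .up f.src ++ (f.lab ++ rep o .down f.dst)

theorem viaEdge_mem_Suf {T : Str} (hT : IsText T) (o : PathOrder) {f : Edge T}
    (hf : f ∈ edges T) : viaEdge o f ∈ Suf T :=
  append_mem_Suf hT (rep_mem hT o .up f.src)
    (lab_append_mem_U_down hf (rep_mem hT o .down f.dst))

/-- Both sides say that some position has only `A` before it and only `B` after it (or that the list
is empty). On the left the distinguished element is the first one outside `A`, on the right the last
one outside `B`. -/
theorem split_swap {α : Type*} (A B : α → Prop) (π : List α) :
    ((∀ f ∈ π, A f) ∨ ∃ P f Q, π = P ++ f :: Q ∧ ¬ A f ∧ (∀ g ∈ P, A g) ∧ (∀ g ∈ Q, B g)) ↔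
    ((∀ f ∈ π, B f) ∨ ∃ P f Q, π = P ++ f :: Q ∧ ¬ B f ∧ (∀ g ∈ P, A g) ∧ (∀ g ∈ Q, B g)) := by
  have step : ∀ (N : α → Prop) (a : α) (π : List α),
      (∃ P f Q, a :: π = P ++ f :: Q ∧ ¬ N f ∧ (∀ g ∈ P, A g) ∧ (∀ g ∈ Q, B g)) ↔
      (¬ N a ∧ ∀ g ∈ π, B g) ∨
        A a ∧ ∃ P f Q, π = P ++ f :: Q ∧ ¬ N f ∧ (∀ g ∈ P, A g) ∧ (∀ g ∈ Q, B g) := by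
    intro N a π
    constructor
    · rintro ⟨P, f, Q, h, h1, h2, h3⟩
      cases P with
      | nil =>
        simp only [List.nil_append, List.cons.injEq] at h
        obtain ⟨rfl, rfl⟩ := h
        exact Or.inl ⟨h1, h3⟩
      | cons b P =>
        simp only [List.cons_append, List.cons.injEq] at h
        obtain ⟨rfl, rfl⟩ := h
        rw [List.forall_mem_cons] at h2
        exact Or.inr ⟨h2.1, P, f, Q, rfl, h1, h2.2, h3⟩
    · rintro (⟨h1, h2⟩ | ⟨h, P, f, Q, rfl, h1, h2, h3⟩)
      · exact ⟨[], a, π, rfl, h1, by simp, h2⟩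
      · exact ⟨a :: P, f, Q, rfl, h1, by simpa using ⟨h, h2⟩, h3⟩
  induction π with
  | nil => simp
  | cons a π ih =>
    rw [step, step, List.forall_mem_cons, List.forall_mem_cons]
    -- Only a propositional tautology in `A a`, `B a` and the four statements about the tail
    -- remains.
    revert ih
    generalize (∀ x ∈ π, A x) = p
    generalize (∀ x ∈ π, B x) = q
    generalize (∃ P f Q, π = P ++ f :: Q ∧ ¬ A f ∧ (∀ g ∈ P, A g) ∧ ∀ g ∈ Q, B g) = r
    generalize (∃ P f Q, π = P ++ f :: Q ∧ ¬ B f ∧ (∀ g ∈ P, A g) ∧ ∀ g ∈ Q, B g) = s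
    tauto

theorem CS_up_eq_down (o : PathOrder) (T : Str) : CS o T .up = CS o T .down := by
  ext S
  simp only [CS, Set.mem_ofPred_eq, split_swap (IsPrimary o .up) (IsPrimary o .down)]

/-- Primary paths spell representatives, so a nontrivial canonical suffix is determined by its
secondary edge. The choice of `δ` is removed first, by `CS_up_eq_down`. -/
theorem mem_CS_iff {T : Str} (hT : IsText T) (o : PathOrder) (δ : Side) (S : Str) :
    S ∈ CS o T δ ↔ S = rep o .down (root T) ∨
      ∃ f ∈ edges T, ¬ IsPrimary o .down f ∧ S = viaEdge o f := by
  have h : CS o T δ = CS o T .down := by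
    cases δ
    · exact CS_up_eq_down o T
    · rfl
  rw [h]
  constructor
  · rintro ⟨π, hπ, rfl, h | ⟨P, f, Q, rfl, h1, h2, h3⟩⟩
    · left
      rw [(hπ.all_down_iff hT).1 h, rep_sink hT, List.append_nil]
    · right
      obtain ⟨x, p1, p2⟩ := isPath_append_iff.1 hπ
      obtain ⟨hf, rfl, p3⟩ := isPath_cons_iff.1 p2
      refine ⟨f, hf, h1, ?_⟩
      rw [viaEdge, (p1.all_up_iff hT).1 h2, (p3.all_down_iff hT).1 h3, rep_root hT, rep_sink hT,
        str_append, str_cons, List.append_nil, List.nil_append]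
  · rintro (rfl | ⟨f, hf, h1, rfl⟩)
    · obtain ⟨π, hπ, hs⟩ := rep_mem hT o .down (root T)
      exact ⟨π, hπ, hs, Or.inl ((hπ.all_down_iff hT).2 (by rw [rep_sink hT, hs, List.append_nil]))⟩
    · obtain ⟨P, hP, hPs⟩ := rep_mem hT o .up f.src
      obtain ⟨Q, hQ, hQs⟩ := rep_mem hT o .down f.dst
      refine ⟨P ++ f :: Q, hP.append (.cons hf hQ), ?_, Or.inr ⟨P, f, Q, rfl, h1, ?_, ?_⟩⟩
      · rw [str_append, str_cons, hPs, hQs, viaEdge]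
      · exact (hP.all_up_iff hT).2 (by rw [rep_root hT, hPs, List.nil_append])
      · exact (hQ.all_down_iff hT).2 (by rw [rep_sink hT, hQs, List.append_nil])

/-! ### GLPF values of the canonical suffixes -/

theorem GLPF_pos_rep_root {T : Str} (hT : IsText T) (o : PathOrder) :
    GLPF o T (pos T (rep o .down (root T))) = 0 := by
  have h := rep_mem hT o .down (root T)
  rw [U_down_root hT] at h
  refine Nat.le_zero.1 ((GLPF_pos_le_iff h 0).2 fun S' hS' hlt => ?_)
  exact absurd (rep_le hT o (by rwa [U_down_root hT])) hlt.2

/-- A smaller suffix can only be met by branching off at `src f` or above: below the edge, the path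
already follows the smallest continuation. At `src f` itself the primary edge supplies one. -/
theorem GLPF_pos_viaEdge {T : Str} (hT : IsText T) (o : PathOrder) {f : Edge T}
    (hf : f ∈ edges T) (hs : ¬ IsPrimary o .down f) :
    GLPF o T (pos T (viaEdge o f)) = (rep o .up f.src).length := by
  have hS := viaEdge_mem_Suf hT o hf
  have hup := rep_mem hT o .up f.src
  have hdown := rep_mem hT o .down f.src
  have hvia := lab_append_mem_U_down hf (rep_mem hT o .down f.dst)
  obtain ⟨u, hu, hur⟩ := mem_U_up.1 hup
  obtain ⟨v, huv, hv⟩ := lift_edge hf hu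
  apply le_antisymm
  · refine (GLPF_pos_le_iff hS _).2 fun S' hS' hlt => ?_
    by_contra hcon
    obtain ⟨z, x, y, hx, hy, hz, hxy⟩ := lcp_spec (viaEdge o f) S'
    have hne : x ≠ y := by
      rintro rfl
      rw [hx, ← hy] at hlt
      exact hlt.2 (o.le_refl _)
    rw [hx] at hS
    rw [hy] at hS'
    have hzn := isSTNode_of_differ hT hS hS' hne hxy
    rw [hz, not_le, ← hur] at hcon
    have huz : u.1 <+: z := by
      refine List.prefix_of_prefix_length_le (l₃ := viaEdge o f) ?_ ?_ hcon.le
      · rw [hur, viaEdge]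
        exact List.prefix_append _ _
      · rw [hx]
        exact List.prefix_append _ _
    have hveq : viaEdge o f = v.1 ++ rep o .down f.dst := by
      rw [viaEdge, huv.2.1, hur, List.append_assoc]
    -- `z` and `v` both lie on the path of `viaEdge o f`, and `z` is strictly below `u`. No node
    -- lies strictly inside the edge from `u` to `v`, so `z` is at or below `v`.
    have hvz : v.1 <+: z := by
      have p1 : v.1 <+: viaEdge o f := by rw [hveq]; exact List.prefix_append _ _
      have p2 : z <+: viaEdge o f := by rw [hx]; exact List.prefix_append _ _
      rcases List.prefix_or_prefix_of_prefix p1 p2 with h | h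
      · exact h
      · rcases huv.2.2 ⟨z, hzn⟩ huz h with e | e
        · rw [← e] at hcon
          exact absurd hcon (lt_irrefl _)
        · rw [← e]
    obtain ⟨z', rfl⟩ := hvz
    have hr : rep o .down f.dst = z' ++ x := by
      rw [hveq, List.append_assoc] at hx
      simpa using hx
    have hy' : z' ++ y ∈ U .down f.dst := by
      rw [← hv, U_down_cls hT, mem_conts, ← List.append_assoc]
      exact hS'
    -- Both suffixes pass through `v`, so minimality of the lower representative there contradicts
    -- that the second suffix is smaller.
    have hle := rep_le hT o hy'
    apply hlt.2
    rw [hveq, hy, List.append_assoc, PathOrder.append_le_append_left]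
    exact hle
  -- The witness leaves `src f` along the smallest continuation. It is strictly smaller, since
  -- otherwise `f` would be primary.
  · have hS' := append_mem_Suf hT hup hdown
    have hlt : o.lt (rep o .up f.src ++ rep o .down f.src) (viaEdge o f) := by
      refine PathOrder.lt_of_not_le fun h => hs ?_
      rw [viaEdge, PathOrder.append_le_append_left] at h
      exact (isPrimary_down_iff hT hf).2 (rep_antisymm hT hvia h).symm
    refine le_trans ?_ (lcp_le_GLPF_pos hS hS' hlt)
    rw [viaEdge, lcp_append]
    exact Nat.le_add_right _ _

/-- The quasi-irreducible GLPF array in terms of the secondary edges. -/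
theorem mem_qirGLPF_iff {T : Str} (hT : IsText T) (o : PathOrder) (δ : Side) (x : ℕ × ℕ) :
    x ∈ qirGLPF o T δ ↔ x = (T.length + 1 - (rep o .down (root T)).length, 0) ∨
      ∃ f ∈ edges T, ¬ IsPrimary o .down f ∧
        x = (T.length + 1 - (viaEdge o f).length, (rep o .up f.src).length) := by
  simp only [qirGLPF, Set.mem_ofPred_eq, mem_CS_iff hT o δ]
  constructor
  · rintro ⟨S, rfl | ⟨f, hf, hs, rfl⟩, rfl⟩
    · exact Or.inl (by rw [GLPF_pos_rep_root hT, pos])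
    · exact Or.inr ⟨f, hf, hs, by rw [GLPF_pos_viaEdge hT o hf hs, pos]⟩
  · rintro (rfl | ⟨f, hf, hs, rfl⟩)
    · exact ⟨_, Or.inl rfl, by rw [GLPF_pos_rep_root hT, pos]⟩
    · exact ⟨_, Or.inr ⟨f, hf, hs, rfl⟩, by rw [GLPF_pos_viaEdge hT o hf hs, pos]⟩

/-! ## The order of the incoming edges -/

/-- A suffix of `b` occurs wherever `b` does, followed by the same symbols, so it inherits
branching. This keeps nodes from falling inside edges below. -/
theorem isSTNode_of_suffix {T a b : Str} (hb : IsSTNode T b) (ha : a ≠ []) (h : a <:+ b) :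
    IsSTNode T a := by
  rcases hb with rfl | hb | ⟨c, d, hne, hc, hd⟩
  · exact absurd (List.suffix_nil.1 h) ha
  · exact Or.inr (Or.inl ⟨ha, h.trans hb.2⟩)
  · obtain ⟨s, rfl⟩ := h
    refine Or.inr (Or.inr ⟨c, d, hne, ?_, ?_⟩)
    · exact (List.suffix_append s (a ++ [c])).isInfix.trans (by simpa using hc)
    · exact (List.suffix_append s (a ++ [d])).isInfix.trans (by simpa using hd)

/-- A shorter suffix has at least as many occurrences. Nonemptiness of `a` matters, since the empty
string is not continued by the empty string. -/
theorem conts_subset_of_suffix {T a b : Str} (ha : a ≠ []) (h : a <:+ b) :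
    conts T b ⊆ conts T a := by
  obtain ⟨s, rfl⟩ := h
  intro X hX
  refine ⟨by simp [ha], ?_⟩
  rw [mem_conts, List.append_assoc] at hX
  exact (List.suffix_append s (a ++ X)).trans hX.2

/-- The members of the destination of two distinct edges that are spelled by paths through these
edges are separated by length. -/
theorem length_lt_of_edgePosLe {T : Str} (hT : IsText T) {f g : Edge T} (hf : f ∈ edges T)
    (hg : g ∈ edges T) (hd : f.dst = g.dst) (hne : f ≠ g) (hle : EdgePosLe f g) {x y : Str}
    (hx : x ∈ U .up f.src) (hy : y ∈ U .up g.src) :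
    y.length + g.lab.length < x.length + f.lab.length := by
  by_contra hcon
  rw [not_lt] at hcon
  have hr := rep_mem hT .pos .up f.src
  have hyr := length_le_rep hT .pos hy
  have hle' : (rep .pos .up g.src).length + g.lab.length ≤
    (rep .pos .up f.src).length + f.lab.length := hle
  have hyr' : y.length + g.lab.length ≤ (rep .pos .up f.src).length + f.lab.length := by omega
  have mx := append_lab_mem_U_up hf hx
  have mr := append_lab_mem_U_up hf hr
  have my := append_lab_mem_U_up hg hy
  rw [← hd] at my
  -- If the claim failed, the member through `g` would be sandwiched in the suffix chain between two
  -- members through `f`: the one from `x`, and the one from the representative of `f.src`.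
  have sxy := suffix_of_mem_U_up hT mx my (by simpa using hcon)
  have syr := suffix_of_mem_U_up hT my mr (by simpa using hyr')
  obtain ⟨a, ha, rfl⟩ := mem_U_up.1 hx
  obtain ⟨b, hb, rfl⟩ := mem_U_up.1 hy
  obtain ⟨r, hr', hrr⟩ := mem_U_up.1 hr
  rw [← hrr] at syr hyr'
  obtain ⟨a', eA, ha'⟩ := lift_edge hf ha
  obtain ⟨b', eB, hb'⟩ := lift_edge hg hb
  have hf0 := lab_ne_nil hf
  have hg0 := lab_ne_nil hg
  have lf := List.length_pos_iff.2 hf0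
  have lg := List.length_pos_iff.2 hg0
  -- If one label were a proper suffix of the other, cutting off the shorter one would leave `b.1 ++
  -- Z` as a suffix of `r`, or `a.1 ++ Z` as a suffix of `b`: a node strictly inside an edge.
  have hlab : f.lab = g.lab := by
    rcases lt_trichotomy f.lab.length g.lab.length with h | h | h
    · exfalso
      have hs : f.lab <:+ g.lab := List.suffix_of_suffix_length_le
        ((List.suffix_append a.1 f.lab).trans sxy) (List.suffix_append b.1 g.lab) h.le
      obtain ⟨Z, hZ⟩ := hs
      have hZ0 : Z ≠ [] := by
        rintro rfl
        simp only [List.nil_append] at hZ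
        rw [hZ] at h
        exact lt_irrefl _ h
      rw [← hZ, ← List.append_assoc, List.suffix_append_inj_of_length_eq rfl] at syr
      have hn := isSTNode_of_suffix r.2 (by simp [hZ0]) syr.1
      rcases eB.2.2 ⟨_, hn⟩ (by simp) (by rw [eB.2.1, ← hZ]; simp) with e | e
      · have := congrArg Subtype.val e
        exact hZ0 (by simpa using this)
      · have := congrArg Subtype.val e
        rw [eB.2.1, ← hZ] at this
        exact hf0 (by simpa using this)
    · exact (List.suffix_of_suffix_length_le ((List.suffix_append a.1 f.lab).trans sxy)
        (List.suffix_append b.1 g.lab) h.le).eq_of_length h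
    · exfalso
      have hs : g.lab <:+ f.lab := List.suffix_of_suffix_length_le
        (List.suffix_append b.1 g.lab) ((List.suffix_append a.1 f.lab).trans sxy) h.le
      obtain ⟨Z, hZ⟩ := hs
      have hZ0 : Z ≠ [] := by
        rintro rfl
        simp only [List.nil_append] at hZ
        rw [hZ] at h
        exact lt_irrefl _ h
      rw [← hZ, ← List.append_assoc, List.suffix_append_inj_of_length_eq rfl] at sxy
      have hn := isSTNode_of_suffix b.2 (by simp [hZ0]) sxy.1
      rcases eA.2.2 ⟨_, hn⟩ (by simp) (by rw [eA.2.1, ← hZ]; simp) with e | e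
      · have := congrArg Subtype.val e
        exact hZ0 (by simpa using this)
      · have := congrArg Subtype.val e
        rw [eA.2.1, ← hZ] at this
        exact hg0 (by simpa using this)
  rw [hlab, List.suffix_append_inj_of_length_eq rfl] at sxy syr
  -- After cancelling the label, `b` lies between `a` and `r` in the suffix chain. These two have
  -- equal continuations, and continuations are antitone, so `b` shares them. The empty string is
  -- treated separately.
  have hsrc : f.src = g.src := by
    rw [← ha, ← hb, cls_eq_iff_conts hT]
    have har : conts T a.1 = conts T r.1 := (cls_eq_iff_conts hT).1 (ha.trans hr'.symm)
    by_cases ha0 : a.1 = []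
    · have : cls r = root T := by
        rw [hr', ← ha]
        exact (cls_eq_root_iff hT).2 ha0
      have hr0 := (cls_eq_root_iff hT).1 this
      rw [hr0] at syr
      rw [ha0, List.suffix_nil.1 syr.1]
    · have hb0 : b.1 ≠ [] := by
        intro e
        rw [e] at sxy
        exact ha0 (List.suffix_nil.1 sxy.1)
      refine Set.Subset.antisymm ?_ (conts_subset_of_suffix ha0 sxy.1)
      rw [har]
      exact conts_subset_of_suffix hb0 syr.1
  exact hne (edge_det hT hf hg hsrc (by rw [hlab]))

/-! ## A total correctness logic with resource bounds -/

/-- The resources stay within the given bounds on array indices and on words. -/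
def Cost.Le (A W : ℕ) (c : Cost) : Prop := c.addr ≤ A ∧ c.word ≤ W

@[simp] theorem Cost.le_seq {A W : ℕ} {c d : Cost} :
    (c.seq d).Le A W ↔ c.Le A W ∧ d.Le A W := by
  simp only [Cost.Le, Cost.seq, max_le_iff]
  tauto

@[simp] theorem Cost.le_step {A W w : ℕ} : (Cost.step w).Le A W ↔ w ≤ W := by
  simp [Cost.Le, Cost.step]

@[simp] theorem Cost.le_access {A W i w : ℕ} : (Cost.access i w).Le A W ↔ i < A ∧ w ≤ W := by
  simp [Cost.Le, Cost.access]

@[simp] theorem Cost.time_seq (c d : Cost) : (c.seq d).time = c.time + d.time := rfl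

@[simp] theorem Cost.time_step (w : ℕ) : (Cost.step w).time = 1 := rfl

@[simp] theorem Cost.time_access (i w : ℕ) : (Cost.access i w).time = 1 := rfl

theorem Expr.stack_cost {ι : Type} (σ : State ι) (t : Expr ι) : (t.cost σ).stack = 0 := by
  induction t with
  | num | var => rfl
  | arr a i ih => simp [Expr.cost, Cost.seq, Cost.access, ih]
  | add s t hs ht | sub s t hs ht => simp [Expr.cost, Cost.seq, Cost.step, hs, ht]

theorem Cond.stack_cost {ι : Type} (σ : State ι) (b : Cond ι) : (b.cost σ).stack = 0 := by
  induction b with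
  | lt | eq => simp [Cond.cost, Cost.seq, Cost.step, Expr.stack_cost]
  | or c d hc hd => simp [Cond.cost, Cost.seq, Cost.step, hc, hd]

section

variable {ι κ : Type} [DecidableEq ι] {P : κ → Stmt ι κ}

/-- A call charges the size of its frame to the time as well, so the stack needs no analysis of its
own. -/
theorem Exec.stack_le_time {s : Stmt ι κ} {σ τ : State ι} {c : Cost} (h : Exec P s σ τ c) :
    c.stack ≤ c.time := by
  induction h with
  | skip => simp [Cost.step]
  | assign | store | emit => simp [Cost.seq, Cost.step, Cost.access, Expr.stack_cost]
  | seq _ _ h1 h2 => simp only [Cost.seq]; omega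
  | ite_true _ _ h | ite_false _ _ h => simp only [Cost.seq, Cond.stack_cost]; omega
  | while_false => simp [Cond.stack_cost]
  | while_true _ _ _ h1 h2 => simp only [Cost.seq, Cond.stack_cost]; omega
  | call _ h => simp only [Cost.seq, Expr.stack_cost]; omega

/-- Started in `σ`, the statement `s` terminates within the bounds `A` on array indices and `W` on
words, and `Q` holds of the final state and the running time. -/
def Tri (P : κ → Stmt ι κ) (A W : ℕ) (s : Stmt ι κ) (σ : State ι) (Q : State ι → ℕ → Prop) :
    Prop := ∃ τ c, Exec P s σ τ c ∧ c.Le A W ∧ Q τ c.time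

/-! ### Proof rules with time passed to the continuation -/

namespace Tri

variable {A W : ℕ} {σ : State ι} {Q : State ι → ℕ → Prop}

theorem mono {s : Stmt ι κ} {Q' : State ι → ℕ → Prop} (h : Tri P A W s σ Q')
    (hQ : ∀ τ t, Q' τ t → Q τ t) : Tri P A W s σ Q := by
  obtain ⟨τ, c, h1, h2, h3⟩ := h
  exact ⟨τ, c, h1, h2, hQ _ _ h3⟩

theorem skip (h : Q σ 1) : Tri P A W .skip σ Q :=
  ⟨_, _, .skip σ, by simp, h⟩

theorem assign {x : ℕ} {t : Expr ι} (hc : (t.cost σ).Le A W ∧ t.eval σ ≤ W)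
    (h : Q ⟨Function.update σ.loc x (t.eval σ), σ.mem, σ.out⟩ ((t.cost σ).time + 1)) :
    Tri P A W (.assign x t) σ Q :=
  ⟨_, _, .assign σ x t, by simpa using hc, h⟩

theorem store {a : ι} {i t : Expr ι}
    (hc : (i.cost σ).Le A W ∧ (t.cost σ).Le A W ∧ i.eval σ < A ∧ t.eval σ ≤ W)
    (h : Q ⟨σ.loc, Function.update σ.mem a (Function.update (σ.mem a) (i.eval σ) (t.eval σ)),
      σ.out⟩ ((i.cost σ).time + (t.cost σ).time + 1)) :
    Tri P A W (.store a i t) σ Q :=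
  ⟨_, _, .store σ a i t, by simpa [and_assoc] using hc, h⟩

theorem emit {s t : Expr ι} (hc : (s.cost σ).Le A W ∧ (t.cost σ).Le A W)
    (h : Q ⟨σ.loc, σ.mem, σ.out ++ [(s.eval σ, t.eval σ)]⟩
      ((s.cost σ).time + (t.cost σ).time + 1)) :
    Tri P A W (.emit s t) σ Q :=
  ⟨_, _, .emit σ s t, by simpa using hc, h⟩

theorem seq {s t : Stmt ι κ}
    (h : Tri P A W s σ fun σ' k => Tri P A W t σ' fun τ l => Q τ (k + l)) :
    Tri P A W (.seq s t) σ Q := by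
  obtain ⟨σ', c, h1, h2, τ, d, h3, h4, h5⟩ := h
  exact ⟨τ, _, .seq h1 h3, Cost.le_seq.2 ⟨h2, h4⟩, h5⟩

theorem ite {b : Cond ι} {s t : Stmt ι κ} (hc : (b.cost σ).Le A W)
    (ht : b.eval σ = true → Tri P A W s σ fun τ k => Q τ ((b.cost σ).time + k))
    (hf : b.eval σ = false → Tri P A W t σ fun τ k => Q τ ((b.cost σ).time + k)) :
    Tri P A W (.ite b s t) σ Q := by
  cases hb : b.eval σ with
  | true =>
    obtain ⟨τ, c, h1, h2, h3⟩ := ht hb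
    exact ⟨τ, _, .ite_true hb h1, Cost.le_seq.2 ⟨hc, h2⟩, h3⟩
  | false =>
    obtain ⟨τ, c, h1, h2, h3⟩ := hf hb
    exact ⟨τ, _, .ite_false hb h1, Cost.le_seq.2 ⟨hc, h2⟩, h3⟩

theorem while_false {b : Cond ι} {s : Stmt ι κ} (hc : (b.cost σ).Le A W) (hb : b.eval σ = false)
    (h : Q σ (b.cost σ).time) : Tri P A W (.while b s) σ Q :=
  ⟨_, _, .while_false hb, hc, h⟩

theorem while_true {b : Cond ι} {s : Stmt ι κ} (hc : (b.cost σ).Le A W) (hb : b.eval σ = true)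
    (h : Tri P A W s σ fun σ' k => Tri P A W (.while b s) σ' fun τ l =>
      Q τ ((b.cost σ).time + k + l)) : Tri P A W (.while b s) σ Q := by
  obtain ⟨σ', c, h1, h2, τ, d, h3, h4, h5⟩ := h
  exact ⟨τ, _, .while_true hb h1 h3, Cost.le_seq.2 ⟨Cost.le_seq.2 ⟨hc, h2⟩, h4⟩, h5⟩

theorem call {k : κ} {t : Expr ι} (hc : (t.cost σ).Le A W)
    (h : Tri P A W (P k) ⟨Function.update (fun _ => 0) 0 (t.eval σ), σ.mem, σ.out⟩
      fun τ l => Q ⟨σ.loc, τ.mem, τ.out⟩ ((t.cost σ).time + (l + (P k).frame))) :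
    Tri P A W (.call k t) σ Q := by
  obtain ⟨τ, c, h1, h2, h3⟩ := h
  exact ⟨_, _, .call h1, Cost.le_seq.2 ⟨hc, h2⟩, h3⟩

end Tri

end

/-- The loop over an adjacency list, with an invariant `I` that refers to the position in the list,
the state and the time spent so far. -/
theorem Tri.forEach {κ : Type} {P : κ → Stmt Arr κ} {A W : ℕ} {ptr adj other : Arr}
    {body : Stmt Arr κ} {σ : State Arr} {Q : State Arr → ℕ → Prop} (v : ℕ) (p ad ot : ℕ → ℕ)
    (I : ℕ → State Arr → ℕ → Prop)
    (hv : σ.loc 0 = v) (hp : σ.mem ptr = p) (hpv : p v ≤ p (v + 1))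
    (hA : v + 1 < A ∧ p (v + 1) ≤ A) (hW : 1 ≤ W ∧ v + 1 ≤ W ∧ p (v + 1) ≤ W)
    (hadj : ∀ j, p v ≤ j → j < p (v + 1) → ad j < A ∧ ad j ≤ W ∧ ot (ad j) ≤ W)
    (hI : ∀ j τ t, I j τ t → τ.loc 0 = v ∧ τ.loc 1 = j ∧ τ.mem ptr = p ∧ τ.mem adj = ad ∧
      τ.mem other = ot)
    (h0 : I (p v) ⟨Function.update σ.loc 1 (p v), σ.mem, σ.out⟩ 3)
    (hstep : ∀ j τ t, p v ≤ j → j < p (v + 1) → I j τ t →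
      Tri P A W body
        ⟨Function.update (Function.update τ.loc 2 (ad j)) 3 (ot (ad j)), τ.mem, τ.out⟩
        fun τ' s => τ'.loc 1 = j ∧
          I (j + 1) ⟨Function.update τ'.loc 1 (j + 1), τ'.mem, τ'.out⟩ (t + (17 + s)))
    (hend : ∀ τ t, I (p (v + 1)) τ t → Q τ (t + 7)) :
    Tri P A W (Alg.forEach ptr adj other body) σ Q := by
  refine Tri.seq (Tri.assign ?_ (Tri.seq ?_))
  · simp [Expr.cost, Expr.eval, hv, hp]
    omega
  · simp only [Expr.cost, Expr.eval, hv, hp, Cost.time_seq, Cost.time_step, Cost.time_access]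
    -- The first assignment takes 3 steps. A test takes 6; an iteration takes 17 beyond its body,
    -- namely the test, two loads of 3 steps, the increment of 4 and the closing `skip`. The final 7
    -- is the failing test plus the `skip` of the outer block.
    suffices hloop : ∀ k j τ t, p v ≤ j → j + k = p (v + 1) → I j τ t →
        Tri P A W (.while (.lt Alg.j (.arr ptr (.add Alg.v (.num 1)))) (Alg.block [
          .assign 2 (.arr adj Alg.j), .assign 3 (.arr other Alg.f), body,
          .assign 1 (.add Alg.j (.num 1))])) τ fun τ' s => Q τ' (t + s + 1) by
      refine (hloop (p (v + 1) - p v) (p v) _ 3 le_rfl (by omega) h0).mono fun τ t h => ?_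
      refine Tri.skip ?_
      exact (by omega : 3 + t + 1 = 1 + 1 + 1 + (t + 1)) ▸ h
    intro k
    induction k with
    | zero =>
      intro j τ t hj hk hIj
      obtain ⟨e0, e1, e2, e3, e4⟩ := hI _ _ _ hIj
      refine Tri.while_false ?_ ?_ ?_
      · simp [Cond.cost, Expr.cost, Expr.eval, e0, e1, e2]
        omega
      · simp [Cond.eval, Expr.eval, e0, e1, e2]
        omega
      · simp only [Cond.cost, Expr.cost, Cost.time_seq, Cost.time_step, Cost.time_access]
        exact hend _ _ ((show j = p (v + 1) by omega) ▸ hIj)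
    | succ k ih =>
      intro j τ t hj hk hIj
      obtain ⟨e0, e1, e2, e3, e4⟩ := hI _ _ _ hIj
      obtain ⟨a1, a2, a3⟩ := hadj j hj (by omega)
      refine Tri.while_true ?_ ?_ ?_
      · simp [Cond.cost, Expr.cost, Expr.eval, e0, e1, e2]
        omega
      · simp [Cond.eval, Expr.eval, e0, e1, e2]
        omega
      · refine Tri.seq (Tri.assign ?_ (Tri.seq (Tri.assign ?_ (Tri.seq ?_))))
        · simp [Expr.cost, Expr.eval, e1, e3]
          omega
        · simp [Expr.cost, Expr.eval, e1, e3, e4]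
          omega
        · simp only [Expr.eval, e1, e3, e4, Function.update_self]
          refine (hstep j τ t hj (by omega) hIj).mono fun τ' s h => ?_
          refine Tri.seq (Tri.assign ?_ (Tri.skip ?_))
          · simp [Expr.cost, Expr.eval, h.1]
            omega
          · simp only [Expr.eval, h.1, Expr.cost, Cond.cost, Cost.time_seq, Cost.time_step,
              Cost.time_access]
            refine (ih (j + 1) _ _ (by omega) (by omega) h.2).mono fun τ'' l hl => ?_
            convert hl using 1
            omega

/-! ## The numbered graph -/

/-- The best lower path through the edge `i` precedes the best lower path through the edge `k`. -/
def Beats (D : SelfIndex) (dn : ℕ → ℕ) : PathOrder → ℕ → ℕ → Prop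
  | .lex, i, k => D.sym i < D.sym k
  | .pos, i, k => D.len k + dn (D.dst k) < D.len i + dn (D.dst i)

theorem Beats.asymm {D : SelfIndex} {dn : ℕ → ℕ} {o : PathOrder} {i k : ℕ}
    (h : Beats D dn o i k) (h' : Beats D dn o k i) : False := by
  cases o <;> exact lt_asymm h h'

/-- The facts about a self-index that the algorithm depends on: `up` and `dn` are the lengths of the
upper and the lower representatives of the nodes, `prim` tells the `(+)`-primary edges. -/
structure NumGraph (D : SelfIndex) (o : PathOrder) (σ : ℕ) (up dn : ℕ → ℕ) (prim : ℕ → Prop) :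
    Prop where
  numE_pos : 0 < D.numE
  root_lt : D.root < D.numV
  sink_lt : D.sink < D.numV
  src_lt : ∀ i < D.numE, D.src i < D.numV
  dst_lt : ∀ i < D.numE, D.dst i < D.numV
  len_pos : ∀ i < D.numE, 0 < D.len i
  sym_le : ∀ i < D.numE, D.sym i ≤ σ
  sum_le : ∀ i < D.numE, up (D.src i) + D.len i + dn (D.dst i) ≤ D.n
  up_le_n : ∀ v < D.numV, up v ≤ D.n
  dn_le_n : ∀ v < D.numV, dn v ≤ D.n
  inPtr_zero : D.inPtr 0 = 0
  inPtr_last : D.inPtr D.numV = D.numE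
  inPtr_mono : ∀ v < D.numV, D.inPtr v ≤ D.inPtr (v + 1)
  outPtr_zero : D.outPtr 0 = 0
  outPtr_last : D.outPtr D.numV = D.numE
  outPtr_mono : ∀ v < D.numV, D.outPtr v ≤ D.outPtr (v + 1)
  in_mem : ∀ v < D.numV, ∀ j, D.inPtr v ≤ j → j < D.inPtr (v + 1) →
    D.inAdj j < D.numE ∧ D.dst (D.inAdj j) = v
  in_surj : ∀ i < D.numE, ∃ j, D.inPtr (D.dst i) ≤ j ∧ j < D.inPtr (D.dst i + 1) ∧ D.inAdj j = i
  out_mem : ∀ v < D.numV, ∀ j, D.outPtr v ≤ j → j < D.outPtr (v + 1) →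
    D.outAdj j < D.numE ∧ D.src (D.outAdj j) = v
  out_surj : ∀ i < D.numE,
    ∃ j, D.outPtr (D.src i) ≤ j ∧ j < D.outPtr (D.src i + 1) ∧ D.outAdj j = i
  in_nodup : ∀ v < D.numV, (adjList D.inPtr D.inAdj v).Nodup
  in_empty : ∀ v < D.numV, D.inPtr v = D.inPtr (v + 1) → v = D.root
  in_root : D.inPtr D.root = D.inPtr (D.root + 1)
  out_empty : ∀ v < D.numV, D.outPtr v = D.outPtr (v + 1) → v = D.sink
  up_le : ∀ i < D.numE, up (D.src i) + D.len i ≤ up (D.dst i)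
  up_attained : ∀ v < D.numV, D.inPtr v < D.inPtr (v + 1) →
    ∃ i < D.numE, D.dst i = v ∧ up v = up (D.src i) + D.len i
  up_zero : ∀ v < D.numV, D.inPtr v = D.inPtr (v + 1) → up v = 0
  dn_zero : ∀ v < D.numV, D.outPtr v = D.outPtr (v + 1) → dn v = 0
  dn_prim : ∀ i < D.numE, prim i → dn (D.src i) = D.len i + dn (D.dst i)
  prim_exists : ∀ v < D.numV, D.outPtr v < D.outPtr (v + 1) → ∃ i < D.numE, D.src i = v ∧ prim i
  prim_best : ∀ i < D.numE, ∀ k < D.numE, D.src i = D.src k → i ≠ k → prim i →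
    Beats D dn o i k

theorem ptr_le_of_le {ptr : ℕ → ℕ} {N : ℕ} (h : ∀ v < N, ptr v ≤ ptr (v + 1)) {u v : ℕ}
    (huv : u ≤ v) (hv : v ≤ N) : ptr u ≤ ptr v := by
  induction v, huv using Nat.le_induction with
  | base => exact le_rfl
  | succ v _ ih => exact (ih (by omega)).trans (h v (by omega))

/-- The arrays that hold the input. -/
structure Input (D : SelfIndex) (m : Arr → ℕ → ℕ) : Prop where
  n : m .n 0 = D.n
  root : m .root 0 = D.root
  sink : m .sink 0 = D.sink
  src : m .src = D.src
  dst : m .dst = D.dst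
  len : m .len = D.len
  sym : m .sym = D.sym
  inPtr : m .inPtr = D.inPtr
  inAdj : m .inAdj = D.inAdj
  outPtr : m .outPtr = D.outPtr
  outAdj : m .outAdj = D.outAdj

/-- The time still to be spent on the nodes that have not been visited. -/
def pot (ptr seen : ℕ → ℕ) (N : ℕ) : ℕ :=
  ∑ v ∈ Finset.range N, if seen v = 1 then 0 else 60 + 100 * (ptr (v + 1) - ptr v)

/-- Marking `v` releases exactly its share of the potential, from which its own visit is paid. -/
theorem pot_update {ptr seen : ℕ → ℕ} {N v : ℕ} (hv : v < N) (h : seen v ≠ 1) :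
    pot ptr (Function.update seen v 1) N + (60 + 100 * (ptr (v + 1) - ptr v)) =
      pot ptr seen N := by
  unfold pot
  rw [← Finset.add_sum_erase _ _ (Finset.mem_range.2 hv),
    ← Finset.add_sum_erase (Finset.range N) (fun v => if seen v = 1 then 0 else _)
      (Finset.mem_range.2 hv)]
  rw [Finset.sum_congr rfl (g := fun v => if seen v = 1 then 0 else
    60 + 100 * (ptr (v + 1) - ptr v))]
  · simp [h]
    omega
  · intro x hx
    rw [Function.update_of_ne (Finset.ne_of_mem_erase hx)]

variable {D : SelfIndex} {o : PathOrder} {σ : ℕ} {up dn : ℕ → ℕ} {prim : ℕ → Prop}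

namespace NumGraph

variable (G : NumGraph D o σ up dn prim)

include G

theorem inPtr_le {v : ℕ} (hv : v ≤ D.numV) : D.inPtr v ≤ D.numE :=
  G.inPtr_last ▸ ptr_le_of_le G.inPtr_mono hv le_rfl

theorem outPtr_le {v : ℕ} (hv : v ≤ D.numV) : D.outPtr v ≤ D.numE :=
  G.outPtr_last ▸ ptr_le_of_le G.outPtr_mono hv le_rfl

theorem up_src_lt {i : ℕ} (hi : i < D.numE) : up (D.src i) < up (D.dst i) := by
  have := G.up_le i hi
  have := G.len_pos i hi
  omega

end NumGraph

/-! ## The upward search -/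

/-- The invariant of the upward search. -/
structure UpInv (D : SelfIndex) (up : ℕ → ℕ) (m : Arr → ℕ → ℕ) : Prop where
  input : Input D m
  seen_le : ∀ v, m .seenUp v ≤ 1
  rep : ∀ v < D.numV, m .seenUp v = 1 → m .repUp v = up v
  closed : ∀ i < D.numE, m .seenUp (D.dst i) = 1 → m .seenUp (D.src i) = 1

/-- The effect of the upward search at `v`. -/
structure UpPost (D : SelfIndex) (up : ℕ → ℕ) (v : ℕ) (σ τ : State Arr) (t : ℕ) : Prop where
  inv : UpInv D up τ.mem
  out : τ.out = σ.out
  seen : τ.mem .seenUp v = 1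
  mono : ∀ u, σ.mem .seenUp u = 1 → τ.mem .seenUp u = 1
  frame : ∀ u, up v < up u → τ.mem .seenUp u = σ.mem .seenUp u
  others : ∀ a, a ≠ .repUp → a ≠ .seenUp → τ.mem a = σ.mem a
  time : t + pot D.inPtr (τ.mem .seenUp) D.numV ≤ 10 + pot D.inPtr (σ.mem .seenUp) D.numV

/-- The invariant of the loop of the upward search. -/
structure UpLoop (D : SelfIndex) (up : ℕ → ℕ) (v : ℕ) (σ : State Arr) (j : ℕ) (τ : State Arr)
    (t : ℕ) : Prop where
  inv : UpInv D up τ.mem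
  out : τ.out = σ.out
  arg : τ.loc 0 = v
  idx : τ.loc 1 = j
  mono : ∀ u, σ.mem .seenUp u = 1 → τ.mem .seenUp u = 1
  frame : ∀ u, up v ≤ up u → τ.mem .seenUp u = σ.mem .seenUp u
  others : ∀ a, a ≠ .repUp → a ≠ .seenUp → τ.mem a = σ.mem a
  best_le : τ.loc 4 ≤ up v
  done : ∀ k, D.inPtr v ≤ k → k < j → τ.mem .seenUp (D.src (D.inAdj k)) = 1 ∧
    up (D.src (D.inAdj k)) + D.len (D.inAdj k) ≤ τ.loc 4
  time : t + pot D.inPtr (τ.mem .seenUp) D.numV ≤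
    3 + pot D.inPtr (σ.mem .seenUp) D.numV + 100 * (j - D.inPtr v)

theorem Input.of_others {m m' : Arr → ℕ → ℕ} (h : Input D m)
    (h' : ∀ a, a ≠ .repUp → a ≠ .seenUp → a ≠ .repDown → a ≠ .seenDown → a ≠ .primary →
      m' a = m a) : Input D m' := by
  constructor
  all_goals rw [h'] <;> first | decide | skip
  · exact h.n
  · exact h.root
  · exact h.sink
  · exact h.src
  · exact h.dst
  · exact h.len
  · exact h.sym
  · exact h.inPtr
  · exact h.inAdj
  · exact h.outPtr
  · exact h.outAdj

theorem UpInv.visit {m : Arr → ℕ → ℕ} (h : UpInv D up m) {v : ℕ}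
    (hsrc : ∀ i < D.numE, D.dst i = v → m .seenUp (D.src i) = 1) :
    UpInv D up (Function.update (Function.update m .repUp (Function.update (m .repUp) v (up v)))
      .seenUp (Function.update (m .seenUp) v 1)) := by
  refine ⟨h.input.of_others ?_, ?_, ?_, ?_⟩
  · intro a h1 h2 _ _ _
    simp [h1, h2]
  · intro u
    by_cases hu : u = v
    · simp [hu]
    · simpa [hu] using h.seen_le u
  · intro u hu hs
    by_cases huv : u = v
    · simp [huv]
    · simp only [Function.update_self, ne_eq, huv, not_false_eq_true, Function.update_of_ne] at hs
      simpa [huv] using h.rep u hu hs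
  · intro i hi hs
    simp only [Function.update_self] at hs ⊢
    by_cases h1 : D.src i = v
    · simp [h1]
    · rw [Function.update_of_ne h1]
      by_cases h2 : D.dst i = v
      · exact hsrc i hi h2
      · rw [Function.update_of_ne h2] at hs
        exact h.closed i hi hs

/-- Induction on `up v`, which drops strictly against every edge. The time is amortized: a call
costs at most 10 steps, enough when the node is already marked, plus the potential that it releases.
-/
theorem tri_prepUpward (G : NumGraph D o σ up dn prim) {A W : ℕ} (hA : D.numE + D.numV + 2 ≤ A)
    (hW : D.n + σ + D.numE + D.numV + 2 ≤ W) (v : ℕ) (hv : v < D.numV) (s : State Arr)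
    (hs : UpInv D up s.mem) (hs0 : s.loc 0 = v) :
    Tri (Alg.procs o) A W Alg.prepUpward s (UpPost D up v s) := by
  induction hk : up v using Nat.strong_induction_on generalizing v s with
  | _ k ih =>
  have hin := hs.input
  have hseen := hs.seen_le v
  have hpv := G.inPtr_mono v hv
  have hpe := G.inPtr_le (v := v + 1) hv
  have hupn := G.up_le_n v hv
  unfold Alg.prepUpward
  refine Tri.ite ?_ (fun hb => ?_) (fun hb => ?_)
  · simp [Cond.cost, Expr.cost, Expr.eval, hs0]
    omega
  · simp only [Cond.eval, Expr.eval, hs0, decide_eq_true_eq] at hb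
    refine Tri.skip ⟨hs, rfl, hb, fun _ h => h, fun _ _ => rfl, fun _ _ _ => rfl, ?_⟩
    simp only [Cond.cost, Expr.cost, Cost.time_seq, Cost.time_step, Cost.time_access]
    omega
  simp only [Cond.eval, Expr.eval, hs0, decide_eq_false_iff_not] at hb
  have hpot : ∀ seen : ℕ → ℕ, seen v ≠ 1 → _ := fun seen h => pot_update (ptr := D.inPtr) hv h
  refine Tri.ite ?_ (fun hb' => ?_) (fun hb' => ?_)
  · simp [Alg.isEmpty, Cond.cost, Expr.cost, Expr.eval, hs0, hin.inPtr]
    omega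
  · simp only [Alg.isEmpty, Cond.eval, Expr.eval, hs0, hin.inPtr, decide_eq_true_eq] at hb'
    have hup0 := G.up_zero v hv hb'
    refine Tri.seq (Tri.store ?_ (Tri.seq (Tri.store ?_ (Tri.skip ?_))))
    · simp [Expr.cost, Expr.eval, hs0]
      omega
    · simp [Expr.cost, Expr.eval, hs0]
      omega
    · simp only [Alg.isEmpty, Cond.cost, Expr.cost, Expr.eval, hs0, Cost.time_seq, Cost.time_step,
        Cost.time_access]
      have hinv := hs.visit (v := v) (fun i hi hd => by
        obtain ⟨j, h1, h2, -⟩ := G.in_surj i hi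
        rw [hd] at h1 h2
        omega)
      rw [hup0] at hinv
      have h3 := hpot _ hb
      refine ⟨by simpa using hinv, rfl, by simp, ?_, ?_, ?_, ?_⟩
      · intro u hu
        by_cases h : u = v
        · simp [h]
        · simpa [h] using hu
      · intro u hu
        have h : u ≠ v := by rintro rfl; omega
        simp [h]
      · intro a h1 h2
        simp [h1, h2]
      · simp only [Function.update_self, ne_eq, reduceCtorEq, not_false_eq_true,
          Function.update_of_ne]
        omega
  · simp only [Alg.isEmpty, Cond.eval, Expr.eval, hs0, hin.inPtr, decide_eq_false_iff_not] at hb'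
    refine Tri.seq (Tri.assign ?_ (Tri.seq ?_))
    · simp [Expr.cost, Expr.eval]
    simp only [Alg.isEmpty, Cond.cost, Expr.cost, Expr.eval, Cost.time_seq, Cost.time_step,
      Cost.time_access]
    refine Tri.forEach v D.inPtr D.inAdj D.src (UpLoop D up v s) ?_ hin.inPtr hpv ?_ ?_ ?_ ?_ ?_
      ?_ ?_
    · simpa using hs0
    · omega
    · omega
    · intro j h1 h2
      obtain ⟨h3, h4⟩ := G.in_mem v hv j h1 h2
      have := G.src_lt _ h3
      omega
    · intro j τ t h
      exact ⟨h.arg, h.idx, h.inv.input.inPtr, h.inv.input.inAdj, h.inv.input.src⟩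
    · refine ⟨hs, rfl, by simpa using hs0, by simp, fun _ h => h, fun _ _ => rfl,
        fun _ _ _ => rfl, by simp, fun k h1 h2 => by omega, by simp⟩
    · intro j τ t h1 h2 hL
      obtain ⟨h3, h4⟩ := G.in_mem v hv j h1 h2
      have h5 := G.src_lt _ h3
      have h6 := G.up_src_lt h3
      have h7 := G.up_le _ h3
      rw [h4] at h6 h7
      have hrec := ih _ (hk ▸ h6) (D.src (D.inAdj j)) h5
        ⟨Function.update (fun _ => 0) 0 (D.src (D.inAdj j)), τ.mem, τ.out⟩ hL.inv (by simp) rfl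
      refine Tri.seq (Tri.call ?_ ?_)
      · simp [Expr.cost]
        omega
      simp only [Expr.eval, Function.update_self]
      refine Tri.mono hrec fun τ' t' hp => ?_
      have hr := hp.inv.rep _ h5 hp.seen
      have hfr : (Alg.procs o .prepUpward).frame = 6 := rfl
      have hin' := hp.inv.input
      have hb4 := hL.best_le
      have htime := hp.time
      have htime' := hL.time
      simp only at htime
      -- Both outcomes of the comparison restore the loop invariant; `b` is the new best length and
      -- `x` the time of the whole iteration, including the overhead of the loop. The 60 and the 10
      -- of the recursive call stay below the 100 reserved per edge.
      have hloop : ∀ (b x : ℕ), b ≤ up v → τ.loc 4 ≤ b →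
          up (D.src (D.inAdj j)) + D.len (D.inAdj j) ≤ b → x ≤ t' + 60 →
          ∀ l : ℕ → ℕ, l 0 = v → l 1 = j + 1 → l 4 = b →
          UpLoop D up v s (j + 1) ⟨l, τ'.mem, τ'.out⟩ (t + x) := by
        intro b x g1 g2 g3 g4 l l0 l1 l4
        refine ⟨hp.inv, hp.out.trans hL.out, l0, l1, fun u hu => hp.mono u (hL.mono u hu), ?_, ?_,
          by simpa [l4] using g1, ?_, ?_⟩
        · intro u hu
          rw [← hL.frame u hu]
          exact hp.frame u (by omega)
        · intro a a1 a2
          rw [← hL.others a a1 a2]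
          exact hp.others a a1 a2
        · intro k k1 k2
          simp only [l4]
          by_cases hkj : k = j
          · subst hkj
            exact ⟨hp.seen, g3⟩
          · obtain ⟨q1, q2⟩ := hL.done k k1 (by omega)
            exact ⟨hp.mono _ q1, q2.trans g2⟩
        · simp only
          omega
      refine Tri.seq (Tri.ite ?_ (fun hc => ?_) (fun hc => ?_))
      · simp [Cond.cost, Expr.cost, Expr.eval, hr, hin'.len]
        omega
      · simp [Cond.eval, Expr.eval, hr, hin'.len] at hc
        refine Tri.assign ?_ (Tri.skip ?_)
        · simp [Expr.cost, Expr.eval, hr, hin'.len]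
          omega
        · simp only [Cond.cost, Expr.cost, Expr.eval, Cost.time_seq, Cost.time_step,
            Cost.time_access, hfr]
          refine ⟨by simpa using hL.idx, ?_⟩
          exact hloop _ _ h7 hc.le le_rfl (by omega) _ (by simpa using hL.arg) (by simp)
            (by simp [hr, hin'.len])
      · simp [Cond.eval, Expr.eval, hr, hin'.len] at hc
        refine Tri.skip (Tri.skip ?_)
        simp only [Cond.cost, Expr.cost, Cost.time_seq, Cost.time_step, Cost.time_access, hfr]
        refine ⟨by simpa using hL.idx, ?_⟩
        exact hloop _ _ hb4 le_rfl hc (by omega) _ (by simpa using hL.arg) (by simp) (by simp)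
    · intro τ t hL
      have hsrc : ∀ i < D.numE, D.dst i = v → τ.mem .seenUp (D.src i) = 1 ∧
          up (D.src i) + D.len i ≤ τ.loc 4 := by
        intro i hi hd
        obtain ⟨j, h1, h2, rfl⟩ := G.in_surj i hi
        rw [hd] at h1 h2
        exact hL.done j h1 h2
      -- The running maximum never exceeds `up v` and has passed the edge that attains it.
      have hbest : τ.loc 4 = up v := by
        obtain ⟨i, hi, hd, he⟩ := G.up_attained v hv (by omega)
        have := (hsrc i hi hd).2
        exact le_antisymm hL.best_le (by omega)
      -- The recursive calls reach only nodes with smaller `up`, so `v` is still unmarked and its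
      -- share of the potential is still available.
      have hv1 : τ.mem .seenUp v ≠ 1 := by rwa [hL.frame v le_rfl]
      have h3 := hpot _ hv1
      have htime := hL.time
      have harg := hL.arg
      refine Tri.seq (Tri.store ?_ (Tri.seq (Tri.store ?_ (Tri.skip ?_))))
      · simp [Expr.cost, Expr.eval, harg, hbest]
        omega
      · simp [Expr.cost, Expr.eval, harg]
        omega
      simp only [Expr.cost, Expr.eval, harg, hbest, Cost.time_step]
      have hinv := hL.inv.visit (v := v) fun i hi hd => (hsrc i hi hd).1
      refine ⟨by simpa using hinv, hL.out, by simp, ?_, ?_, ?_, ?_⟩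
      · intro u hu
        by_cases h : u = v
        · simp [h]
        · simpa [h] using hL.mono u hu
      · intro u hu
        have h : u ≠ v := by rintro rfl; omega
        simpa [h] using hL.frame u (by omega)
      · intro a h1 h2
        simpa [h1, h2] using hL.others a h1 h2
      · simp only [Function.update_self, ne_eq, reduceCtorEq, not_false_eq_true,
          Function.update_of_ne]
        omega

/-! ## The downward search -/

theorem NumGraph.prim_unique (G : NumGraph D o σ up dn prim) {i k : ℕ} (hi : i < D.numE)
    (hk : k < D.numE) (hs : D.src i = D.src k) (h : prim i) (h' : prim k) : i = k := by
  by_contra hne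
  exact (G.prim_best i hi k hk hs hne h).asymm (G.prim_best k hk i hi hs.symm (Ne.symm hne) h')

/-- The invariant of the downward search. -/
structure DownInv (D : SelfIndex) (dn : ℕ → ℕ) (prim : ℕ → Prop) (m : Arr → ℕ → ℕ) : Prop where
  input : Input D m
  seen_le : ∀ v, m .seenDown v ≤ 1
  primary_le : ∀ i, m .primary i ≤ 1
  rep : ∀ v < D.numV, m .seenDown v = 1 → m .repDown v = dn v
  closed : ∀ i < D.numE, m .seenDown (D.src i) = 1 → m .seenDown (D.dst i) = 1
  primary : ∀ i < D.numE, m .primary i = 1 ↔ m .seenDown (D.src i) = 1 ∧ prim i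

/-- The effect of the downward search at `v`. -/
structure DownPost (D : SelfIndex) (up dn : ℕ → ℕ) (prim : ℕ → Prop) (v : ℕ) (σ τ : State Arr)
    (t : ℕ) : Prop where
  inv : DownInv D dn prim τ.mem
  out : τ.out = σ.out
  seen : τ.mem .seenDown v = 1
  mono : ∀ u, σ.mem .seenDown u = 1 → τ.mem .seenDown u = 1
  frame : ∀ u, up u < up v → τ.mem .seenDown u = σ.mem .seenDown u
  others : ∀ a, a ≠ .repDown → a ≠ .seenDown → a ≠ .primary → τ.mem a = σ.mem a
  time : t + pot D.outPtr (τ.mem .seenDown) D.numV ≤ 10 + pot D.outPtr (σ.mem .seenDown) D.numV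

/-- The invariant of the loop of the downward search. -/
structure DownLoop (D : SelfIndex) (up dn : ℕ → ℕ) (prim : ℕ → Prop) (v : ℕ) (σ : State Arr)
    (j : ℕ) (τ : State Arr) (t : ℕ) : Prop where
  inv : DownInv D dn prim τ.mem
  out : τ.out = σ.out
  arg : τ.loc 0 = v
  idx : τ.loc 1 = j
  mono : ∀ u, σ.mem .seenDown u = 1 → τ.mem .seenDown u = 1
  frame : ∀ u, up u ≤ up v → τ.mem .seenDown u = σ.mem .seenDown u
  others : ∀ a, a ≠ .repDown → a ≠ .seenDown → a ≠ .primary → τ.mem a = σ.mem a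
  best_lt : τ.loc 5 < D.numE
  first : j = D.outPtr v → τ.loc 4 = 0
  best : D.outPtr v < j → D.src (τ.loc 5) = v ∧
    τ.loc 4 = D.len (τ.loc 5) + dn (D.dst (τ.loc 5))
  done : ∀ k, D.outPtr v ≤ k → k < j → τ.mem .seenDown (D.dst (D.outAdj k)) = 1 ∧
    (prim (D.outAdj k) → τ.loc 5 = D.outAdj k)
  time : t + pot D.outPtr (τ.mem .seenDown) D.numV ≤
    3 + pot D.outPtr (σ.mem .seenDown) D.numV + 100 * (j - D.outPtr v)

theorem DownInv.visit_sink {m : Arr → ℕ → ℕ} (h : DownInv D dn prim m) {v : ℕ}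
    (hsrc : ∀ i < D.numE, D.src i ≠ v) :
    DownInv D dn prim (Function.update (Function.update m .repDown
      (Function.update (m .repDown) v (dn v))) .seenDown
        (Function.update (m .seenDown) v 1)) := by
  refine ⟨h.input.of_others ?_, ?_, by simpa using h.primary_le, ?_, ?_, ?_⟩
  · intro a h1 h2 h3 h4 _
    simp [h3, h4]
  · intro u
    by_cases hu : u = v
    · simp [hu]
    · simpa [hu] using h.seen_le u
  · intro u hu hs
    by_cases huv : u = v
    · simp [huv]
    · simp only [Function.update_self, ne_eq, huv, not_false_eq_true, Function.update_of_ne] at hs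
      simpa [huv] using h.rep u hu hs
  · intro i hi hs
    simp only [Function.update_self] at hs ⊢
    rw [Function.update_of_ne (hsrc i hi)] at hs
    by_cases h1 : D.dst i = v
    · simp [h1]
    · rw [Function.update_of_ne h1]
      exact h.closed i hi hs
  · intro i hi
    simpa [hsrc i hi] using h.primary i hi

/-- Finishing `v` adds the single mark `b`. By uniqueness of the primary edge, the other edges
leaving `v` are rightly left unmarked. -/
theorem DownInv.visit (G : NumGraph D o σ up dn prim) {m : Arr → ℕ → ℕ} (h : DownInv D dn prim m)
    {v b : ℕ} (hb : b < D.numE) (hbv : D.src b = v) (hbp : prim b) (hv : m .seenDown v ≠ 1)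
    (hdst : ∀ i < D.numE, D.src i = v → m .seenDown (D.dst i) = 1) :
    DownInv D dn prim (Function.update (Function.update (Function.update m .primary
      (Function.update (m .primary) b 1)) .repDown
      (Function.update (m .repDown) v (dn v))) .seenDown
        (Function.update (m .seenDown) v 1)) := by
  refine ⟨h.input.of_others ?_, ?_, ?_, ?_, ?_, ?_⟩
  · intro a h1 h2 h3 h4 h5
    simp [h3, h4, h5]
  · intro u
    by_cases hu : u = v
    · simp [hu]
    · simpa [hu] using h.seen_le u
  · intro u
    by_cases hu : u = b
    · simp [hu]
    · simpa [hu] using h.primary_le u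
  · intro u hu hs
    by_cases huv : u = v
    · simp [huv]
    · simp only [Function.update_self, ne_eq, huv, not_false_eq_true, Function.update_of_ne] at hs
      simpa [huv] using h.rep u hu hs
  · intro i hi hs
    simp only [Function.update_self] at hs ⊢
    by_cases h1 : D.dst i = v
    · simp [h1]
    · rw [Function.update_of_ne h1]
      by_cases h2 : D.src i = v
      · exact hdst i hi h2
      · rw [Function.update_of_ne h2] at hs
        exact h.closed i hi hs
  · intro i hi
    have hp := h.primary i hi
    by_cases hib : i = b
    · subst hib
      simp [hbv, hbp]
    · by_cases hiv : D.src i = v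
      · have : ¬ prim i := fun hpi => hib (G.prim_unique hi hb (hiv.trans hbv.symm) hpi hbp)
        simp [hib, hiv, this]
        rw [hp, hiv]
        simp [hv]
      · simpa [hib, hiv] using hp

/-- Here the measure is `D.n - up v`, as `up` grows along edges. The primary edge strictly beats
every other edge leaving `v`, so the running best ends there for any order of the list. -/
theorem tri_prepDownward (G : NumGraph D o σ up dn prim) {A W : ℕ}
    (hA : D.numE + D.numV + 2 ≤ A) (hW : D.n + σ + D.numE + D.numV + 2 ≤ W) (v : ℕ)
    (hv : v < D.numV) (s : State Arr) (hs : DownInv D dn prim s.mem) (hs0 : s.loc 0 = v)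
    (hs5 : s.loc 5 = 0) :
    Tri (Alg.procs o) A W (Alg.prepDownward o) s (DownPost D up dn prim v s) := by
  induction hk : D.n - up v using Nat.strong_induction_on generalizing v s with
  | _ k ih =>
  have hin := hs.input
  have hseen := hs.seen_le v
  have hpv := G.outPtr_mono v hv
  have hpe := G.outPtr_le (v := v + 1) hv
  have hdnn := G.dn_le_n v hv
  unfold Alg.prepDownward
  refine Tri.ite ?_ (fun hb => ?_) (fun hb => ?_)
  · simp [Cond.cost, Expr.cost, Expr.eval, hs0]
    omega
  · simp only [Cond.eval, Expr.eval, hs0, decide_eq_true_eq] at hb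
    refine Tri.skip ⟨hs, rfl, hb, fun _ h => h, fun _ _ => rfl, fun _ _ _ _ => rfl, ?_⟩
    simp only [Cond.cost, Expr.cost, Cost.time_seq, Cost.time_step, Cost.time_access]
    omega
  simp only [Cond.eval, Expr.eval, hs0, decide_eq_false_iff_not] at hb
  have hpot : ∀ seen : ℕ → ℕ, seen v ≠ 1 → _ := fun seen h => pot_update (ptr := D.outPtr) hv h
  refine Tri.ite ?_ (fun hb' => ?_) (fun hb' => ?_)
  · simp [Alg.isEmpty, Cond.cost, Expr.cost, Expr.eval, hs0, hin.outPtr]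
    omega
  · simp only [Alg.isEmpty, Cond.eval, Expr.eval, hs0, hin.outPtr, decide_eq_true_eq] at hb'
    have hdn0 := G.dn_zero v hv hb'
    refine Tri.seq (Tri.store ?_ (Tri.seq (Tri.store ?_ (Tri.skip ?_))))
    · simp [Expr.cost, Expr.eval, hs0]
      omega
    · simp [Expr.cost, Expr.eval, hs0]
      omega
    · simp only [Alg.isEmpty, Cond.cost, Expr.cost, Expr.eval, hs0, Cost.time_seq, Cost.time_step,
        Cost.time_access]
      have hinv := hs.visit_sink (v := v) (fun i hi hd => by
        obtain ⟨j, h1, h2, -⟩ := G.out_surj i hi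
        rw [hd] at h1 h2
        omega)
      rw [hdn0] at hinv
      have h3 := hpot _ hb
      refine ⟨by simpa using hinv, rfl, by simp, ?_, ?_, ?_, ?_⟩
      · intro u hu
        by_cases h : u = v
        · simp [h]
        · simpa [h] using hu
      · intro u hu
        have h : u ≠ v := by rintro rfl; omega
        simp [h]
      · intro a h1 h2 h3
        simp [h1, h2]
      · simp only [Function.update_self, ne_eq, reduceCtorEq, not_false_eq_true,
          Function.update_of_ne]
        omega
  · simp only [Alg.isEmpty, Cond.eval, Expr.eval, hs0, hin.outPtr, decide_eq_false_iff_not] at hb'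
    refine Tri.seq (Tri.assign ?_ (Tri.seq ?_))
    · simp [Expr.cost, Expr.eval]
    simp only [Alg.isEmpty, Cond.cost, Expr.cost, Expr.eval, Cost.time_seq, Cost.time_step,
      Cost.time_access]
    refine Tri.forEach v D.outPtr D.outAdj D.dst (DownLoop D up dn prim v s) ?_ hin.outPtr hpv
      ?_ ?_ ?_ ?_ ?_ ?_ ?_
    · simpa using hs0
    · omega
    · omega
    · intro j h1 h2
      obtain ⟨h3, h4⟩ := G.out_mem v hv j h1 h2
      have := G.dst_lt _ h3
      omega
    · intro j τ t h
      exact ⟨h.arg, h.idx, h.inv.input.outPtr, h.inv.input.outAdj, h.inv.input.dst⟩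
    -- Variable `5` starts at `0`, which is a valid edge number since there is an edge. This matters
    -- because the condition evaluates both alternatives, so the symbol of `best` is read even
    -- before any path has been found.
    · refine ⟨hs, rfl, by simpa using hs0, by simp, fun _ h => h, fun _ _ => rfl,
        fun _ _ _ _ => rfl, by simpa [hs5] using G.numE_pos, by simp, fun h => by omega,
        fun k h1 h2 => by omega, by simp⟩
    · intro j τ t h1 h2 hL
      obtain ⟨h3, h4⟩ := G.out_mem v hv j h1 h2
      have h5 := G.dst_lt _ h3
      have h6 := G.up_src_lt h3
      have h7 := G.sum_le _ h3
      have h8 := G.len_pos _ h3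
      have h9 := G.up_le_n _ h5
      have h10 := G.sym_le _ h3
      have h11 := G.sym_le _ hL.best_lt
      rw [h4] at h6 h7
      have hrec := ih _ (by omega) (D.dst (D.outAdj j)) h5
        ⟨Function.update (fun _ => 0) 0 (D.dst (D.outAdj j)), τ.mem, τ.out⟩ hL.inv (by simp)
        (by simp) rfl
      refine Tri.seq (Tri.call ?_ ?_)
      · simp [Expr.cost]
        omega
      simp only [Expr.eval, Function.update_self]
      refine Tri.mono hrec fun τ' t' hp => ?_
      have hr := hp.inv.rep _ h5 hp.seen
      have hfr : (Alg.procs o .prepDownward).frame = 7 := by cases o <;> rfl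
      have hin' := hp.inv.input
      have hb5 := hL.best_lt
      have htime := hp.time
      have htime' := hL.time
      simp only at htime
      have hb4 : τ.loc 4 ≤ D.n := by
        rcases h1.eq_or_lt with h | h
        · rw [hL.first h.symm]
          exact Nat.zero_le _
        · have := G.sum_le _ hb5
          have := (hL.best h).2
          omega
      have hloop : ∀ (b x : ℕ), b < D.numE → D.src b = v → (prim (D.outAdj j) → b = D.outAdj j) →
          (∀ k, D.outPtr v ≤ k → k < j → prim (D.outAdj k) → b = D.outAdj k) → x ≤ t' + 70 →
          ∀ l : ℕ → ℕ, l 0 = v → l 1 = j + 1 → l 4 = D.len b + dn (D.dst b) → l 5 = b →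
          DownLoop D up dn prim v s (j + 1) ⟨l, τ'.mem, τ'.out⟩ (t + x) := by
        intro b x g1 g2 g3 g4 g5 l l0 l1 l4 l5
        refine ⟨hp.inv, hp.out.trans hL.out, l0, l1, fun u hu => hp.mono u (hL.mono u hu), ?_, ?_,
          by simpa [l5] using g1, fun h => by omega, fun _ => by simpa [l5] using ⟨g2, l4⟩, ?_, ?_⟩
        · intro u hu
          rw [← hL.frame u hu]
          exact hp.frame u (by omega)
        · intro a a1 a2 a3
          rw [← hL.others a a1 a2 a3]
          exact hp.others a a1 a2 a3
        · intro k k1 k2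
          simp only [l5]
          by_cases hkj : k = j
          · subst hkj
            exact ⟨hp.seen, g3⟩
          · obtain ⟨q1, q2⟩ := hL.done k k1 (by omega)
            exact ⟨hp.mono _ q1, g4 k k1 (by omega)⟩
        · simp only
          omega
      have hcost : ∀ l : ℕ → ℕ, l 2 = D.outAdj j → l 3 = D.dst (D.outAdj j) → l 4 = τ.loc 4 →
          l 5 = τ.loc 5 →
          (Cond.cost ⟨l, τ'.mem, τ'.out⟩
            (.or (.eq Alg.bestLen (.num 0)) (Alg.better o))).Le A W ∧
          (Cond.cost ⟨l, τ'.mem, τ'.out⟩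
            (.or (.eq Alg.bestLen (.num 0)) (Alg.better o))).time ≤ 20 := by
        intro l l2 l3 l4 l5
        cases o
        · simp [Alg.better, Cond.cost, Expr.cost, Expr.eval, hin'.sym, l2, l4, l5]
          omega
        · simp [Alg.better, Cond.cost, Expr.cost, Expr.eval, hin'.len, hr, l2, l3, l4]
          omega
      -- After the first edge `bestLen` is positive, because labels are nonempty, so the test
      -- reduces to the comparison itself.
      have heval : D.outPtr v < j → ∀ l : ℕ → ℕ, l 2 = D.outAdj j → l 3 = D.dst (D.outAdj j) →
          l 4 = τ.loc 4 → l 5 = τ.loc 5 → ((Cond.eval ⟨l, τ'.mem, τ'.out⟩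
            (.or (.eq Alg.bestLen (.num 0)) (Alg.better o))) = true ↔
              Beats D dn o (D.outAdj j) (τ.loc 5)) := by
        intro hj l l2 l3 l4 l5
        obtain ⟨b1, b2⟩ := hL.best hj
        have b3 := G.len_pos _ hb5
        have b4 : τ.loc 4 ≠ 0 := by omega
        cases o
        · simp [Alg.better, Cond.eval, Expr.eval, hin'.sym, l2, l4, l5, b4, Beats]
        · simp [Alg.better, Cond.eval, Expr.eval, hin'.len, hr, l2, l3, l4, b4, Beats, ← b2]
      have hc1 := hcost (Function.update (Function.update τ.loc 2 (D.outAdj j)) 3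
        (D.dst (D.outAdj j))) (by simp) (by simp) (by simp) (by simp)
      have he1 := fun hj => heval hj (Function.update (Function.update τ.loc 2 (D.outAdj j)) 3
        (D.dst (D.outAdj j))) (by simp) (by simp) (by simp) (by simp)
      refine Tri.seq (Tri.ite hc1.1 (fun hc => ?_) (fun hc => ?_))
      · refine Tri.seq (Tri.assign ?_ (Tri.seq (Tri.assign ?_ (Tri.skip (Tri.skip ?_)))))
        · simp [Expr.cost, Expr.eval, hr, hin'.len]
          omega
        · simp [Expr.cost, Expr.eval]
          omega
        · simp only [Expr.cost, Expr.eval, Cost.time_seq, Cost.time_step, Cost.time_access, hfr]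
          refine ⟨by simpa using hL.idx, ?_⟩
          refine hloop (D.outAdj j) _ h3 h4 (fun _ => rfl) ?_ (by omega) _ (by simpa using hL.arg)
            (by simp) (by simp [hr, hin'.len]) (by simp)
          -- Had the primary edge come earlier, it would be the current best, and the new edge could
          -- not beat it.
          intro k k1 k2 k3
          by_contra hne
          obtain ⟨q1, q2⟩ := G.out_mem v hv k k1 (by omega)
          have hbk := (hL.done k k1 k2).2 k3
          have hbt := G.prim_best _ q1 _ h3 (q2.trans h4.symm) (Ne.symm hne) k3
          rw [← hbk] at hbt
          exact hbt.asymm ((he1 (by omega)).1 hc)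
      · have hj : D.outPtr v < j := by
          rcases h1.eq_or_lt with h | h
          · simp [Cond.eval, Expr.eval, hL.first h.symm] at hc
          · exact h
        obtain ⟨b1, b2⟩ := hL.best hj
        refine Tri.skip (Tri.skip ?_)
        simp only [Expr.cost, Cost.time_step, hfr]
        refine ⟨by simpa using hL.idx, ?_⟩
        refine hloop (τ.loc 5) _ hb5 b1 ?_ (fun k k1 k2 => (hL.done k k1 k2).2) (by omega) _
          (by simpa using hL.arg) (by simp) (by simpa using b2) (by simp)
        -- A primary edge would have beaten the current best, contrary to the outcome of the test.
        intro hpj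
        by_contra hne
        have hbt := (he1 hj).2 (G.prim_best _ h3 _ hb5 (h4.trans b1.symm) (Ne.symm hne) hpj)
        rw [hc] at hbt
        exact Bool.false_ne_true hbt
    · intro τ t hL
      have hj : D.outPtr v < D.outPtr (v + 1) := by omega
      have hdst : ∀ i < D.numE, D.src i = v → τ.mem .seenDown (D.dst i) = 1 ∧
          (prim i → τ.loc 5 = i) := by
        intro i hi hd
        obtain ⟨j, h1, h2, rfl⟩ := G.out_surj i hi
        rw [hd] at h1 h2
        exact hL.done j h1 h2
      obtain ⟨b1, b2⟩ := hL.best hj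
      have hprim : prim (τ.loc 5) := by
        obtain ⟨i, hi, hd, hp⟩ := G.prim_exists v hv hj
        rwa [(hdst i hi hd).2 hp]
      have hbest : τ.loc 4 = dn v := by
        rw [b2, ← G.dn_prim _ hL.best_lt hprim, b1]
      have hv1 : τ.mem .seenDown v ≠ 1 := by rwa [hL.frame v le_rfl]
      have h3 := hpot _ hv1
      have htime := hL.time
      have harg := hL.arg
      have hlt := hL.best_lt
      refine Tri.seq (Tri.store ?_ (Tri.seq (Tri.store ?_ (Tri.seq (Tri.store ?_ (Tri.skip ?_))))))
      · simp [Expr.cost, Expr.eval]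
        omega
      · simp [Expr.cost, Expr.eval, harg, hbest]
        omega
      · simp [Expr.cost, Expr.eval, harg]
        omega
      simp only [Expr.cost, Expr.eval, harg, hbest, Cost.time_step]
      have hinv := hL.inv.visit G hlt b1 hprim hv1 fun i hi hd => (hdst i hi hd).1
      refine ⟨by simpa using hinv, hL.out, by simp, ?_, ?_, ?_, ?_⟩
      · intro u hu
        by_cases h : u = v
        · simp [h]
        · simpa [h] using hL.mono u hu
      · intro u hu
        have h : u ≠ v := by rintro rfl; omega
        simpa [h] using hL.frame u (by omega)
      · intro a h1 h2 h3
        simpa [h1, h2, h3] using hL.others a h1 h2 h3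
      · simp only [Function.update_self, ne_eq, reduceCtorEq, not_false_eq_true,
          Function.update_of_ne]
        omega

/-! ## The backward search -/

open Classical in
/-- The output of the backward search at `v`; `k` bounds the recursion depth. -/
noncomputable def searchOut (D : SelfIndex) (up dn : ℕ → ℕ) (prim : ℕ → Prop) :
    ℕ → ℕ → List (ℕ × ℕ)
  | 0, _ => []
  | k + 1, v =>
    if D.inPtr v = D.inPtr (v + 1) then [(D.n + 1 - dn v, 0)]
    else (adjList D.inPtr D.inAdj v).flatMap fun i =>
      if prim i then searchOut D up dn prim k (D.src i)
      else [(D.n + 1 - up (D.src i) - D.len i - dn v, up (D.src i))]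

open Classical in
/-- The nodes visited by the backward search at `v`; `k` bounds the recursion depth. -/
noncomputable def searchVisited (D : SelfIndex) (prim : ℕ → Prop) : ℕ → ℕ → List ℕ
  | 0, _ => []
  | k + 1, v => v :: (adjList D.inPtr D.inAdj v).flatMap fun i =>
      if prim i then searchVisited D prim k (D.src i) else []

/-- The time that the backward search spends on the node `v` itself. -/
def nodeTime (ptr : ℕ → ℕ) (v : ℕ) : ℕ := 60 + 100 * (ptr (v + 1) - ptr v)

/-- The state after the preprocessing. -/
structure Prepared (D : SelfIndex) (up dn : ℕ → ℕ) (prim : ℕ → Prop) (m : Arr → ℕ → ℕ) :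
    Prop where
  input : Input D m
  up : ∀ v < D.numV, m .repUp v = up v
  dn : ∀ v < D.numV, m .repDown v = dn v
  primary_le : ∀ i, m .primary i ≤ 1
  primary : ∀ i < D.numE, m .primary i = 1 ↔ prim i

theorem range'_map_flatMap_succ {α : Type*} (g : ℕ → ℕ) (F : ℕ → List α) {a j : ℕ} (h : a ≤ j) :
    ((List.range' a (j + 1 - a)).map g).flatMap F =
      ((List.range' a (j - a)).map g).flatMap F ++ F (g j) := by
  rw [Nat.sub_add_comm h, List.range'_concat]
  simp [h]

/-- Separates the program from the combinatorics: the run is compared with the recursive list of its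
outputs and charged to the list of visited nodes. The depth `k` suffices since `up` drops at each
call. -/
theorem tri_qIrrGLPF (G : NumGraph D o σ up dn prim) {A W : ℕ}
    (hA : D.numE + D.numV + 2 ≤ A) (hW : D.n + σ + D.numE + D.numV + 2 ≤ W) (k v : ℕ)
    (hv : v < D.numV) (hk : up v < k) (s : State Arr) (hs : Prepared D up dn prim s.mem)
    (hs0 : s.loc 0 = v) :
    Tri (Alg.procs o) A W Alg.qIrrGLPF s fun τ t => τ.mem = s.mem ∧
      τ.out = s.out ++ searchOut D up dn prim k v ∧
      t ≤ ((searchVisited D prim k v).map (nodeTime D.inPtr)).sum := by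
  classical
  induction k generalizing v s with
  | zero => omega
  | succ k ih =>
  have hin := hs.input
  have hpv := G.inPtr_mono v hv
  have hpe := G.inPtr_le (v := v + 1) hv
  have hdn := hs.dn v hv
  have hdnn := G.dn_le_n v hv
  unfold Alg.qIrrGLPF
  refine Tri.ite ?_ (fun hb => ?_) (fun hb => ?_)
  · simp [Alg.isEmpty, Cond.cost, Expr.cost, Expr.eval, hs0, hin.inPtr]
    omega
  · simp only [Alg.isEmpty, Cond.eval, Expr.eval, hs0, hin.inPtr, decide_eq_true_eq] at hb
    refine Tri.emit ?_ ⟨rfl, ?_, ?_⟩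
    · simp [Expr.cost, Expr.eval, hs0, hin.n, hdn]
      omega
    · simp [searchOut, hb, Expr.eval, hs0, hin.n, hdn]
    · simp only [Alg.isEmpty, Cond.cost, Expr.cost, Cost.time_seq, Cost.time_step,
        Cost.time_access, searchVisited, List.map_cons, List.sum_cons, nodeTime]
      omega
  · simp only [Alg.isEmpty, Cond.eval, Expr.eval, hs0, hin.inPtr, decide_eq_false_iff_not] at hb
    simp only [Alg.isEmpty, Cond.cost, Expr.cost, Cost.time_seq, Cost.time_step, Cost.time_access]
    have hO : searchOut D up dn prim (k + 1) v =
        ((List.range' (D.inPtr v) (D.inPtr (v + 1) - D.inPtr v)).map D.inAdj).flatMap fun i =>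
          if prim i then searchOut D up dn prim k (D.src i)
          else [(D.n + 1 - up (D.src i) - D.len i - dn v, up (D.src i))] := by
      simp [searchOut, hb, adjList]
    have hV : searchVisited D prim (k + 1) v =
        v :: ((List.range' (D.inPtr v) (D.inPtr (v + 1) - D.inPtr v)).map D.inAdj).flatMap
          fun i => if prim i then searchVisited D prim k (D.src i) else [] := rfl
    rw [hO, hV]
    generalize hF : (fun i => if prim i then searchOut D up dn prim k (D.src i)
          else [(D.n + 1 - up (D.src i) - D.len i - dn v, up (D.src i))]) = F
    generalize hF' : (fun i => if prim i then searchVisited D prim k (D.src i) else []) = F'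
    refine Tri.forEach v D.inPtr D.inAdj D.src (fun j τ t => τ.loc 0 = v ∧ τ.loc 1 = j ∧
      τ.mem = s.mem ∧
      τ.out = s.out ++ ((List.range' (D.inPtr v) (j - D.inPtr v)).map D.inAdj).flatMap F ∧
      t ≤ 3 + 100 * (j - D.inPtr v) +
        ((((List.range' (D.inPtr v) (j - D.inPtr v)).map D.inAdj).flatMap F').map
          (nodeTime D.inPtr)).sum) hs0 hin.inPtr hpv ?_ ?_ ?_ ?_ ?_ ?_ ?_
    · omega
    · omega
    · intro j h1 h2
      obtain ⟨h3, h4⟩ := G.in_mem v hv j h1 h2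
      have := G.src_lt _ h3
      omega
    · rintro j τ t ⟨h0, h1, h2, -, -⟩
      exact ⟨h0, h1, by rw [h2, hin.inPtr], by rw [h2, hin.inAdj], by rw [h2, hin.src]⟩
    · exact ⟨by simpa using hs0, by simp, rfl, by simp, by simp⟩
    · rintro j τ t h1 h2 ⟨l0, l1, hm, ho, ht⟩
      obtain ⟨h3, h4⟩ := G.in_mem v hv j h1 h2
      have h5 := G.src_lt _ h3
      have h6 := G.up_src_lt h3
      have h7 := G.sum_le _ h3
      have h8 := hs.up _ h5
      have h9 := hs.primary_le (D.inAdj j)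
      have h10 := hs.primary _ h3
      rw [h4] at h6 h7
      rw [range'_map_flatMap_succ _ _ h1, range'_map_flatMap_succ _ _ h1, List.map_append,
        List.sum_append, ← List.append_assoc, ← ho]
      refine Tri.ite ?_ (fun hc => ?_) (fun hc => ?_)
      · simp [Cond.cost, Expr.cost, Expr.eval, hm]
        omega
      · simp only [Cond.eval, Expr.eval, hm, decide_eq_true_eq] at hc
        have hp : prim (D.inAdj j) := h10.1 (by simpa using hc)
        have hFj : F (D.inAdj j) = searchOut D up dn prim k (D.src (D.inAdj j)) := by
          simp [← hF, hp]
        have hFj' : F' (D.inAdj j) = searchVisited D prim k (D.src (D.inAdj j)) := by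
          simp [← hF', hp]
        refine Tri.call ?_ ?_
        · simp [Expr.cost]
          omega
        simp only [Expr.eval, Function.update_self]
        refine Tri.mono (ih (D.src (D.inAdj j)) h5 (by omega)
          ⟨Function.update (fun _ => 0) 0 (D.src (D.inAdj j)), τ.mem, τ.out⟩
          (by simpa [hm] using hs) (by simp)) fun τ' t' ⟨q1, q2, q3⟩ => ?_
        have hfr : (Alg.procs o .qIrrGLPF).frame = 5 := rfl
        refine ⟨by simpa using l1, by simpa using l0, by simp, q1.trans hm, ?_, ?_⟩
        · rw [hFj]
          exact q2
        · simp only [Cond.cost, Expr.cost, Cost.time_seq, Cost.time_step, Cost.time_access, hfr,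
            hFj']
          omega
      · simp only [Cond.eval, Expr.eval, hm, decide_eq_false_iff_not] at hc
        have hp : ¬ prim (D.inAdj j) := fun h => hc (by simpa using h10.2 h)
        refine Tri.emit ?_ ?_
        · simp [Expr.cost, Expr.eval, hm, hin.n, hin.len, h8, l0, hdn]
          omega
        · refine ⟨by simpa using l1, by simpa using l0, by simp, hm, ?_, ?_⟩
          · simp [Expr.eval, hm, hin.n, hin.len, h8, l0, hdn, ← hF, hp]
          · simp only [Cond.cost, Expr.cost, Cost.time_seq, Cost.time_step, Cost.time_access]
            omega
    · rintro τ t ⟨l0, l1, hm, ho, ht⟩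
      refine ⟨hm, ho, ?_⟩
      rw [List.map_cons, List.sum_cons, nodeTime]
      omega

/-! ## The nodes visited by the backward search -/

theorem mem_adjList {ptr adj : ℕ → ℕ} {v i : ℕ} :
    i ∈ adjList ptr adj v ↔ ∃ j, ptr v ≤ j ∧ j < ptr (v + 1) ∧ adj j = i := by
  simp only [adjList, List.mem_map, List.mem_range'_1]
  constructor
  · rintro ⟨j, h, rfl⟩
    exact ⟨j, by omega, by omega, rfl⟩
  · rintro ⟨j, h1, h2, rfl⟩
    exact ⟨j, by omega, rfl⟩

namespace NumGraph

theorem mem_inAdj (G : NumGraph D o σ up dn prim) {v i : ℕ} (hv : v < D.numV) :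
    i ∈ adjList D.inPtr D.inAdj v ↔ i < D.numE ∧ D.dst i = v := by
  rw [mem_adjList]
  constructor
  · rintro ⟨j, h1, h2, rfl⟩
    exact G.in_mem v hv j h1 h2
  · rintro ⟨hi, rfl⟩
    exact G.in_surj i hi

theorem inPtr_ne (G : NumGraph D o σ up dn prim) {i : ℕ} (hi : i < D.numE) :
    D.inPtr (D.dst i) ≠ D.inPtr (D.dst i + 1) := by
  obtain ⟨j, h1, h2, -⟩ := G.in_surj i hi
  omega

/-- Induction against the direction of the edges, from the sink. -/
theorem sink_induction (G : NumGraph D o σ up dn prim) {p : ℕ → Prop} (hsink : p D.sink)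
    (hstep : ∀ i < D.numE, prim i → p (D.dst i) → p (D.src i)) (v : ℕ) (hv : v < D.numV) :
    p v := by
  induction hk : D.n - up v using Nat.strong_induction_on generalizing v with
  | _ k ih =>
    rcases (G.outPtr_mono v hv).eq_or_lt with h | h
    · exact G.out_empty v hv h ▸ hsink
    · obtain ⟨i, hi, rfl, hp⟩ := G.prim_exists v hv h
      have h1 := G.up_src_lt hi
      have h2 := G.dst_lt i hi
      have h3 := G.up_le_n _ h2
      exact hstep i hi hp (ih _ (by omega) _ h2 rfl)

/-- `w` is the node after `u` on the primary path from `u` to the sink. -/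
def Step (D : SelfIndex) (prim : ℕ → Prop) (u w : ℕ) : Prop :=
  ∃ i < D.numE, prim i ∧ D.src i = u ∧ D.dst i = w

theorem step_rightUnique (G : NumGraph D o σ up dn prim) : Relator.RightUnique (Step D prim) := by
  rintro u w w' ⟨i, hi, hp, rfl, rfl⟩ ⟨k, hk, hp', hs, rfl⟩
  rw [G.prim_unique hi hk hs.symm hp hp']

theorem up_le_of_reach (G : NumGraph D o σ up dn prim) {u w : ℕ}
    (h : Relation.ReflTransGen (Step D prim) u w) : up u ≤ up w := by
  induction h with
  | refl => exact le_rfl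
  | tail _ hs ih =>
    obtain ⟨i, hi, -, rfl, rfl⟩ := hs
    exact ih.trans (G.up_src_lt hi).le

theorem reach_of_mem_searchVisited (G : NumGraph D o σ up dn prim) {k v u : ℕ}
    (hv : v < D.numV) (h : u ∈ searchVisited D prim k v) :
    u < D.numV ∧ Relation.ReflTransGen (Step D prim) u v := by
  induction k generalizing v with
  | zero => simp [searchVisited] at h
  | succ k ih =>
    simp only [searchVisited, List.mem_cons, List.mem_flatMap] at h
    rcases h with rfl | ⟨i, hi, hu⟩
    · exact ⟨hv, .refl⟩
    · obtain ⟨h1, rfl⟩ := (G.mem_inAdj hv).1 hi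
      split_ifs at hu with hp
      · obtain ⟨h2, h3⟩ := ih (G.src_lt i h1) hu
        exact ⟨h2, h3.tail ⟨i, h1, hp, rfl, rfl⟩⟩
      · simp at hu

/-- Two distinct primary edges with the same destination are reached from disjoint sets of nodes. -/
theorem eq_of_reach (G : NumGraph D o σ up dn prim) {u i k : ℕ} (hi : i < D.numE)
    (hk : k < D.numE) (hpi : prim i) (hpk : prim k) (hd : D.dst i = D.dst k)
    (h : Relation.ReflTransGen (Step D prim) u (D.src i))
    (h' : Relation.ReflTransGen (Step D prim) u (D.src k)) : i = k := by
  -- The only primary step from the source of `i` leads to the common destination; a path from there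
  -- back to the source of `k` would contradict the growth of `up`.
  have aux : ∀ {i k : ℕ}, i < D.numE → k < D.numE → prim i → prim k → D.dst i = D.dst k →
      Relation.ReflTransGen (Step D prim) (D.src i) (D.src k) → i = k := by
    intro i k hi hk hpi hpk hd h
    rcases Relation.ReflTransGen.cases_head h with e | ⟨w, hw, hr⟩
    · exact G.prim_unique hi hk e hpi hpk
    · have := G.step_rightUnique hw ⟨i, hi, hpi, rfl, rfl⟩
      subst this
      have h1 := G.up_le_of_reach hr
      have h2 := G.up_src_lt hk
      rw [← hd] at h2
      omega
  rcases Relation.ReflTransGen.total_of_right_unique G.step_rightUnique h h' with h | h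
  · exact aux hi hk hpi hpk hd h
  · exact (aux hk hi hpk hpi hd.symm h).symm

/-- Backward walks through distinct primary edges into one node never meet, and none returns to its
start because `up` decreases. So no marks are needed in this search. -/
theorem searchVisited_nodup (G : NumGraph D o σ up dn prim) (k v : ℕ) (hv : v < D.numV) :
    (searchVisited D prim k v).Nodup := by
  induction k generalizing v with
  | zero => simp [searchVisited]
  | succ k ih =>
    rw [searchVisited, List.nodup_cons, List.nodup_flatMap]
    refine ⟨?_, ?_, ?_⟩
    · rw [List.mem_flatMap]
      rintro ⟨i, hi, hu⟩
      obtain ⟨h1, rfl⟩ := (G.mem_inAdj hv).1 hi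
      split_ifs at hu with hp
      · have h2 := G.up_le_of_reach (G.reach_of_mem_searchVisited (G.src_lt i h1) hu).2
        have h3 := G.up_src_lt h1
        omega
      · simp at hu
    · intro i hi
      obtain ⟨h1, rfl⟩ := (G.mem_inAdj hv).1 hi
      split_ifs
      · exact ih _ (G.src_lt i h1)
      · simp
    · refine (G.in_nodup v hv).imp_of_mem fun {i j} hi hj hne => ?_
      obtain ⟨h1, h2⟩ := (G.mem_inAdj hv).1 hi
      obtain ⟨h3, h4⟩ := (G.mem_inAdj hv).1 hj
      intro u hu hu'
      simp only at hu hu'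
      split_ifs at hu with hp
      · split_ifs at hu' with hp'
        · exact hne (G.eq_of_reach h1 h3 hp hp' (h2.trans h4.symm)
            (G.reach_of_mem_searchVisited (G.src_lt i h1) hu).2
            (G.reach_of_mem_searchVisited (G.src_lt j h3) hu').2)
        · simp at hu'
      · simp at hu

/-! ### Total time of the searches -/

theorem pot_zero (ptr seen : ℕ → ℕ) (N : ℕ) (hz : ∀ v, seen v = 0) (h0 : ptr 0 = 0)
    (h : ∀ v < N, ptr v ≤ ptr (v + 1)) : pot ptr seen N = 60 * N + 100 * ptr N := by
  unfold pot
  simp only [hz, zero_ne_one, if_false]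
  induction N with
  | zero => simp [h0]
  | succ N ih =>
    rw [Finset.sum_range_succ, ih fun v hv => h v (by omega)]
    have := h N (by omega)
    omega

/-- As no node is visited twice, the charges add up to at most the full potential, in which the
degrees sum to `D.numE`. -/
theorem sum_searchVisited_le (G : NumGraph D o σ up dn prim) (k v : ℕ) (hv : v < D.numV) :
    ((searchVisited D prim k v).map (nodeTime D.inPtr)).sum ≤ 60 * D.numV + 100 * D.numE := by
  rw [← List.sum_toFinset _ (G.searchVisited_nodup k v hv), ← G.inPtr_last,
    ← pot_zero D.inPtr (fun _ => 0) D.numV (fun _ => rfl) G.inPtr_zero G.inPtr_mono]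
  unfold pot
  simp only [zero_ne_one, if_false]
  refine Finset.sum_le_sum_of_subset (f := nodeTime D.inPtr) fun u hu => ?_
  rw [List.mem_toFinset] at hu
  exact Finset.mem_range.2 (G.reach_of_mem_searchVisited hv hu).1

/-! ## The output of the backward search -/

theorem mem_searchOut (G : NumGraph D o σ up dn prim) (x : ℕ × ℕ) :
    x ∈ searchOut D up dn prim (up D.sink + 1) D.sink ↔ x = (D.n + 1 - dn D.root, 0) ∨
      ∃ i < D.numE, ¬ prim i ∧
        x = (D.n + 1 - up (D.src i) - D.len i - dn (D.dst i), up (D.src i)) := by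
  constructor
  · suffices h : ∀ k, ∀ v < D.numV, x ∈ searchOut D up dn prim k v → _ from h _ _ G.sink_lt
    intro k
    induction k with
    | zero => simp [searchOut]
    | succ k ih =>
      intro v hv hx
      rw [searchOut] at hx
      split_ifs at hx with h0
      · rw [G.in_empty v hv h0] at hx
        exact Or.inl (by simpa using hx)
      · obtain ⟨i, hi, hx⟩ := List.mem_flatMap.1 hx
        obtain ⟨h1, rfl⟩ := (G.mem_inAdj hv).1 hi
        split_ifs at hx with hp
        · exact ih _ (G.src_lt i h1) hx
        · exact Or.inr ⟨i, h1, hp, by simpa using hx⟩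
  -- Whatever the search at `v` writes is also written by the search at the sink, since the primary
  -- path from `v` leads there.
  · have climb : ∀ v < D.numV, (∀ k, up v < k → x ∈ searchOut D up dn prim k v) →
        x ∈ searchOut D up dn prim (up D.sink + 1) D.sink := by
      refine G.sink_induction (fun h => h _ (Nat.lt_succ_self _)) fun i hi hp h hx => h fun k hk => ?_
      have h1 := G.up_src_lt hi
      cases k with
      | zero => omega
      | succ k =>
        rw [searchOut, if_neg (G.inPtr_ne hi), List.mem_flatMap]
        refine ⟨i, (G.mem_inAdj (G.dst_lt i hi)).2 ⟨hi, rfl⟩, ?_⟩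
        rw [if_pos hp]
        exact hx k (by omega)
    rintro (rfl | ⟨i, hi, hp, rfl⟩)
    · refine climb D.root G.root_lt fun k hk => ?_
      cases k with
      | zero => omega
      | succ k => simp [searchOut, G.in_root]
    · refine climb (D.dst i) (G.dst_lt i hi) fun k hk => ?_
      cases k with
      | zero => omega
      | succ k =>
        rw [searchOut, if_neg (G.inPtr_ne hi), List.mem_flatMap]
        refine ⟨i, (G.mem_inAdj (G.dst_lt i hi)).2 ⟨hi, rfl⟩, ?_⟩
        simp [hp]

/-- The output is sorted if the lengths of the members of each node that are spelled by paths
through different incoming edges are separated. -/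
theorem searchOut_sorted (G : NumGraph D o σ up dn prim) (lens : ℕ → Set ℕ)
    (hup : ∀ v < D.numV, up v ∈ lens v) (hle : ∀ v < D.numV, ∀ l ∈ lens v, l + dn v ≤ D.n)
    (hstep : ∀ i < D.numE, ∀ l ∈ lens (D.src i), l + D.len i ∈ lens (D.dst i))
    (hsep : ∀ v < D.numV, (adjList D.inPtr D.inAdj v).Pairwise fun i j =>
      ∀ a ∈ lens (D.src i), ∀ b ∈ lens (D.src j), b + D.len j < a + D.len i)
    (k v : ℕ) (hv : v < D.numV) :
    (searchOut D up dn prim k v).Pairwise fun x y => x.1 < y.1 := by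
  classical
  -- Every position written through the edge `i` comes from a member of its source followed by the
  -- label and the lower representative of the destination. For a primary edge this uses that the
  -- lower representative of the source absorbs the label.
  have hedge : ∀ k, ∀ i < D.numE, (∀ v < D.numV, ∀ x ∈ searchOut D up dn prim k v,
      ∃ l ∈ lens v, x.1 = D.n + 1 - (l + dn v)) →
      ∀ x ∈ (if prim i then searchOut D up dn prim k (D.src i)
        else [(D.n + 1 - up (D.src i) - D.len i - dn (D.dst i), up (D.src i))]),
      ∃ l ∈ lens (D.src i), x.1 = D.n + 1 - (l + D.len i + dn (D.dst i)) := by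
    intro k i hi ih x hx
    split_ifs at hx with hp
    · obtain ⟨l, hl, hx'⟩ := ih _ (G.src_lt i hi) x hx
      exact ⟨l, hl, by rw [hx', G.dn_prim i hi hp, add_assoc]⟩
    · rw [List.mem_singleton] at hx
      subst hx
      exact ⟨_, hup _ (G.src_lt i hi), by simp only; omega⟩
  have hmem : ∀ k, ∀ v < D.numV, ∀ x ∈ searchOut D up dn prim k v,
      ∃ l ∈ lens v, x.1 = D.n + 1 - (l + dn v) := by
    intro k
    induction k with
    | zero => simp [searchOut]
    | succ k ih =>
      intro v hv x hx
      rw [searchOut] at hx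
      split_ifs at hx with h0
      · rw [List.mem_singleton] at hx
        subst hx
        exact ⟨up v, hup v hv, by simp [G.up_zero v hv h0]⟩
      · obtain ⟨i, hi, hx⟩ := List.mem_flatMap.1 hx
        obtain ⟨h1, rfl⟩ := (G.mem_inAdj hv).1 hi
        obtain ⟨l, hl, hx'⟩ := hedge k i h1 ih x hx
        exact ⟨_, hstep i h1 l hl, hx'⟩
  induction k generalizing v with
  | zero => simp [searchOut]
  | succ k ih =>
    rw [searchOut]
    split_ifs with h0
    · simp
    · rw [List.pairwise_flatMap]
      refine ⟨fun i hi => ?_, (hsep v hv).imp_of_mem fun {i j} hi hj hlt x hx y hy => ?_⟩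
      · obtain ⟨h1, rfl⟩ := (G.mem_inAdj hv).1 hi
        split_ifs
        · exact ih _ (G.src_lt i h1)
        · simp
      · obtain ⟨h1, h2⟩ := (G.mem_inAdj hv).1 hi
        obtain ⟨h3, h4⟩ := (G.mem_inAdj hv).1 hj
        obtain ⟨a, ha, hxa⟩ := hedge k i h1 (hmem k) x (by rw [h2]; exact hx)
        obtain ⟨b, hb, hyb⟩ := hedge k j h3 (hmem k) y (by rw [h4]; exact hy)
        have hab := hlt a ha b hb
        have hle' := hle _ (G.dst_lt i h1) _ (hstep i h1 a ha)
        rw [hxa, hyb, h4]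
        rw [h2] at hle' ⊢
        omega

/-- Some edge is primary and writes no pair of its own, which makes room for the entry of the
trivial suffix. -/
theorem length_searchOut_le (G : NumGraph D o σ up dn prim)
    (hs : (searchOut D up dn prim (up D.sink + 1) D.sink).Pairwise fun x y => x.1 < y.1) :
    (searchOut D up dn prim (up D.sink + 1) D.sink).length ≤ D.numE := by
  classical
  have hnd : (searchOut D up dn prim (up D.sink + 1) D.sink).Nodup :=
    hs.imp fun {x y} h e => by rw [e] at h; exact lt_irrefl _ h
  rw [← List.toFinset_card_of_nodup hnd]
  obtain ⟨i, hi, -, hp⟩ := G.prim_exists (D.src 0) (G.src_lt 0 G.numE_pos) (by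
    obtain ⟨j, h1, h2, -⟩ := G.out_surj 0 G.numE_pos
    omega)
  have hsub : (searchOut D up dn prim (up D.sink + 1) D.sink).toFinset ⊆
      insert (D.n + 1 - dn D.root, 0) (((Finset.range D.numE).erase i).image fun i =>
        (D.n + 1 - up (D.src i) - D.len i - dn (D.dst i), up (D.src i))) := by
    intro x hx
    rw [List.mem_toFinset, G.mem_searchOut] at hx
    rw [Finset.mem_insert, Finset.mem_image]
    rcases hx with hx | ⟨k, hk, hpk, hx⟩
    · exact Or.inl hx
    · refine Or.inr ⟨k, Finset.mem_erase.2 ⟨?_, Finset.mem_range.2 hk⟩, hx.symm⟩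
      rintro rfl
      exact hpk hp
  have h1 := Finset.card_le_card hsub
  have h2 := Finset.card_insert_le (D.n + 1 - dn D.root, 0)
    (((Finset.range D.numE).erase i).image fun i =>
      (D.n + 1 - up (D.src i) - D.len i - dn (D.dst i), up (D.src i)))
  have h3 := Finset.card_image_le (s := (Finset.range D.numE).erase i)
    (f := fun i => (D.n + 1 - up (D.src i) - D.len i - dn (D.dst i), up (D.src i)))
  have h4 := Finset.card_erase_of_mem (Finset.mem_range.2 hi)
  rw [Finset.card_range] at h4
  omega

end NumGraph

/-! ## The whole algorithm -/

theorem tri_main (G : NumGraph D o σ up dn prim) :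
    Tri (Alg.procs o) (D.numE + D.numV + 2) (D.n + σ + D.numE + D.numV + 2) Alg.main D.init
      fun τ t => τ.out = searchOut D up dn prim (up D.sink + 1) D.sink ∧
        t ≤ 180 * D.numV + 300 * D.numE + 60 := by
  have hroot := G.root_lt
  have hsink := G.sink_lt
  have hin : Input D D.init.mem := by
    constructor <;> rfl
  have hUp : UpInv D up D.init.mem :=
    ⟨hin, fun _ => Nat.zero_le _, fun v _ h => absurd h (zero_ne_one (α := ℕ)),
      fun v _ h => absurd h (zero_ne_one (α := ℕ))⟩
  have hpotU := NumGraph.pot_zero D.inPtr (D.init.mem .seenUp) D.numV (fun _ => rfl) G.inPtr_zero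
    G.inPtr_mono
  have hpotD := NumGraph.pot_zero D.outPtr (D.init.mem .seenDown) D.numV (fun _ => rfl)
    G.outPtr_zero G.outPtr_mono
  rw [G.inPtr_last] at hpotU
  rw [G.outPtr_last] at hpotD
  have frU : (Alg.procs o .prepUpward).frame = 6 := rfl
  have frD : (Alg.procs o .prepDownward).frame = 7 := by cases o <;> rfl
  have frQ : (Alg.procs o .qIrrGLPF).frame = 5 := rfl
  refine Tri.seq (Tri.call ?_ ?_)
  · simp [Expr.cost, Expr.eval, hin.sink]
    omega
  simp only [Expr.eval, hin.sink]
  refine Tri.mono (tri_prepUpward G le_rfl le_rfl D.sink hsink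
    ⟨Function.update (fun _ => 0) 0 D.sink, D.init.mem, D.init.out⟩ hUp (by simp))
    fun τ₁ t₁ h₁ => ?_
  have hin₁ := h₁.inv.input
  have hDown : DownInv D dn prim τ₁.mem := by
    have hz : ∀ a : Arr, a ≠ .repUp → a ≠ .seenUp → D.init.mem a = 0 → τ₁.mem a = 0 :=
      fun a b c d => (h₁.others a b c).trans d
    have z1 := hz .seenDown (by simp) (by simp) rfl
    have z2 := hz .primary (by simp) (by simp) rfl
    exact ⟨hin₁, by simp [z1], by simp [z2], by simp [z1], by simp [z1], by simp [z1, z2]⟩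
  -- The marked nodes contain the sink and are closed under predecessors. Every node reaches the
  -- sink, so all are marked.
  have hUp₁ : ∀ v < D.numV, τ₁.mem .repUp v = up v := fun v hv =>
    h₁.inv.rep v hv (G.sink_induction (p := fun v => τ₁.mem .seenUp v = 1) h₁.seen
      (fun i hi _ h => h₁.inv.closed i hi h) v hv)
  refine Tri.seq (Tri.call ?_ ?_)
  · simp [Expr.cost, Expr.eval, hin₁.root]
    omega
  simp only [Expr.eval, hin₁.root]
  refine Tri.mono (tri_prepDownward G le_rfl le_rfl D.root hroot
    ⟨Function.update (fun _ => 0) 0 D.root, τ₁.mem, τ₁.out⟩ hDown (by simp) (by simp))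
    fun τ₂ t₂ h₂ => ?_
  have hin₂ := h₂.inv.input
  -- Dually, the marks are closed under successors and contain the root, from which every node is
  -- reached.
  have hseen : ∀ v < D.numV, τ₂.mem .seenDown v = 1 := by
    intro v
    induction hk : up v using Nat.strong_induction_on generalizing v with
    | _ k ih =>
      intro hv
      rcases (G.inPtr_mono v hv).eq_or_lt with h | h
      · rw [G.in_empty v hv h]
        exact h₂.seen
      · obtain ⟨i, hi, rfl, -⟩ := G.up_attained v hv h
        exact h₂.inv.closed i hi (ih _ (hk ▸ G.up_src_lt hi) _ rfl (G.src_lt i hi))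
  have hprep : Prepared D up dn prim τ₂.mem :=
    ⟨hin₂, fun v hv => by rw [h₂.others .repUp (by simp) (by simp) (by simp)]; exact hUp₁ v hv,
      fun v hv => h₂.inv.rep v hv (hseen v hv), h₂.inv.primary_le, fun i hi => by
        rw [h₂.inv.primary i hi]
        simp [hseen _ (G.src_lt i hi)]⟩
  refine Tri.seq (Tri.call ?_ ?_)
  · simp [Expr.cost, Expr.eval, hin₂.sink]
    omega
  simp only [Expr.eval, hin₂.sink]
  refine Tri.mono (tri_qIrrGLPF G le_rfl le_rfl (up D.sink + 1) D.sink hsink (Nat.lt_succ_self _)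
    ⟨Function.update (fun _ => 0) 0 D.sink, τ₂.mem, τ₂.out⟩ hprep (by simp))
    fun τ₃ t₃ ⟨_, h₃, h₃'⟩ => ?_
  refine Tri.skip ⟨?_, ?_⟩
  · simp only [h₃, h₂.out, h₁.out]
    rfl
  · have e1 := h₁.time
    have e2 := h₂.time
    have e3 := G.sum_searchVisited_le (up D.sink + 1) D.sink hsink
    have e4 : τ₁.mem .seenDown = D.init.mem .seenDown := h₁.others _ (by simp) (by simp)
    simp only [e4, hpotD] at e2
    simp only [hpotU] at e1
    simp only [Expr.cost, Cost.time_seq, Cost.time_step, Cost.time_access, frU, frD, frQ]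
    omega

/-! ## The numbered graph of a self-index -/

theorem exists_edge_src {T : Str} (hT : IsText T) {v : Node T} (hv : v ≠ sink T) :
    ∃ f ∈ edges T, f.src = v := by
  obtain ⟨f, hf, h, -⟩ := exists_isPrimary_down hT .pos hv
  exact ⟨f, hf, h⟩

namespace SelfIndex.Represents

variable {D : SelfIndex} {T : Str} {node : Fin D.numV ≃ Node T} {edge : Fin D.numE ≃ edges T}

/-- A function on the nodes, in terms of the numbers of the nodes. -/
noncomputable def onNodes (node : Fin D.numV ≃ Node T) (g : Node T → ℕ) (v : ℕ) : ℕ :=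
  if h : v < D.numV then g (node ⟨v, h⟩) else 0

theorem onNodes_of_lt {g : Node T → ℕ} {v : ℕ} (h : v < D.numV) :
    onNodes node g v = g (node ⟨v, h⟩) := dif_pos h

@[simp] theorem onNodes_symm {g : Node T → ℕ} (x : Node T) :
    onNodes node g (node.symm x) = g x := by
  simp [onNodes]

/-- The `(+)`-primary edges, in terms of the numbers of the edges. -/
def PrimaryIdx (o : PathOrder) (edge : Fin D.numE ≃ edges T) (i : ℕ) : Prop :=
  ∃ h : i < D.numE, IsPrimary o .down (edge ⟨i, h⟩).1

theorem primaryIdx_iff {o : PathOrder} {i : ℕ} (h : i < D.numE) :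
    PrimaryIdx o edge i ↔ IsPrimary o .down (edge ⟨i, h⟩).1 :=
  ⟨fun ⟨_, hp⟩ => hp, fun hp => ⟨h, hp⟩⟩

theorem numE_le_size (edge : Fin D.numE ≃ edges T) : D.numE ≤ size T := by
  have : (edges T).ncard = D.numE := by
    rw [← Nat.card_coe_set_eq, ← Nat.card_congr edge, Nat.card_eq_fintype_card, Fintype.card_fin]
  rw [size, this]
  exact Nat.le_add_right _ _

variable (R : D.Represents T node edge)

include R

theorem src_eq' {i : ℕ} (hi : i < D.numE) : D.src i = node.symm (edge ⟨i, hi⟩).1.src :=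
  R.src_eq ⟨i, hi⟩

theorem dst_eq' {i : ℕ} (hi : i < D.numE) : D.dst i = node.symm (edge ⟨i, hi⟩).1.dst :=
  R.dst_eq ⟨i, hi⟩

theorem len_eq' {i : ℕ} (hi : i < D.numE) : D.len i = (edge ⟨i, hi⟩).1.lab.length :=
  R.len_eq ⟨i, hi⟩

theorem sym_eq' {i : ℕ} (hi : i < D.numE) : (edge ⟨i, hi⟩).1.lab.head? = some (D.sym i) :=
  R.sym_eq ⟨i, hi⟩

/-! ### Translation between numbers and the CDAWG -/

theorem eq_of_dst {v i : ℕ} (hv : v < D.numV) (hi : i < D.numE) :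
    (edge ⟨i, hi⟩).1.dst = node ⟨v, hv⟩ ↔ D.dst i = v := by
  rw [R.dst_eq' hi]
  constructor
  · intro h
    simp [h]
  · rintro rfl
    simp

theorem eq_of_src {v i : ℕ} (hv : v < D.numV) (hi : i < D.numE) :
    (edge ⟨i, hi⟩).1.src = node ⟨v, hv⟩ ↔ D.src i = v := by
  rw [R.src_eq' hi]
  constructor
  · intro h
    simp [h]
  · rintro rfl
    simp

theorem exists_dst {v : ℕ} (hv : v < D.numV) (h : D.inPtr v ≠ D.inPtr (v + 1) ∨
    node ⟨v, hv⟩ ≠ Cdawg.root T) : ∃ i, ∃ hi : i < D.numE, (edge ⟨i, hi⟩).1.dst = node ⟨v, hv⟩ := by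
  rcases h with h | h
  · have := R.inPtr_mono v hv
    obtain ⟨hi, hd⟩ := (R.mem_in ⟨v, hv⟩ (D.inAdj (D.inPtr v))).1
      (mem_adjList.2 ⟨_, le_rfl, by simp only; omega, rfl⟩)
    exact ⟨_, hi, hd⟩
  · obtain ⟨f, hf, hd⟩ := exists_edge_dst h
    refine ⟨edge.symm ⟨f, hf⟩, (edge.symm ⟨f, hf⟩).2, by simpa using hd⟩

theorem inPtr_lt_of_dst {v i : ℕ} (hv : v < D.numV) (hi : i < D.numE)
    (h : (edge ⟨i, hi⟩).1.dst = node ⟨v, hv⟩) : D.inPtr v < D.inPtr (v + 1) := by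
  obtain ⟨j, h1, h2, -⟩ := mem_adjList.1 ((R.mem_in ⟨v, hv⟩ i).2 ⟨hi, h⟩)
  simp only at h1 h2
  omega

theorem exists_src {v : ℕ} (hv : v < D.numV) (h : D.outPtr v ≠ D.outPtr (v + 1)) :
    ∃ i, ∃ hi : i < D.numE, (edge ⟨i, hi⟩).1.src = node ⟨v, hv⟩ := by
  have := R.outPtr_mono v hv
  obtain ⟨hi, hd⟩ := (R.mem_out ⟨v, hv⟩ (D.outAdj (D.outPtr v))).1
    (mem_adjList.2 ⟨_, le_rfl, by simp only; omega, rfl⟩)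
  exact ⟨_, hi, hd⟩

theorem outPtr_lt_of_src {v i : ℕ} (hv : v < D.numV) (hi : i < D.numE)
    (h : (edge ⟨i, hi⟩).1.src = node ⟨v, hv⟩) : D.outPtr v < D.outPtr (v + 1) := by
  obtain ⟨j, h1, h2, -⟩ := mem_adjList.1 ((R.mem_out ⟨v, hv⟩ i).2 ⟨hi, h⟩)
  simp only at h1 h2
  omega

/-- The only link from the string side to the program proofs. There is an edge because the sink,
having `T` as a member, differs from the root. -/
theorem numGraph (hT : IsText T) (o : PathOrder) {σ : ℕ} (hσ : ∀ a ∈ T, a ≤ σ) :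
    NumGraph D o σ (onNodes node fun v => (rep o .up v).length)
      (onNodes node fun v => (rep o .down v).length) (PrimaryIdx o edge) := by
  have hsr : Cdawg.sink T ≠ Cdawg.root T := by
    intro e
    have h1 := (cls_eq_root_iff hT).1 e
    exact hT.ne_nil h1
  have hlen : ∀ f ∈ edges T, (rep o .up f.src).length + f.lab.length +
      (rep o .down f.dst).length ≤ T.length := by
    intro f hf
    have := length_le_of_mem_Suf (viaEdge_mem_Suf hT o hf)
    simp only [viaEdge, List.length_append] at this
    omega
  have hrep : ∀ v : Node T, (rep o .up v).length + (rep o .down v).length ≤ T.length := by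
    intro v
    have := length_le_of_mem_Suf (append_mem_Suf hT (rep_mem hT o .up v) (rep_mem hT o .down v))
    simpa using this
  constructor
  · obtain ⟨f, hf, -⟩ := exists_edge_src hT hsr.symm
    exact Nat.zero_lt_of_lt (edge.symm ⟨f, hf⟩).2
  · rw [R.root_eq]
    exact (node.symm _).2
  · rw [R.sink_eq]
    exact (node.symm _).2
  · intro i hi
    rw [R.src_eq' hi]
    exact (node.symm _).2
  · intro i hi
    rw [R.dst_eq' hi]
    exact (node.symm _).2
  · intro i hi
    rw [R.len_eq' hi]
    exact List.length_pos_iff.2 (lab_ne_nil (edge ⟨i, hi⟩).2)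
  · intro i hi
    apply hσ
    have h1 := List.mem_of_mem_head? (R.sym_eq' hi)
    have h2 := suffix_of_mem_U_down hT (lab_append_mem_U_down (edge ⟨i, hi⟩).2
      (rep_mem hT o .down (edge ⟨i, hi⟩).1.dst))
    exact h2.subset (List.mem_append_left _ h1)
  · intro i hi
    rw [R.src_eq' hi, R.dst_eq' hi, R.len_eq' hi, onNodes_symm, onNodes_symm, R.n_eq]
    exact hlen _ (edge ⟨i, hi⟩).2
  · intro v hv
    rw [onNodes_of_lt hv, R.n_eq]
    have := hrep (node ⟨v, hv⟩)
    omega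
  · intro v hv
    rw [onNodes_of_lt hv, R.n_eq]
    have := hrep (node ⟨v, hv⟩)
    omega
  · exact R.inPtr_zero
  · exact R.inPtr_last
  · exact R.inPtr_mono
  · exact R.outPtr_zero
  · exact R.outPtr_last
  · exact R.outPtr_mono
  · intro v hv j h1 h2
    obtain ⟨hi, hd⟩ := (R.mem_in ⟨v, hv⟩ (D.inAdj j)).1 (mem_adjList.2 ⟨j, h1, h2, rfl⟩)
    exact ⟨hi, (R.eq_of_dst hv hi).1 hd⟩
  · intro i hi
    have hv : D.dst i < D.numV := by
      rw [R.dst_eq' hi]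
      exact (node.symm _).2
    exact mem_adjList.1 ((R.mem_in ⟨_, hv⟩ i).2 ⟨hi, (R.eq_of_dst hv hi).2 rfl⟩)
  · intro v hv j h1 h2
    obtain ⟨hi, hd⟩ := (R.mem_out ⟨v, hv⟩ (D.outAdj j)).1 (mem_adjList.2 ⟨j, h1, h2, rfl⟩)
    exact ⟨hi, (R.eq_of_src hv hi).1 hd⟩
  · intro i hi
    have hv : D.src i < D.numV := by
      rw [R.src_eq' hi]
      exact (node.symm _).2
    exact mem_adjList.1 ((R.mem_out ⟨_, hv⟩ i).2 ⟨hi, (R.eq_of_src hv hi).2 rfl⟩)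
  · exact fun v hv => R.in_nodup ⟨v, hv⟩
  · intro v hv h
    by_contra hne
    obtain ⟨i, hi, hd⟩ := R.exists_dst hv (Or.inr fun e => hne (by rw [R.root_eq, ← e]; simp))
    have := R.inPtr_lt_of_dst hv hi hd
    omega
  · by_contra h
    have hv : D.root < D.numV := by
      rw [R.root_eq]
      exact (node.symm _).2
    obtain ⟨i, hi, hd⟩ := R.exists_dst hv (Or.inl h)
    refine dst_ne_root hT (edge ⟨i, hi⟩).2 (hd.trans ?_)
    simp [R.root_eq]
  · intro v hv h
    by_contra hne
    obtain ⟨f, hf, hs⟩ := exists_edge_src hT (v := node ⟨v, hv⟩)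
      fun e => hne (by rw [R.sink_eq, ← e]; simp)
    have := R.outPtr_lt_of_src hv (edge.symm ⟨f, hf⟩).2 (by simpa using hs)
    omega
  · intro i hi
    rw [R.src_eq' hi, R.dst_eq' hi, R.len_eq' hi, onNodes_symm, onNodes_symm]
    have hf := (edge ⟨i, hi⟩).2
    simpa using length_le_rep hT o (append_lab_mem_U_up hf (rep_mem hT o .up _))
  · intro v hv h
    obtain ⟨k, hk, hd⟩ := R.exists_dst hv (Or.inl h.ne)
    obtain ⟨f, hf, hfd, hp⟩ := exists_isPrimary_up hT o (v := node ⟨v, hv⟩)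
      (hd ▸ dst_ne_root hT (edge ⟨k, hk⟩).2)
    have hi := (edge.symm ⟨f, hf⟩).2
    have he : (edge ⟨_, hi⟩).1 = f := by simp
    refine ⟨_, hi, (R.eq_of_dst hv hi).1 (by rw [he, hfd]), ?_⟩
    rw [R.src_eq' hi, R.len_eq' hi, onNodes_symm, onNodes_of_lt hv, he, ← hfd,
      (isPrimary_up_iff hT hf).1 hp, List.length_append]
  · intro v hv h
    by_cases hr : node ⟨v, hv⟩ = Cdawg.root T
    · rw [onNodes_of_lt hv, hr, rep_root hT]
      rfl
    · obtain ⟨i, hi, hd⟩ := R.exists_dst hv (Or.inr hr)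
      have := R.inPtr_lt_of_dst hv hi hd
      omega
  · intro v hv h
    by_cases hr : node ⟨v, hv⟩ = Cdawg.sink T
    · rw [onNodes_of_lt hv, hr, rep_sink hT]
      rfl
    · obtain ⟨f, hf, hs⟩ := exists_edge_src hT hr
      have := R.outPtr_lt_of_src hv (edge.symm ⟨f, hf⟩).2 (by simpa using hs)
      omega
  · rintro i hi hp
    rw [primaryIdx_iff hi, isPrimary_down_iff hT (edge ⟨i, hi⟩).2] at hp
    rw [R.src_eq' hi, R.dst_eq' hi, R.len_eq' hi, onNodes_symm, onNodes_symm, hp,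
      List.length_append]
  · intro v hv h
    obtain ⟨k, hk, hs⟩ := R.exists_src hv h.ne
    obtain ⟨f, hf, hfs, hp⟩ := exists_isPrimary_down hT o (v := node ⟨v, hv⟩)
      (hs ▸ src_ne_sink hT (edge ⟨k, hk⟩).2)
    have hi := (edge.symm ⟨f, hf⟩).2
    have he : (edge ⟨_, hi⟩).1 = f := by simp
    exact ⟨_, hi, (R.eq_of_src hv hi).1 (by rw [he, hfs]), (primaryIdx_iff hi).2 (by rwa [he])⟩
  · intro i hi k hk hs hne hp
    rw [primaryIdx_iff hi] at hp
    have hs' : (edge ⟨i, hi⟩).1.src = (edge ⟨k, hk⟩).1.src := by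
      rw [R.src_eq' hi, R.src_eq' hk] at hs
      exact node.symm.injective (Fin.ext hs)
    have hne' : (edge ⟨i, hi⟩).1 ≠ (edge ⟨k, hk⟩).1 := by
      intro e
      have := edge.injective (Subtype.ext e)
      exact hne (congrArg Fin.val this)
    have := better_of_isPrimary_down hT (edge ⟨i, hi⟩).2 (edge ⟨k, hk⟩).2 hs' hne' hp
    cases o
    · exact this _ _ (R.sym_eq' hi) (R.sym_eq' hk)
    · simp only [Beats]
      rw [R.dst_eq' hi, R.dst_eq' hk, R.len_eq' hi, R.len_eq' hk, onNodes_symm, onNodes_symm]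
      exact this

/-- The abstract sets of lengths become the lengths of the members of the nodes; their separation is
`length_lt_of_edgePosLe`. -/
theorem searchOut_sorted (hT : IsText T) (o : PathOrder) {σ : ℕ} (hσ : ∀ a ∈ T, a ≤ σ) (k v : ℕ)
    (hv : v < D.numV) :
    (searchOut D (onNodes node fun v => (rep o .up v).length)
      (onNodes node fun v => (rep o .down v).length) (PrimaryIdx o edge) k v).Pairwise
        fun x y => x.1 < y.1 := by
  have G := R.numGraph hT o hσ
  refine G.searchOut_sorted (fun v => {l | ∃ h : v < D.numV, ∃ S ∈ U .up (node ⟨v, h⟩),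
    S.length = l}) ?_ ?_ ?_ ?_ k v hv
  · intro v hv
    exact ⟨hv, _, rep_mem hT o .up _, (onNodes_of_lt (g := fun v => (rep o .up v).length) hv).symm⟩
  · rintro v hv l ⟨_, S, hS, rfl⟩
    rw [onNodes_of_lt hv, R.n_eq]
    have := length_le_of_mem_Suf (append_mem_Suf hT hS (rep_mem hT o .down _))
    simpa using this
  · rintro i hi l ⟨h, S, hS, rfl⟩
    have h' := G.dst_lt i hi
    rw [← (R.eq_of_src h hi).2 rfl] at hS
    have := append_lab_mem_U_up (edge ⟨i, hi⟩).2 hS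
    rw [(R.eq_of_dst h' hi).2 rfl] at this
    exact ⟨h', _, this, by rw [List.length_append, R.len_eq' hi]⟩
  · intro v hv
    refine ((G.in_nodup v hv).and (R.in_sorted ⟨v, hv⟩)).imp_of_mem ?_
    rintro i j hi hj ⟨hne, hle⟩ a ⟨h, X, hX, rfl⟩ b ⟨h', Y, hY, rfl⟩
    obtain ⟨hi, hdi⟩ := (R.mem_in ⟨v, hv⟩ i).1 hi
    obtain ⟨hj, hdj⟩ := (R.mem_in ⟨v, hv⟩ j).1 hj
    rw [← (R.eq_of_src h hi).2 rfl] at hX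
    rw [← (R.eq_of_src h' hj).2 rfl] at hY
    rw [R.len_eq' hi, R.len_eq' hj]
    refine length_lt_of_edgePosLe hT (edge ⟨i, hi⟩).2 (edge ⟨j, hj⟩).2 (hdi.trans hdj.symm) ?_
      (hle hi hj) hX hY
    intro e
    exact hne (congrArg Fin.val (edge.injective (Subtype.ext e)))

theorem mem_searchOut (hT : IsText T) (o : PathOrder) {σ : ℕ} (hσ : ∀ a ∈ T, a ≤ σ) (δ : Side) :
    {x | x ∈ searchOut D (onNodes node fun v => (rep o .up v).length)
      (onNodes node fun v => (rep o .down v).length) (PrimaryIdx o edge)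
      (onNodes node (fun v => (rep o .up v).length) D.sink + 1) D.sink} = qirGLPF o T δ := by
  ext x
  have hroot : onNodes node (fun v => (rep o .down v).length) D.root =
      (rep o .down (Cdawg.root T)).length := by rw [R.root_eq, onNodes_symm]
  have hedge : ∀ i (hi : i < D.numE), (D.n + 1 -
      onNodes node (fun v => (rep o .up v).length) (D.src i) - D.len i -
      onNodes node (fun v => (rep o .down v).length) (D.dst i),
      onNodes node (fun v => (rep o .up v).length) (D.src i)) =
      (T.length + 1 - (viaEdge o (edge ⟨i, hi⟩).1).length,
        (rep o .up (edge ⟨i, hi⟩).1.src).length) := by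
    intro i hi
    rw [R.src_eq' hi, R.dst_eq' hi, R.len_eq' hi, onNodes_symm, onNodes_symm, R.n_eq]
    simp only [viaEdge, List.length_append, Prod.mk.injEq, and_true]
    omega
  rw [mem_qirGLPF_iff hT, Set.mem_ofPred_eq, (R.numGraph hT o hσ).mem_searchOut, hroot, R.n_eq]
  refine or_congr Iff.rfl ⟨?_, ?_⟩
  · rintro ⟨i, hi, hp, rfl⟩
    rw [primaryIdx_iff hi] at hp
    exact ⟨_, (edge ⟨i, hi⟩).2, hp, by rw [← hedge i hi, R.n_eq]⟩
  · rintro ⟨f, hf, hp, rfl⟩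
    have hi := (edge.symm ⟨f, hf⟩).2
    have he : (edge ⟨_, hi⟩).1 = f := by simp
    refine ⟨_, hi, ?_, ?_⟩
    · rw [primaryIdx_iff hi, he]
      exact hp
    · rw [← R.n_eq, hedge _ hi, he]
      simp [R.n_eq]

end SelfIndex.Represents

/-- Every node but the root is the destination of an edge. -/
theorem NumGraph.numV_le {D : SelfIndex} {o : PathOrder} {σ : ℕ} {up dn : ℕ → ℕ}
    {prim : ℕ → Prop} (G : NumGraph D o σ up dn prim) : D.numV ≤ D.numE + 1 := by
  have hsub : Finset.range D.numV ⊆ insert D.root ((Finset.range D.numE).image D.dst) := by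
    intro v hv
    rw [Finset.mem_range] at hv
    rw [Finset.mem_insert, Finset.mem_image]
    rcases (G.inPtr_mono v hv).eq_or_lt with h | h
    · exact Or.inl (G.in_empty v hv h)
    · obtain ⟨i, hi, hd, -⟩ := G.up_attained v hv h
      exact Or.inr ⟨i, Finset.mem_range.2 hi, hd⟩
  have h1 := Finset.card_le_card hsub
  have h2 := Finset.card_insert_le D.root ((Finset.range D.numE).image D.dst)
  have h3 := Finset.card_image_le (s := Finset.range D.numE) (f := D.dst)
  rw [Finset.card_range] at h1 h3
  omega

end Cdawg

/-! ### Assembly -/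

theorem mainTheorem2 :
    (∀ T : Str, IsText T → ∀ p ∈ Finset.Icc 1 T.length,
      GLPF .lex T p = PLCP T p ∧ GLPF .pos T p = LPF T p) ∧
    ∃ C : ℕ, ∀ (o : PathOrder) (T : Str) (σ : ℕ) (D : SelfIndex),
      IsText T → (∀ a ∈ T, a ≤ σ) → D.IsFor T →
        ∃ (τ : State Arr) (c : Cost),
          Exec (Alg.procs o) Alg.main D.init τ c ∧
          (∀ δ : Side, {x | x ∈ τ.out} = qirGLPF o T δ) ∧
          τ.out.Pairwise (fun x y => x.1 < y.1) ∧
          τ.out.length ≤ size T ∧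
          c.time ≤ C * size T ∧
          space D c τ.out ≤ C * size T ∧
          c.word ≤ C * (T.length + σ + size T) := by
  -- With `E = D.numE` one has `D.numV ≤ E + 1` and `1 ≤ E ≤ size T`. Time and stack are then at
  -- most `720 E` each, the 19 arrays `95 E`, the input `19 E` and the output `2 E`, so 1000 covers
  -- every bound.
  refine ⟨fun T _ p hp => ⟨GLPF_lex_eq_PLCP hp, GLPF_pos_eq_LPF hp⟩, 1000, ?_⟩
  rintro o T σ D hT hσ ⟨node, edge, R⟩
  have G := R.numGraph hT o hσ
  obtain ⟨τ, c, h1, ⟨h2, h3⟩, h4, h5⟩ := tri_main G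
  have hsort := R.searchOut_sorted hT o hσ
    (SelfIndex.Represents.onNodes node (fun v => (rep o .up v).length) D.sink + 1) D.sink G.sink_lt
  have hlen := G.length_searchOut_le hsort
  have hE := SelfIndex.Represents.numE_le_size edge
  have hE0 := G.numE_pos
  have hV := G.numV_le
  have hst := h1.stack_le_time
  have hcard : Fintype.card Arr = 19 := rfl
  have hn := R.n_eq
  refine ⟨τ, c, h1, fun δ => ?_, ?_, ?_, ?_, ?_, ?_⟩
  · rw [h4]
    exact R.mem_searchOut hT o hσ δ
  · rw [h4]
    exact hsort
  · rw [h4]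
    exact hlen.trans hE
  · omega
  · rw [space, SelfIndex.words, hcard, h4]
    omega
  · omega
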